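/- Let $\{Z(\mathbf s):\mathbf s\in\mathbb Z^2\}$ be a real-valued random field that is stationary of order four: $E Z(\mathbf s)^4<\infty$ and all joint moments of order at most four are translation invariant. Let $\gamma(\mathbf h)=\mathrm{Cov}(Z(\mathbf 0),Z(\mathbf h))$ and $\kappa(\mathbf h_1,\mathbf h_2,\mathbf h_3)=\mathrm{cum}(Z(\mathbf 0),Z(\mathbf h_1),Z(\mathbf h_2),Z(\mathbf h_3))$ be absolutely summable, and put, on $\Pi^2=[-\pi,\pi]^2$, $$f(\boldsymbol\omega)=(2\pi)^{-2}\sum_{\mathbf h}\gamma(\mathbf h)e^{-\iota\mathbf h^{T}\boldsymbol\omega},\qquad f_4(\boldsymbol\omega_1,\boldsymbol\omega_2,\boldsymbol\omega_3)=(2\pi)^{-6}\sum_{\mathbf h_1,\mathbf h_2,\mathbf h_3}\kappa(\mathbf h_1,\mathbf h_2,\mathbf h_3)e^{-\iota\sum_{\ell}\mathbf h_\ell^{T}\boldsymbol\omega_\ell}.$$ Let $\psi:\Pi^2\to\mathbb R$ be of bounded variation (in the sense of Hardy and Krause), and let $$M(\psi)=\int_{\Pi^2}\psi f,\quad \sigma_1^2=(2\pi)^2\int_{\Pi^2}\psi(\boldsymbol\omega)[\psi(\boldsymbol\omega)+\psi(-\boldsymbol\omega)]f^2(\boldsymbol\omega)\,d\boldsymbol\omega,$$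 $$\sigma_2^2=(2\pi)^2\int_{\Pi^2}\int_{\Pi^2}\psi(\boldsymbol\omega_1)\psi(\boldsymbol\omega_2)f_4(\boldsymbol\omega_1,\boldsymbol\omega_2,-\boldsymbol\omega_2)\,d\boldsymbol\omega_1\,d\boldsymbol\omega_2,\qquad \sigma^2=\sigma_1^2+\sigma_2^2 .$$ For $n=n_1n_2$ and $\mathbf j\in\mathbb Z^2$ let $$\mathcal I_{\mathbf j,n}(\boldsymbol\omega)=(2\pi)^{-2}n^{-1}\Big|\sum_{\mathbf s\in \mathbf j+\{1,\dots,n_1\}\times\{1,\dots,n_2\}}Z(\mathbf s)e^{-\iota\mathbf s^{T}\boldsymbol\omega}\Big|^2,\qquad \boldsymbol\omega_{\mathbf i,n}=(2\pi i_1/n_1,2\pi i_2/n_2),$$ $$\mathcal J_n=\prod_{k=1}^2\{-\lfloor (n_k-1)/2\rfloor,\dots,\lfloor n_k/2\rfloor\}\setminus\{(0,0)\},$$ $$\widehat M_{\mathbf j,n}=(2\pi)^2n^{-1}\sum_{\mathbf i\in\mathcal J_n}\psi(\boldsymbol\omega_{\mathbf i,n})\mathcal I_{\mathbf j,n}(\boldsymbol\omega_{\mathbf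 i,n}),\qquad H_{\mathbf j,n}=n^{1/2}(\widehat M_{\mathbf j,n}-M(\psi)).$$ Here and below $n\to\infty$ means that $n_1\to\infty$ and $n_2\to\infty$. Assume: 1. $H_{\mathbf 0,n}\to N(0,\sigma^2)$ in distribution. 2. For all integer families $\mathbf j^{(n)},\mathbf k^{(n)}\in\mathbb Z^2$ with $|j^{(n)}_i-k^{(n)}_i|/n_i\to\infty$ for $i=1,2$: $(H_{\mathbf j^{(n)},n},H_{\mathbf k^{(n)},n})\to N(\mathbf 0,\sigma^2 I_2)$ in distribution. 3. For all such $\mathbf j^{(n)},\mathbf k^{(n)}$ and all $\mathbf m_n\in\mathbb Z^2$ with $|m_{n,i}|\le n_i-\lfloor n_i/2\rfloor$ for which $\boldsymbol\omega_{\mathbf m_n,n}$ converges to a limit $\boldsymbol\omega$ with $0<|\omega_i|<\pi$, $i=1,2$: $(\mathcal I_{\mathbf j^{(n)},n}(\boldsymbol\omega_{\mathbf m_n,n}),\mathcal I_{\mathbf k^{(n)},n}(\boldsymbol\omega_{\mathbf m_n,n}))\to f(\boldsymbol\omega)(U_1,U_2)$ in distribution, with $U_1,U_2$ independent standard exponential.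 Let the block sizes $n_k^{(b)}\ge 1$ satisfy $1/n_k^{(b)}+n_k^{(b)}/n_k\to0$ for $k=1,2$, and let $b=n_1^{(b)}n_2^{(b)}$. Let $\ell$ run through the $L=(n_1-n_1^{(b)}+1)(n_2-n_2^{(b)}+1)$ translations in $\prod_k\{0,\dots,n_k-n_k^{(b)}\}$; let $\mathcal I^{(\ell)}$ and $\widehat M^{(\ell)}$ be the periodogram and the spectral mean statistic computed from the $n_1^{(b)}\times n_2^{(b)}$ block translated by $\ell$, with averages $\widetilde{\mathcal I}=L^{-1}\sum_\ell\mathcal I^{(\ell)}$ and $\widetilde M=L^{-1}\sum_\ell\widehat M^{(\ell)}$, and let $\mathcal J_b$, $\boldsymbol\omega_{\mathbf i,b}$ be the index set and frequencies for the block sizes. Put $$\widehat\sigma_n^2=L^{-1}\sum_\ell b(\widehat M^{(\ell)}-\widetilde M)^2,\qquad \widehat\sigma_{2,n}^2=\widehat\sigma_n^2-\widehat\sigma_{1,n}^2,$$ $$\widehat\sigma_{1,n}^2=b^{-1}(4\pi^2)^2\sum_{\mathbf i\in\mathcal J_b}\psi(\boldsymbol\omega_{\mathbf i,b})[\psi(\boldsymbol\omega_{\mathbf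 i,b})+\psi(\boldsymbol\omega_{-\mathbf i,b})]\,L^{-1}\sum_\ell(\mathcal I^{(\ell)}(\boldsymbol\omega_{\mathbf i,b})-\widetilde{\mathcal I}(\boldsymbol\omega_{\mathbf i,b}))^2 .$$ Then, as $n\to\infty$, $\widehat\sigma_{1,n}^2\to\sigma_1^2$, $\widehat\sigma_{2,n}^2\to\sigma_2^2$ and $\widehat\sigma_n^2\to\sigma^2=\sigma_1^2+\sigma_2^2$, all in probability. -/

import Mathlib

open MeasureTheory ProbabilityTheory Filter Topology

namespace SpatialSubsampling

noncomputable section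

/-- The frequency square `Π² = [-π, π]²`. -/
def freqSquare : Set (ℝ × ℝ) :=
  Set.Icc (-Real.pi) Real.pi ×ˢ Set.Icc (-Real.pi) Real.pi

/-- Bounded variation on `[-π, π]²` in the sense of Hardy and Krause: the sums of the absolute
mixed increments over all rectangular grids are bounded (finite Vitali variation), and all
one-dimensional sections have bounded variation. -/
def BoundedVariationSquare (ψ : ℝ × ℝ → ℝ) : Prop :=
  (∃ C : ℝ, ∀ u v : ℕ → ℝ, Monotone u → Monotone v →
    (∀ i, u i ∈ Set.Icc (-Real.pi) Real.pi) → (∀ i, v i ∈ Set.Icc (-Real.pi) Real.pi) →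
    ∀ p q : ℕ, ∑ i ∈ Finset.range p, ∑ j ∈ Finset.range q,
      |ψ (u (i + 1), v (j + 1)) - ψ (u (i + 1), v j) - ψ (u i, v (j + 1)) + ψ (u i, v j)| ≤ C) ∧
  (∀ x ∈ Set.Icc (-Real.pi) Real.pi,
    BoundedVariationOn (fun y => ψ (x, y)) (Set.Icc (-Real.pi) Real.pi)) ∧
  (∀ y ∈ Set.Icc (-Real.pi) Real.pi,
    BoundedVariationOn (fun x => ψ (x, y)) (Set.Icc (-Real.pi) Real.pi))

/-- The inner product `hᵀω` of a lattice vector and a frequency. -/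
def dotFreq (h : ℤ × ℤ) (w : ℝ × ℝ) : ℝ := (h.1 : ℝ) * w.1 + (h.2 : ℝ) * w.2

section Field

variable {Ω : Type*} [MeasurableSpace Ω] (P : Measure Ω) (Z : ℤ × ℤ → Ω → ℝ)

/-- Stationarity of order four: finite fourth moments, and all joint moments of order at most
four are invariant under translation. -/
def FourthOrderStationary : Prop :=
  (∀ s, MemLp (Z s) 4 P) ∧
  ∀ k ≤ 4, ∀ (s : Fin k → ℤ × ℤ) (h : ℤ × ℤ),
    ∫ x, ∏ i, Z (s i + h) x ∂P = ∫ x, ∏ i, Z (s i) x ∂P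

/-- The autocovariance `Cov(Z(0), Z(h))`. -/
def autocov (h : ℤ × ℤ) : ℝ := cov[Z 0, Z h; P]

/-- The joint fourth-order cumulant of four real random variables. -/
def cumulant4 (X₁ X₂ X₃ X₄ : Ω → ℝ) : ℝ :=
  (∫ x, (X₁ x - P[X₁]) * (X₂ x - P[X₂]) * (X₃ x - P[X₃]) * (X₄ x - P[X₄]) ∂P)
    - cov[X₁, X₂; P] * cov[X₃, X₄; P]
    - cov[X₁, X₃; P] * cov[X₂, X₄; P]
    - cov[X₁, X₄; P] * cov[X₂, X₃; P]

/-- `cum(Z(0), Z(h₁), Z(h₂), Z(h₃))`, for `h = (h₁, h₂, h₃)`. -/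
def fieldCumulant4 (h : (ℤ × ℤ) × (ℤ × ℤ) × (ℤ × ℤ)) : ℝ :=
  cumulant4 P (Z 0) (Z h.1) (Z h.2.1) (Z h.2.2)

/-- The spectral density `f`; the series is real because the autocovariance is even. -/
def specDensity (w : ℝ × ℝ) : ℝ :=
  ((2 * Real.pi) ^ 2)⁻¹ *
    (∑' h : ℤ × ℤ, (autocov P Z h : ℂ) * Complex.exp (-Complex.I * (dotFreq h w : ℂ))).re

/-- The fourth-order cumulant spectral density `f₄` of a random field on `ℤ²`, with the
normalization `(2π)^{-2(4-1)}`. -/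
def specDensity4 (w₁ w₂ w₃ : ℝ × ℝ) : ℂ :=
  (((2 * Real.pi) ^ 6)⁻¹ : ℝ) *
    ∑' h : (ℤ × ℤ) × (ℤ × ℤ) × (ℤ × ℤ), (fieldCumulant4 P Z h : ℂ) *
      Complex.exp (-Complex.I *
        ((dotFreq h.1 w₁ + dotFreq h.2.1 w₂ + dotFreq h.2.2 w₃ : ℝ) : ℂ))

/-- The spectral mean `M(ψ)`. -/
def specMean (ψ : ℝ × ℝ → ℝ) : ℝ :=
  ∫ w in freqSquare, ψ w * specDensity P Z w

/-- The variance component `σ₁²(ψ)`. -/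
def sigmaSq1 (ψ : ℝ × ℝ → ℝ) : ℝ :=
  (2 * Real.pi) ^ 2 *
    ∫ w in freqSquare, ψ w * (ψ w + ψ (-w)) * specDensity P Z w ^ 2

/-- The variance component `σ₂²(ψ)`; under stationarity `f₄(ω₁, ω₂, -ω₂)` is real. -/
def sigmaSq2 (ψ : ℝ × ℝ → ℝ) : ℝ :=
  (2 * Real.pi) ^ 2 *
    (∫ w₁ in freqSquare, ∫ w₂ in freqSquare,
      (ψ w₁ : ℂ) * (ψ w₂ : ℂ) * specDensity4 P Z w₁ w₂ (-w₂)).re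

/-- The total limit variance `σ²(ψ) = σ₁²(ψ) + σ₂²(ψ)`. -/
def sigmaSq (ψ : ℝ × ℝ → ℝ) : ℝ := sigmaSq1 P Z ψ + sigmaSq2 P Z ψ

/-- The number `n = n₁ n₂` of sites of an `n₁ × n₂` region, as a real number. -/
def size (n : ℕ × ℕ) : ℝ := (n.1 : ℝ) * (n.2 : ℝ)

/-- The lattice points of the translated region `j + [1, n₁] × [1, n₂]`. -/
def region (j : ℤ × ℤ) (n : ℕ × ℕ) : Finset (ℤ × ℤ) :=
  Finset.Icc (j.1 + 1) (j.1 + n.1) ×ˢ Finset.Icc (j.2 + 1) (j.2 + n.2)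

/-- The Fourier frequency `ω_{j,n} = (2π j₁ / n₁, 2π j₂ / n₂)`. -/
def fourierFreq (n : ℕ × ℕ) (j : ℤ × ℤ) : ℝ × ℝ :=
  (2 * Real.pi * (j.1 : ℝ) / (n.1 : ℝ), 2 * Real.pi * (j.2 : ℝ) / (n.2 : ℝ))

/-- The index set of the nonzero Fourier frequencies in `(-π, π]²`:
`∏ᵢ {-⌊(nᵢ - 1)/2⌋, …, ⌊nᵢ/2⌋}` without `(0, 0)` (integer division rounds down here). -/
def fourierIndex (n : ℕ × ℕ) : Finset (ℤ × ℤ) :=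
  (Finset.Icc (-(((n.1 : ℤ) - 1) / 2)) ((n.1 : ℤ) / 2) ×ˢ
    Finset.Icc (-(((n.2 : ℤ) - 1) / 2)) ((n.2 : ℤ) / 2)).erase (0, 0)

/-- The periodogram at frequency `w`, computed from the data in `j + [1, n₁] × [1, n₂]`. -/
def periodogram (j : ℤ × ℤ) (n : ℕ × ℕ) (w : ℝ × ℝ) (x : Ω) : ℝ :=
  ((2 * Real.pi) ^ 2)⁻¹ * (size n)⁻¹ *
    ‖∑ s ∈ region j n, (Z s x : ℂ) * Complex.exp (-Complex.I * (dotFreq s w : ℂ))‖ ^ 2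

/-- The spectral mean statistic computed from the data in `j + [1, n₁] × [1, n₂]`. -/
def specMeanStat (ψ : ℝ × ℝ → ℝ) (j : ℤ × ℤ) (n : ℕ × ℕ) (x : Ω) : ℝ :=
  (2 * Real.pi) ^ 2 * (size n)⁻¹ *
    ∑ i ∈ fourierIndex n, ψ (fourierFreq n i) * periodogram Z j n (fourierFreq n i) x

/-- `H_{j,n}(ψ) = n^{1/2} (M̂_{j,n}(ψ) - M(ψ))`; `H_n(ψ)` is the case `j = 0`. -/
def hStat (ψ : ℝ × ℝ → ℝ) (j : ℤ × ℤ) (n : ℕ × ℕ) (x : Ω) : ℝ :=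
  Real.sqrt (size n) * (specMeanStat Z ψ j n x - specMean P Z ψ)

/-- The translations `j` for which `j + [1, b₁] × [1, b₂]` lies inside `[1, n₁] × [1, n₂]`;
there are `L = (n₁ - b₁ + 1)(n₂ - b₂ + 1)` of them when `b ≤ n`. -/
def blockShifts (n b : ℕ × ℕ) : Finset (ℤ × ℤ) :=
  Finset.Icc 0 ((n.1 : ℤ) - b.1) ×ˢ Finset.Icc 0 ((n.2 : ℤ) - b.2)

/-- The average `L⁻¹ ∑_ℓ g(ℓ)` over all data blocks. -/
def blockMean (n b : ℕ × ℕ) (g : ℤ × ℤ → ℝ) : ℝ :=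
  ((blockShifts n b).card : ℝ)⁻¹ * ∑ l ∈ blockShifts n b, g l

/-- The subsampling variance estimator `σ̂²_n` with `b₁ × b₂` blocks. -/
def sigmaHatSq (ψ : ℝ × ℝ → ℝ) (n b : ℕ × ℕ) (x : Ω) : ℝ :=
  blockMean n b fun l =>
    size b * (specMeanStat Z ψ l b x - blockMean n b fun l' => specMeanStat Z ψ l' b x) ^ 2

/-- The subsampling estimator `σ̂²_{1,n}` of the first variance component. -/
def sigmaHatSq1 (ψ : ℝ × ℝ → ℝ) (n b : ℕ × ℕ) (x : Ω) : ℝ :=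
  (size b)⁻¹ * (4 * Real.pi ^ 2) ^ 2 *
    ∑ i ∈ fourierIndex b,
      ψ (fourierFreq b i) * (ψ (fourierFreq b i) + ψ (fourierFreq b (-i))) *
        blockMean n b fun l =>
          (periodogram Z l b (fourierFreq b i) x -
            blockMean n b fun l' => periodogram Z l' b (fourierFreq b i) x) ^ 2

/-- The subsampling estimator `σ̂²_{2,n} = σ̂²_n - σ̂²_{1,n}` of the second component. -/
def sigmaHatSq2 (ψ : ℝ × ℝ → ℝ) (n b : ℕ × ℕ) (x : Ω) : ℝ :=
  sigmaHatSq Z ψ n b x - sigmaHatSq1 Z ψ n b x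

end Field

/-- Two families of translations, indexed by the region sizes `(n₁, n₂)`, are well separated:
`|jᵢ⁽ⁿ⁾ - kᵢ⁽ⁿ⁾| / nᵢ → ∞` for `i = 1, 2` as `n₁, n₂ → ∞`. -/
def WellSeparated (j k : ℕ × ℕ → ℤ × ℤ) : Prop :=
  Tendsto (fun n : ℕ × ℕ => |((j n).1 : ℝ) - ((k n).1 : ℝ)| / (n.1 : ℝ)) atTop atTop ∧
  Tendsto (fun n : ℕ × ℕ => |((j n).2 : ℝ) - ((k n).2 : ℝ)| / (n.2 : ℝ)) atTop atTop

instance isProbabilityMeasure_expMeasure_one : IsProbabilityMeasure (expMeasure 1) :=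
  isProbabilityMeasure_expMeasure one_pos

section Assumptions

variable {Ω : Type*} [MeasurableSpace Ω] (P : Measure Ω) [IsProbabilityMeasure P]
  (Z : ℤ × ℤ → Ω → ℝ)

/-- `H_n(ψ)` converges in distribution to `N(0, σ²(ψ))` as `n₁, n₂ → ∞`. -/
def LimitLaw (ψ : ℝ × ℝ → ℝ) : Prop :=
  TendstoInDistribution (fun (n : ℕ × ℕ) x => hStat P Z ψ 0 n x) atTop
    (id : ℝ → ℝ) (fun _ => P) (gaussianReal 0 (sigmaSq P Z ψ).toNNReal)

/-- On well-separated regions the statistics `H` are jointly asymptotically normal with mean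
zero and covariance `σ²(ψ) I₂`. -/
def SeparatedLimitLaw (ψ : ℝ × ℝ → ℝ) : Prop :=
  ∀ j k : ℕ × ℕ → ℤ × ℤ, WellSeparated j k →
    TendstoInDistribution
      (fun (n : ℕ × ℕ) x => (hStat P Z ψ (j n) n x, hStat P Z ψ (k n) n x)) atTop
      (id : ℝ × ℝ → ℝ × ℝ) (fun _ => P)
      ((gaussianReal 0 (sigmaSq P Z ψ).toNNReal).prod
        (gaussianReal 0 (sigmaSq P Z ψ).toNNReal))

/-- On well-separated regions, the periodograms at Fourier frequencies converging to
`w`, `0 < |wᵢ| < π`, are jointly asymptotically distributed as `f(w) (U₁, U₂)` with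
independent standard exponential `U₁, U₂`. -/
def SeparatedPeriodogramLaw : Prop :=
  ∀ (m : ℕ × ℕ → ℤ × ℤ) (w : ℝ × ℝ),
    (∀ n : ℕ × ℕ, |(m n).1| ≤ (n.1 : ℤ) - (n.1 : ℤ) / 2 ∧
      |(m n).2| ≤ (n.2 : ℤ) - (n.2 : ℤ) / 2) →
    Tendsto (fun n : ℕ × ℕ => fourierFreq n (m n)) atTop (𝓝 w) →
    0 < |w.1| → |w.1| < Real.pi → 0 < |w.2| → |w.2| < Real.pi →
    ∀ j k : ℕ × ℕ → ℤ × ℤ, WellSeparated j k →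
      TendstoInDistribution
        (fun (n : ℕ × ℕ) x => (periodogram Z (j n) n (fourierFreq n (m n)) x,
          periodogram Z (k n) n (fourierFreq n (m n)) x)) atTop
        (fun u : ℝ × ℝ => (specDensity P Z w * u.1, specDensity P Z w * u.2)) (fun _ => P)
        ((expMeasure 1).prod (expMeasure 1))

end Assumptions

end

end SpatialSubsampling

open SpatialSubsampling

/-! Both estimators are built from sample variances, over overlapping blocks, of a statistic X whose
values at well-separated blocks are asymptotically independent with a common limit law μ. The core
is a law of large numbers, `SeparatedLaw.tendsto_sample_variance`: if moreover the second moment of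
X does not depend on the translation and converges to that of μ, the sample variance converges in L¹
to the variance of μ. For a bounded continuous function of X, the mean squared error of the block
average is a double average of covariances over pairs of blocks. Pairs closer than a fixed multiple
of the block size are a vanishing fraction of all pairs, and the other covariances are uniformly
small, because a limit along every well-separated family is a limit uniform in the separation
(`eventually_of_wellSeparated`). Convergence of second moments controls the truncation error and
carries this over to X and X².

It remains to obtain the second moments, which convergence in distribution alone does not provide.
The periodogram at a nonzero Fourier frequency ignores the mean of the field, so fourth moments of
the centered field, expanded in covariances and cumulants, give n Var(M̂) explicitly. By Parseval
the matrix of covariances of the discrete Fourier transform is nearly diagonal, with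
pseudo-covariances concentrated at the reflected index; this part tends to σ₁². The cumulant part
becomes an absolutely convergent series in discrete Fourier coefficients of ψ and tends to σ₂². The
bias √n (E M̂ - M(ψ)) is never estimated: a bounded variance and a limit law together force the
means to converge to the mean of the limit, here zero (`tendsto_mean_of_tendstoInDistribution`).
Hence E H_n² → σ², and the law of large numbers gives σ̂² → σ².

For σ̂₁², the same law of large numbers applies to the periodogram at the grid frequency next to
almost every ω: its second moment tends to 2f², and f times a standard exponential has variance f².
The sum over Fourier frequencies is the integral of a step function, so dominated convergence
finishes, using a uniform bound on second moments of the periodogram. Bounded Hardy–Krause variation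
enters only through boundedness and almost everywhere continuity of ψ: its increments are dominated
by those of monotone functions of each coordinate. The claim for σ̂₂² follows by subtraction. -/

namespace SpatialSubsampling

set_option linter.unusedSectionVars false

/-! ### Fourier grids and Riemann sums over the frequency square -/

/-- The one-dimensional index range `{-⌊(n - 1)/2⌋, …, ⌊n/2⌋}`. -/
noncomputable def indexRange (n : ℕ) : Finset ℤ := Finset.Icc (-(((n : ℤ) - 1) / 2)) ((n : ℤ) / 2)

/-- The index set of all Fourier frequencies in `(-π, π]²`, including zero. -/
noncomputable def fullIndex (n : ℕ × ℕ) : Finset (ℤ × ℤ) := indexRange n.1 ×ˢ indexRange n.2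

lemma fourierIndex_eq_erase (n : ℕ × ℕ) : fourierIndex n = (fullIndex n).erase 0 := rfl

lemma fourierIndex_subset (n : ℕ × ℕ) : fourierIndex n ⊆ fullIndex n :=
  Finset.erase_subset _ _

lemma mem_indexRange {n : ℕ} {i : ℤ} :
    i ∈ indexRange n ↔ -(((n : ℤ) - 1) / 2) ≤ i ∧ i ≤ (n : ℤ) / 2 := Finset.mem_Icc

lemma mem_fullIndex {n : ℕ × ℕ} {i : ℤ × ℤ} :
    i ∈ fullIndex n ↔ i.1 ∈ indexRange n.1 ∧ i.2 ∈ indexRange n.2 := Finset.mem_product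

lemma card_indexRange (n : ℕ) : (indexRange n).card = n := by
  rw [indexRange, Int.card_Icc]; omega

lemma card_fullIndex (n : ℕ × ℕ) : ((fullIndex n).card : ℝ) = size n := by
  simp [fullIndex, Finset.card_product, card_indexRange, size]

/-- The index of the Fourier frequency attached to the cell of the partition of `[-π, π)` into
`n` equal intervals that contains `x`. -/
noncomputable def cellIndex (n : ℕ) (x : ℝ) : ℤ :=
  ⌊(x + Real.pi) * n / (2 * Real.pi)⌋ - ((n : ℤ) - 1) / 2

/-- The two-dimensional version of `cellIndex`. -/
noncomputable def gridIndex (n : ℕ × ℕ) (w : ℝ × ℝ) : ℤ × ℤ :=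
  (cellIndex n.1 w.1, cellIndex n.2 w.2)

lemma measurable_cellIndex (n : ℕ) : Measurable (cellIndex n) := by
  unfold cellIndex
  exact (Int.measurable_floor.comp (by fun_prop)).sub_const _

lemma measurable_gridIndex (n : ℕ × ℕ) : Measurable (gridIndex n) :=
  ((measurable_cellIndex _).comp measurable_fst).prodMk
    ((measurable_cellIndex _).comp measurable_snd)

lemma cellIndex_mem {n : ℕ} (hn : 0 < n) {x : ℝ} (hx : x ∈ Set.Ico (-Real.pi) Real.pi) :
    cellIndex n x ∈ indexRange n := by
  have hπ := Real.pi_pos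
  have hn' : (0 : ℝ) < n := by exact_mod_cast hn
  have h0 : (0 : ℤ) ≤ ⌊(x + Real.pi) * n / (2 * Real.pi)⌋ := by
    apply Int.floor_nonneg.mpr
    have : 0 ≤ x + Real.pi := by linarith [hx.1]
    positivity
  have h1 : ⌊(x + Real.pi) * n / (2 * Real.pi)⌋ < (n : ℤ) := by
    rw [Int.floor_lt, div_lt_iff₀ (by positivity)]
    push_cast
    nlinarith [hx.2]
  rw [mem_indexRange, cellIndex]
  omega

/-- The offset `((n : ℤ) - 1) / 2` turns the cell numbers 0, …, n - 1 into exactly `indexRange n`;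
half-open cells make this a true partition, and the lengths can be read off. -/
lemma cellIndex_eq_iff {n : ℕ} (hn : 0 < n) {i : ℤ} (hi : i ∈ indexRange n) (x : ℝ) :
    (x ∈ Set.Ico (-Real.pi) Real.pi ∧ cellIndex n x = i) ↔
      x ∈ Set.Ico (-Real.pi + 2 * Real.pi / n * ((i + ((n : ℤ) - 1) / 2 : ℤ) : ℝ))
        (-Real.pi + 2 * Real.pi / n * ((i + ((n : ℤ) - 1) / 2 : ℤ) : ℝ) + 2 * Real.pi / n) := by
  have hπ := Real.pi_pos
  have hn' : (0 : ℝ) < n := by exact_mod_cast hn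
  rw [mem_indexRange] at hi
  obtain ⟨k, hk⟩ : ∃ k : ℤ, k = i + ((n : ℤ) - 1) / 2 := ⟨_, rfl⟩
  have hk0 : 0 ≤ k := by omega
  have hk1 : k + 1 ≤ n := by omega
  have hk0' : (0 : ℝ) ≤ k := by exact_mod_cast hk0
  have hk1' : (k : ℝ) + 1 ≤ n := by exact_mod_cast hk1
  have e : cellIndex n x = i ↔ ⌊(x + Real.pi) * n / (2 * Real.pi)⌋ = k := by
    rw [cellIndex]; omega
  rw [e, ← hk, Int.floor_eq_iff, le_div_iff₀ (by positivity), div_lt_iff₀ (by positivity)]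
  have e1 : 2 * Real.pi / n * (k : ℝ) * n = 2 * Real.pi * k := by field_simp
  have e2 : 2 * Real.pi / n * n = 2 * Real.pi := by field_simp
  simp only [Set.mem_Ico]
  constructor
  · rintro ⟨-, h1, h2⟩
    constructor
    · refine le_of_mul_le_mul_right ?_ hn'
      nlinarith
    · refine lt_of_mul_lt_mul_right ?_ hn'.le
      nlinarith
  · rintro ⟨h1, h2⟩
    have h1' := mul_le_mul_of_nonneg_right h1 hn'.le
    have h2' := mul_lt_mul_of_pos_right h2 hn'
    refine ⟨⟨?_, ?_⟩, by nlinarith, by nlinarith⟩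
    · refine le_of_mul_le_mul_right ?_ hn'
      nlinarith
    · refine lt_of_mul_lt_mul_right ?_ hn'.le
      nlinarith

/-- The half-open version of the frequency square. -/
def freqSquareIco : Set (ℝ × ℝ) :=
  Set.Ico (-Real.pi) Real.pi ×ˢ Set.Ico (-Real.pi) Real.pi

/-- The cells are half-open and tile `[-π, π)²`; the missing edges are null. -/
lemma restrict_freqSquare :
    (volume : Measure (ℝ × ℝ)).restrict freqSquare = volume.restrict freqSquareIco := by
  rw [freqSquare, freqSquareIco, Measure.volume_eq_prod, ← Measure.prod_restrict,
    ← Measure.prod_restrict, Measure.restrict_congr_set Ico_ae_eq_Icc]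

lemma measurableSet_freqSquare : MeasurableSet freqSquare :=
  measurableSet_Icc.prod measurableSet_Icc

instance isFiniteMeasure_freqSquare :
    IsFiniteMeasure ((volume : Measure (ℝ × ℝ)).restrict freqSquare) :=
  ⟨by
    rw [Measure.restrict_apply_univ, freqSquare, Measure.volume_eq_prod, Measure.prod_prod]
    exact ENNReal.mul_lt_top (by simp) (by simp)⟩

/-- The cells have equal area, so a normalized sum over the Fourier grid is exactly the integral of
a step function. Limits of such sums thereby become a matter of dominated convergence. -/
lemma setIntegral_gridIndex {E : Type*} [NormedAddCommGroup E] [NormedSpace ℝ E]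
    [CompleteSpace E] {n : ℕ × ℕ} (h1 : 0 < n.1) (h2 : 0 < n.2) (T : ℤ × ℤ → E) :
    ∫ w in freqSquare, T (gridIndex n w) =
      ((2 * Real.pi) ^ 2 * (size n)⁻¹) • ∑ i ∈ fullIndex n, T i := by
  have hπ := Real.pi_pos
  have h1' : (0 : ℝ) < n.1 := by exact_mod_cast h1
  have h2' : (0 : ℝ) < n.2 := by exact_mod_cast h2
  let s : ℤ × ℤ → Set (ℝ × ℝ) := fun i => freqSquareIco ∩ gridIndex n ⁻¹' {i}
  have hs : ∀ i, MeasurableSet (s i) := fun i =>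
    (measurableSet_Ico.prod measurableSet_Ico).inter
      (measurable_gridIndex n (measurableSet_singleton i))
  have hU : freqSquareIco = ⋃ i ∈ fullIndex n, s i := by
    ext w
    simp only [Set.mem_iUnion, s, Set.mem_inter_iff, Set.mem_preimage, Set.mem_singleton_iff,
      exists_prop]
    constructor
    · intro hw
      exact ⟨gridIndex n w, mem_fullIndex.mpr ⟨cellIndex_mem h1 hw.1, cellIndex_mem h2 hw.2⟩,
        hw, rfl⟩
    · rintro ⟨i, -, hw, -⟩
      exact hw
  have hv : ∀ i ∈ fullIndex n, volume.real (s i) = (2 * Real.pi) ^ 2 * (size n)⁻¹ := by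
    intro i hi
    rw [mem_fullIndex] at hi
    have : s i = {x | x ∈ Set.Ico (-Real.pi) Real.pi ∧ cellIndex n.1 x = i.1} ×ˢ
        {x | x ∈ Set.Ico (-Real.pi) Real.pi ∧ cellIndex n.2 x = i.2} := by
      ext w
      simp only [s, freqSquareIco, Set.mem_inter_iff, Set.mem_prod, Set.mem_preimage,
        Set.mem_singleton_iff, Set.mem_ofPred_eq, gridIndex, Prod.ext_iff]
      tauto
    rw [this]
    simp_rw [cellIndex_eq_iff h1 hi.1, cellIndex_eq_iff h2 hi.2, Set.ofPred_mem_eq]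
    rw [Measure.volume_eq_prod, measureReal_prod_prod, Real.volume_real_Ico_of_le,
      Real.volume_real_Ico_of_le, size]
    · field_simp
      ring
    · linarith [show 0 < 2 * Real.pi / n.2 by positivity]
    · linarith [show 0 < 2 * Real.pi / n.1 by positivity]
  have hfin : ∀ i ∈ fullIndex n, volume (s i) ≠ ⊤ := by
    intro i hi htop
    have := hv i hi
    rw [measureReal_def, htop, size] at this
    simp only [ENNReal.toReal_top] at this
    have h3 : (0 : ℝ) < (2 * Real.pi) ^ 2 * ((n.1 : ℝ) * n.2)⁻¹ := by positivity
    linarith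
  have hcongr : ∀ i, Set.EqOn (fun w => T (gridIndex n w)) (fun _ => T i) (s i) := by
    intro i w hw
    have : gridIndex n w = i := hw.2
    simp [this]
  rw [restrict_freqSquare, hU, integral_biUnion_finset, Finset.smul_sum]
  · refine Finset.sum_congr rfl fun i hi => ?_
    rw [setIntegral_congr_fun (hs i) (hcongr i), setIntegral_const, hv i hi]
  · exact fun i _ => hs i
  · intro i _ j _ hij
    refine Set.disjoint_left.mpr fun w hw hw' => hij ?_
    exact (hw.2 : gridIndex n w = i).symm.trans hw'.2
  · intro i hi
    exact (integrableOn_congr_fun (hcongr i) (hs i)).mpr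
      (integrableOn_const (hfin i hi))

/-- With k the cell number and q the offset, x exceeds the left endpoint -π + 2πk/n by at most 2π/n,
while the frequency 2π(k - q)/n exceeds it by π - 2πq/n, which lies between π/n and 2π/n because n -
2 ≤ 2q ≤ n - 1. -/
lemma abs_fourierFreq_cell_sub_le {n : ℕ} (hn : 0 < n) (x : ℝ) :
    |2 * Real.pi * (cellIndex n x : ℝ) / n - x| ≤ 2 * Real.pi / n := by
  have hπ := Real.pi_pos
  have hn' : (0 : ℝ) < n := by exact_mod_cast hn
  set k := ⌊(x + Real.pi) * n / (2 * Real.pi)⌋ with hk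
  have h1 : (k : ℝ) ≤ (x + Real.pi) * n / (2 * Real.pi) := Int.floor_le _
  have h2 : (x + Real.pi) * n / (2 * Real.pi) < k + 1 := Int.lt_floor_add_one _
  rw [le_div_iff₀ (by positivity)] at h1
  rw [div_lt_iff₀ (by positivity)] at h2
  obtain ⟨q, hq⟩ : ∃ q : ℤ, q = ((n : ℤ) - 1) / 2 := ⟨_, rfl⟩
  have hq1 : 2 * q ≤ n - 1 := by omega
  have hq2 : (n : ℤ) - 2 ≤ 2 * q := by omega
  have hq1' : 2 * (q : ℝ) ≤ n - 1 := by exact_mod_cast hq1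
  have hq2' : (n : ℝ) - 2 ≤ 2 * q := by exact_mod_cast hq2
  have e : (cellIndex n x : ℝ) = k - q := by rw [cellIndex, ← hq, ← hk]; push_cast; ring
  rw [e, div_sub' hn'.ne', abs_div, abs_of_pos hn']
  refine div_le_div_of_nonneg_right ?_ hn'.le
  rw [abs_le]
  constructor <;> nlinarith

lemma tendsto_fst_atTop_prod : Tendsto (fun n : ℕ × ℕ => n.1) atTop atTop := by
  rw [← prod_atTop_atTop_eq]; exact tendsto_fst

lemma tendsto_snd_atTop_prod : Tendsto (fun n : ℕ × ℕ => n.2) atTop atTop := by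
  rw [← prod_atTop_atTop_eq]; exact tendsto_snd

lemma tendsto_cellIndex_freq (x : ℝ) :
    Tendsto (fun n : ℕ => 2 * Real.pi * (cellIndex n x : ℝ) / n) atTop (𝓝 x) := by
  rw [tendsto_iff_dist_tendsto_zero]
  refine squeeze_zero' (Eventually.of_forall fun _ => dist_nonneg) ?_
    (tendsto_const_div_atTop_nhds_zero_nat (2 * Real.pi))
  filter_upwards [eventually_gt_atTop 0] with n hn
  exact abs_fourierFreq_cell_sub_le hn x

lemma tendsto_fourierFreq_gridIndex (w : ℝ × ℝ) :
    Tendsto (fun n : ℕ × ℕ => fourierFreq n (gridIndex n w)) atTop (𝓝 w) :=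
  ((tendsto_cellIndex_freq w.1).comp tendsto_fst_atTop_prod).prodMk_nhds
    ((tendsto_cellIndex_freq w.2).comp tendsto_snd_atTop_prod)

lemma size_pos {n : ℕ × ℕ} (h1 : 0 < n.1) (h2 : 0 < n.2) : 0 < size n := by
  unfold size; positivity

lemma eventually_pos : ∀ᶠ n : ℕ × ℕ in atTop, 0 < n.1 ∧ 0 < n.2 :=
  (tendsto_fst_atTop_prod.eventually_gt_atTop 0).and (tendsto_snd_atTop_prod.eventually_gt_atTop 0)

/-- An interior frequency with nonzero coordinates. -/
def IsRegularFreq (w : ℝ × ℝ) : Prop :=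
  (0 < |w.1| ∧ |w.1| < Real.pi) ∧ (0 < |w.2| ∧ |w.2| < Real.pi)

lemma eventually_cellIndex {x : ℝ} (h0 : 0 < |x|) (hπ : |x| < Real.pi) :
    ∀ᶠ n : ℕ in atTop, cellIndex n x ∈ indexRange n ∧ -cellIndex n x ∈ indexRange n ∧
      cellIndex n x ≠ 0 := by
  have ht := tendsto_cellIndex_freq x
  have e1 := ht.abs.eventually_lt_const hπ
  have e2 := ht.abs.eventually_const_lt h0
  filter_upwards [e1, e2, eventually_gt_atTop 0] with n h1 h2 hn
  have hn' : (0 : ℝ) < n := by exact_mod_cast hn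
  have hpi := Real.pi_pos
  have hne : cellIndex n x ≠ 0 := by
    intro h; simp [h] at h2
  rw [abs_div, abs_mul, abs_of_pos hn', abs_of_pos (by positivity : 0 < 2 * Real.pi),
    div_lt_iff₀ hn'] at h1
  have h3 : 2 * |(cellIndex n x : ℝ)| < n := by
    refine lt_of_mul_lt_mul_left ?_ hpi.le
    linarith
  have h4 : 2 * |cellIndex n x| < (n : ℤ) := by exact_mod_cast h3
  have h5 := neg_abs_le (cellIndex n x)
  have h6 := le_abs_self (cellIndex n x)
  simp only [mem_indexRange]
  refine ⟨?_, ?_, hne⟩ <;> omega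

/-- The index range is not symmetric when n is even, but an interior frequency eventually has 2|i| <
n. Staying away from zero separates i from -i, which later makes the pseudo-covariance an
off-diagonal entry. -/
lemma eventually_gridIndex {w : ℝ × ℝ} (hw : IsRegularFreq w) :
    ∀ᶠ n : ℕ × ℕ in atTop, gridIndex n w ∈ fourierIndex n ∧ -gridIndex n w ∈ fourierIndex n ∧
      -gridIndex n w ≠ gridIndex n w := by
  filter_upwards [tendsto_fst_atTop_prod.eventually (eventually_cellIndex hw.1.1 hw.1.2),
    tendsto_snd_atTop_prod.eventually (eventually_cellIndex hw.2.1 hw.2.2)] with n h1 h2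
  simp only [fourierIndex_eq_erase, Finset.mem_erase, mem_fullIndex]
  refine ⟨⟨?_, h1.1, h2.1⟩, ⟨?_, h1.2.1, h2.2.1⟩, ?_⟩
  · intro h; exact h1.2.2 (congrArg Prod.fst h)
  · intro h; exact h1.2.2 (congrArg Prod.fst (neg_eq_zero.mp h))
  · intro h
    have : -cellIndex n.1 w.1 = cellIndex n.1 w.1 := congrArg Prod.fst h
    exact h1.2.2 (by omega)

lemma ae_fst_snd {p : ℝ → Prop} (hp : ∀ᵐ x ∂(volume : Measure ℝ), p x) :
    ∀ᵐ w ∂(volume : Measure (ℝ × ℝ)), p w.1 ∧ p w.2 := by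
  rw [Measure.volume_eq_prod]
  exact (Measure.quasiMeasurePreserving_fst.ae hp).and (Measure.quasiMeasurePreserving_snd.ae hp)

lemma ae_isRegularFreq :
    ∀ᵐ w ∂(volume : Measure (ℝ × ℝ)).restrict freqSquare, IsRegularFreq w := by
  rw [ae_restrict_iff' measurableSet_freqSquare]
  have hne : ∀ᵐ x ∂(volume : Measure ℝ), x ≠ 0 ∧ x ≠ Real.pi ∧ x ≠ -Real.pi := by
    simp only [ae_iff, not_and_or, not_not]
    refine Set.Countable.measure_zero (Set.Finite.countable ?_) _
    refine (Set.toFinite {0, Real.pi, -Real.pi}).subset ?_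
    intro x; simp
  filter_upwards [ae_fst_snd hne] with w hw hmem
  have key : ∀ x : ℝ, (x ≠ 0 ∧ x ≠ Real.pi ∧ x ≠ -Real.pi) → x ∈ Set.Icc (-Real.pi) Real.pi →
      0 < |x| ∧ |x| < Real.pi := by
    intro x hx hm
    exact ⟨abs_pos.mpr hx.1, abs_lt.mpr ⟨lt_of_le_of_ne hm.1 hx.2.2.symm,
      lt_of_le_of_ne hm.2 hx.2.1⟩⟩
  exact ⟨key _ hw.1 hmem.1, key _ hw.2 hmem.2⟩

/-- Averages over nonzero Fourier frequencies converge to integrals over the frequency square,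
for bounded summands that converge almost everywhere along the grid. -/
theorem tendsto_fourier_average {ι E : Type*} [NormedAddCommGroup E] [NormedSpace ℝ E]
    [CompleteSpace E] {l : Filter ι} [l.IsCountablyGenerated] {β : ι → ℕ × ℕ}
    (hβ : Tendsto β l atTop) (T : ι → ℤ × ℤ → E) (t : ℝ × ℝ → E) (C : ℝ)
    (hT : ∀ᶠ n in l, ∀ i ∈ fourierIndex (β n), ‖T n i‖ ≤ C)
    (ht : ∀ᵐ w ∂(volume : Measure (ℝ × ℝ)).restrict freqSquare,
      Tendsto (fun n => T n (gridIndex (β n) w)) l (𝓝 (t w))) :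
    Tendsto (fun n => (size (β n))⁻¹ • ∑ i ∈ fourierIndex (β n), T n i) l
      (𝓝 (((2 * Real.pi) ^ 2)⁻¹ • ∫ w in freqSquare, t w)) := by
  classical
  -- Extension by zero makes the bound hold at every index and lets the sum over the full grid, zero
  -- frequency included, agree with the sum over the nonzero frequencies.
  let T' : ι → ℤ × ℤ → E := fun n i => if i ∈ fourierIndex (β n) then T n i else 0
  have hC : ∀ᶠ n in l, ∀ i, ‖T' n i‖ ≤ |C| := by
    filter_upwards [hT] with n hn i
    by_cases hi : i ∈ fourierIndex (β n)
    · simpa [T', hi] using (hn i hi).trans (le_abs_self C)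
    · simp [T', hi]
  have hlim : Tendsto (fun n => ∫ w in freqSquare, T' n (gridIndex (β n) w)) l
      (𝓝 (∫ w in freqSquare, t w)) := by
    refine tendsto_integral_filter_of_dominated_convergence (fun _ => |C|) ?_ ?_
      (integrable_const _) ?_
    · refine Eventually.of_forall fun n => ?_
      have : StronglyMeasurable (T' n) := .of_discrete
      exact (this.comp_measurable (measurable_gridIndex _)).aestronglyMeasurable
    · filter_upwards [hC] with n hn
      exact Eventually.of_forall fun w => hn _
    · filter_upwards [ht, ae_isRegularFreq] with w hw hreg
      refine hw.congr' ?_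
      filter_upwards [hβ.eventually (eventually_gridIndex hreg)] with n hn
      simp [T', hn.1]
  refine (hlim.const_smul (((2 * Real.pi) ^ 2)⁻¹)).congr' ?_
  filter_upwards [hβ.eventually eventually_pos] with n hn
  have hπ := Real.pi_pos
  rw [setIntegral_gridIndex hn.1 hn.2, smul_smul, ← mul_assoc, inv_mul_cancel₀ (by positivity),
    one_mul]
  congr 1
  rw [← Finset.sum_subset (fourierIndex_subset (β n))]
  · exact Finset.sum_congr rfl fun i hi => by simp [T', hi]
  · intro i _ hi; simp [T', hi]

/-! ### Regularity of functions of bounded Hardy–Krause variation -/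

/-- The notion is symmetric in the coordinates, so an estimate for increments in the first variable
also serves for the second. -/
lemma BoundedVariationSquare.swap {ψ : ℝ × ℝ → ℝ} (h : BoundedVariationSquare ψ) :
    BoundedVariationSquare fun w => ψ w.swap := by
  obtain ⟨⟨C, hC⟩, h1, h2⟩ := h
  refine ⟨⟨C, fun u v hu hv hu' hv' p q => ?_⟩, h2, h1⟩
  rw [Finset.sum_comm]
  refine le_of_eq_of_le ?_ (hC v u hv hu hv' hu' q p)
  refine Finset.sum_congr rfl fun j _ => Finset.sum_congr rfl fun i _ => ?_
  simp only [Prod.swap_prod_mk]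
  congr 1
  ring

/-- Finite Vitali variation bounds the mixed increments over strips of varying heights. -/
lemma sum_abs_mixed_increment_le {ψ : ℝ × ℝ → ℝ} {C : ℝ}
    (hC : ∀ u v : ℕ → ℝ, Monotone u → Monotone v →
      (∀ i, u i ∈ Set.Icc (-Real.pi) Real.pi) → (∀ i, v i ∈ Set.Icc (-Real.pi) Real.pi) →
      ∀ p q : ℕ, ∑ i ∈ Finset.range p, ∑ j ∈ Finset.range q,
        |ψ (u (i + 1), v (j + 1)) - ψ (u (i + 1), v j) - ψ (u i, v (j + 1)) + ψ (u i, v j)| ≤ C)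
    {u : ℕ → ℝ} (hu : Monotone u) (hu' : ∀ i, u i ∈ Set.Icc (-Real.pi) Real.pi) (p : ℕ)
    {y : ℕ → ℝ} (hy : ∀ i, y i ∈ Set.Icc (-Real.pi) Real.pi) :
    ∑ i ∈ Finset.range p,
      |(ψ (u (i + 1), y i) - ψ (u i, y i)) - (ψ (u (i + 1), -Real.pi) - ψ (u i, -Real.pi))| ≤ C := by
  classical
  have hπ := Real.pi_pos
  -- All heights together with the base -π, sorted into one vertical grid `v` that stays constant
  -- after its last point.
  let S : Finset ℝ := insert (-Real.pi) ((Finset.range p).image y)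
  have hSne : S.Nonempty := ⟨_, Finset.mem_insert_self _ _⟩
  have hSmem : ∀ z ∈ S, z ∈ Set.Icc (-Real.pi) Real.pi := by
    intro z hz
    rcases Finset.mem_insert.mp hz with rfl | hz
    · exact ⟨le_rfl, by linarith⟩
    · obtain ⟨i, -, rfl⟩ := Finset.mem_image.mp hz
      exact hy i
  obtain ⟨q, hq⟩ : ∃ q, S.card = q + 1 := ⟨S.card - 1, by have := hSne.card_pos; omega⟩
  let e := S.orderIsoOfFin hq
  let v : ℕ → ℝ := fun j => e ⟨min j q, by omega⟩
  have hvS : ∀ j, v j ∈ S := fun j => (e _).2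
  have hv : Monotone v := by
    intro a b hab
    refine e.monotone ?_
    simp only [Fin.mk_le_mk]
    omega
  have hsurj : ∀ z ∈ S, ∃ k ≤ q, v k = z := by
    intro z hz
    obtain ⟨k, hk⟩ := e.surjective ⟨z, hz⟩
    refine ⟨k, by omega, ?_⟩
    have : (⟨min (k : ℕ) q, by omega⟩ : Fin (q + 1)) = k := by
      apply Fin.ext; simp only; omega
    simp only [v, this, hk]
  have hv0 : v 0 = -Real.pi := by
    obtain ⟨k, -, hk⟩ := hsurj (-Real.pi) (Finset.mem_insert_self _ _)
    exact le_antisymm (hk ▸ hv (Nat.zero_le k)) (hSmem _ (hvS 0)).1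
  refine le_trans (Finset.sum_le_sum fun i hi => ?_)
    (hC u v hu hv hu' (fun j => hSmem _ (hvS j)) p q)
  obtain ⟨k, hkq, hk⟩ := hsurj (y i)
    (Finset.mem_insert_of_mem (Finset.mem_image_of_mem y hi))
  -- The increment over the strip from the base to `y i` telescopes over grid rows; adding the
  -- remaining rows only increases the sum of absolute values.
  have htel := Finset.sum_range_sub (fun j => ψ (u (i + 1), v j) - ψ (u i, v j)) k
  simp only [hv0, hk] at htel
  rw [← htel]
  refine (Finset.abs_sum_le_sum_abs _ _).trans ?_
  refine le_trans (le_of_eq ?_) (Finset.sum_le_sum_of_subset_of_nonneg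
    (Finset.range_mono hkq) fun _ _ _ => abs_nonneg _)
  refine Finset.sum_congr rfl fun j _ => ?_
  congr 1
  ring

/-- A function of bounded Hardy–Krause variation has sections in the first variable whose
increments are dominated, uniformly in the second variable, by those of a monotone function. -/
lemma BoundedVariationSquare.exists_monotoneOn {ψ : ℝ × ℝ → ℝ} (h : BoundedVariationSquare ψ) :
    ∃ F : ℝ → ℝ, MonotoneOn F (Set.Icc (-Real.pi) Real.pi) ∧
      ∀ x ∈ Set.Icc (-Real.pi) Real.pi, ∀ x' ∈ Set.Icc (-Real.pi) Real.pi,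
      ∀ y ∈ Set.Icc (-Real.pi) Real.pi, |ψ (x, y) - ψ (x', y)| ≤ |F x - F x'| := by
  have hπ := Real.pi_pos
  set I := Set.Icc (-Real.pi) Real.pi with hI
  have hmem : -Real.pi ∈ I := ⟨le_rfl, by linarith⟩
  obtain ⟨⟨C, hC⟩, -, h2⟩ := h
  -- The section x ↦ ψ(x, ·) is regarded as a curve for the uniform distance. Once it has bounded
  -- variation, its variation function dominates all increments simultaneously in y.
  let Φ : ℝ → UniformFun I ℝ := fun x => UniformFun.ofFun fun y => ψ (x, y)
  have hdist : ∀ x x', edist (Φ x) (Φ x') = ⨆ y : I, edist (ψ (x, y)) (ψ (x', y)) :=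
    fun x x' => UniformFun.edist_def _ _
  set V := eVariationOn (fun x => ψ (x, -Real.pi)) I with hV
  have hVtop : V ≠ ⊤ := h2 _ hmem
  -- The height may change with the interval: each increment is compared with the one on the base
  -- line, the difference being paid for by the Vitali variation and the base line by its own
  -- variation.
  have hsum : ∀ (u : ℕ → ℝ), Monotone u → (∀ i, u i ∈ I) → ∀ p (y : ℕ → I),
      ∑ i ∈ Finset.range p, edist (ψ (u (i + 1), y i)) (ψ (u i, y i)) ≤ ENNReal.ofReal C + V := by
    intro u hu hu' p y
    have h3 := sum_abs_mixed_increment_le hC hu hu' p (y := fun i => y i) fun i => (y i).2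
    have h4 : ∑ i ∈ Finset.range p, edist (ψ (u (i + 1), -Real.pi)) (ψ (u i, -Real.pi)) ≤ V :=
      eVariationOn.sum_le hu hu'
    refine le_trans ?_ (add_le_add (ENNReal.ofReal_le_ofReal h3) h4)
    rw [ENNReal.ofReal_sum_of_nonneg fun _ _ => abs_nonneg _, ← Finset.sum_add_distrib]
    refine Finset.sum_le_sum fun i _ => ?_
    rw [edist_dist, edist_dist, ← ENNReal.ofReal_add (abs_nonneg _) dist_nonneg]
    refine ENNReal.ofReal_le_ofReal ?_
    rw [Real.dist_eq, Real.dist_eq]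
    have := abs_sub_abs_le_abs_sub (ψ (u (i + 1), y i) - ψ (u i, y i))
      (ψ (u (i + 1), -Real.pi) - ψ (u i, -Real.pi))
    linarith
  set B := ENNReal.ofReal C + V with hB
  have hBtop : B ≠ ⊤ := ENNReal.add_ne_top.mpr ⟨ENNReal.ofReal_ne_top, hVtop⟩
  have hbv : BoundedVariationOn Φ I := by
    refine ne_top_of_le_ne_top (ENNReal.mul_ne_top ENNReal.ofNat_ne_top hBtop : 2 * B ≠ ⊤) ?_
    refine iSup_le fun ⟨p, u, hu, hu'⟩ => ?_
    -- The supremum over y need not be attained; a height reaching half of it costs the factor 2.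
    -- Halving requires the distance to be finite, which is the one-interval case of `hsum`.
    have hch : ∀ i, ∃ y : I, edist (Φ (u (i + 1))) (Φ (u i)) ≤
        2 * edist (ψ (u (i + 1), y)) (ψ (u i, y)) := by
      intro i
      by_cases h0 : edist (Φ (u (i + 1))) (Φ (u i)) = 0
      · exact ⟨⟨_, hmem⟩, by simp [h0]⟩
      have hlt : edist (Φ (u (i + 1))) (Φ (u i)) ≠ ⊤ := by
        refine ne_top_of_le_ne_top hBtop ?_
        rw [hdist]
        refine iSup_le fun y => ?_
        refine le_trans ?_ (hsum (fun k => u (i + k)) (fun a b hab => hu (by omega))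
          (fun k => hu' _) 1 (fun _ => y))
        simp
      have hhalf := ENNReal.half_lt_self h0 hlt
      conv_rhs at hhalf => rw [hdist]
      obtain ⟨y, hy⟩ := lt_iSup_iff.mp hhalf
      refine ⟨y, ?_⟩
      rw [ENNReal.div_lt_iff (by simp) (by simp)] at hy
      rw [mul_comm]
      exact hy.le
    choose y hy using hch
    calc ∑ i ∈ Finset.range p, edist (Φ (u (i + 1))) (Φ (u i))
        ≤ ∑ i ∈ Finset.range p, 2 * edist (ψ (u (i + 1), y i)) (ψ (u i, y i)) :=
          Finset.sum_le_sum fun i _ => hy i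
      _ ≤ 2 * B := by
          rw [← Finset.mul_sum]
          exact mul_le_mul_right (hsum u hu hu' p y) 2
  have hloc := hbv.locallyBoundedVariationOn
  refine ⟨variationOnFromTo Φ I (-Real.pi), variationOnFromTo.monotoneOn hloc hmem, ?_⟩
  have key : ∀ x ∈ I, ∀ x' ∈ I, x ≤ x' → ∀ y ∈ I, |ψ (x, y) - ψ (x', y)| ≤
      variationOnFromTo Φ I (-Real.pi) x' - variationOnFromTo Φ I (-Real.pi) x := by
    intro x hx x' hx' hxx' y hy
    rw [sub_eq_of_eq_add' (variationOnFromTo.add hloc hmem hx hx').symm,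
      variationOnFromTo.eq_of_le _ _ hxx']
    have h1 : edist (ψ (x, y)) (ψ (x', y)) ≤ eVariationOn Φ (I ∩ Set.Icc x x') := by
      refine le_trans ?_ (eVariationOn.edist_le Φ ⟨hx, le_rfl, hxx'⟩ ⟨hx', hxx', le_rfl⟩)
      rw [hdist]
      exact le_iSup (fun y : I => edist (ψ (x, y)) (ψ (x', y))) ⟨y, hy⟩
    have h2 := ENNReal.toReal_mono (hloc x x' hx hx') h1
    rwa [edist_dist, ENNReal.toReal_ofReal dist_nonneg, Real.dist_eq] at h2
  intro x hx x' hx' y hy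
  rcases le_total x x' with hle | hle
  · rw [abs_sub_comm (variationOnFromTo Φ I (-Real.pi) x)]
    exact (key x hx x' hx' hle y hy).trans (le_abs_self _)
  · rw [abs_sub_comm]
    exact (key x' hx' x hx hle y hy).trans (le_abs_self _)

/-- The two points are joined by changing one coordinate at a time. -/
lemma BoundedVariationSquare.exists_dominating {ψ : ℝ × ℝ → ℝ} (h : BoundedVariationSquare ψ) :
    ∃ F G : ℝ → ℝ, MonotoneOn F (Set.Icc (-Real.pi) Real.pi) ∧
      MonotoneOn G (Set.Icc (-Real.pi) Real.pi) ∧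
      ∀ w ∈ freqSquare, ∀ w' ∈ freqSquare,
        |ψ w - ψ w'| ≤ |F w.1 - F w'.1| + |G w.2 - G w'.2| := by
  obtain ⟨F, hF, hF'⟩ := h.exists_monotoneOn
  obtain ⟨G, hG, hG'⟩ := h.swap.exists_monotoneOn
  refine ⟨F, G, hF, hG, fun w hw w' hw' => ?_⟩
  have h1 := hF' w.1 hw.1 w'.1 hw'.1 w.2 hw.2
  have h2 := hG' w.2 hw.2 w'.2 hw'.2 w'.1 hw'.1
  simp only [Prod.swap_prod_mk] at h2
  have : ψ w - ψ w' = (ψ (w.1, w.2) - ψ (w'.1, w.2)) + (ψ (w'.1, w.2) - ψ (w'.1, w'.2)) := by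
    simp
  rw [this]
  exact (abs_add_le _ _).trans (add_le_add h1 h2)

lemma BoundedVariationSquare.exists_bound {ψ : ℝ × ℝ → ℝ} (h : BoundedVariationSquare ψ) :
    ∃ B : ℝ, 0 ≤ B ∧ ∀ w ∈ freqSquare, |ψ w| ≤ B := by
  have hπ := Real.pi_pos
  obtain ⟨F, G, hF, hG, hFG⟩ := h.exists_dominating
  have hl : -Real.pi ∈ Set.Icc (-Real.pi) Real.pi := ⟨le_rfl, by linarith⟩
  have hr : Real.pi ∈ Set.Icc (-Real.pi) Real.pi := ⟨by linarith, le_rfl⟩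
  refine ⟨|ψ (-Real.pi, -Real.pi)| + ((F Real.pi - F (-Real.pi)) + (G Real.pi - G (-Real.pi))),
    ?_, fun w hw => ?_⟩
  · have h1 := hF hl hr (by linarith)
    have h2 := hG hl hr (by linarith)
    have := abs_nonneg (ψ (-Real.pi, -Real.pi))
    linarith
  · have h1 := hFG w hw (-Real.pi, -Real.pi) ⟨hl, hl⟩
    have h2 := hF hl hw.1 hw.1.1
    have h3 := hG hl hw.2 hw.2.1
    have h4 := hF hw.1 hr hw.1.2
    have h5 := hG hw.2 hr hw.2.2
    simp only at h1
    rw [abs_of_nonneg (sub_nonneg.mpr h2), abs_of_nonneg (sub_nonneg.mpr h3)] at h1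
    have := abs_sub_abs_le_abs_sub (ψ w) (ψ (-Real.pi, -Real.pi))
    linarith

lemma neg_mem_freqSquare {w : ℝ × ℝ} (hw : w ∈ freqSquare) : -w ∈ freqSquare :=
  ⟨⟨by simpa using hw.1.2, by simpa using neg_le_neg hw.1.1⟩,
    ⟨by simpa using hw.2.2, by simpa using neg_le_neg hw.2.1⟩⟩

/-- A monotone function has countably many discontinuities, and reflection preserves null sets. The
reflected point is included because σ₁² involves ψ(-ω). -/
lemma ae_continuousWithinAt_of_monotoneOn {F : ℝ → ℝ}
    (hF : MonotoneOn F (Set.Icc (-Real.pi) Real.pi)) :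
    ∀ᵐ x ∂(volume : Measure ℝ), (x ∈ Set.Icc (-Real.pi) Real.pi →
      ContinuousWithinAt F (Set.Icc (-Real.pi) Real.pi) x) ∧
      (-x ∈ Set.Icc (-Real.pi) Real.pi →
      ContinuousWithinAt F (Set.Icc (-Real.pi) Real.pi) (-x)) := by
  have h1 : ∀ᵐ x ∂(volume : Measure ℝ), x ∈ Set.Icc (-Real.pi) Real.pi →
      ContinuousWithinAt F (Set.Icc (-Real.pi) Real.pi) x := by
    simp only [ae_iff, Classical.not_imp]
    exact hF.countable_not_continuousWithinAt.measure_zero _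
  exact h1.and ((Measure.measurePreserving_neg (volume : Measure ℝ)).quasiMeasurePreserving.ae h1)

/-- A function of bounded Hardy–Krause variation is continuous within the square at almost all
`w` and `-w`. -/
lemma BoundedVariationSquare.ae_continuousWithinAt {ψ : ℝ × ℝ → ℝ}
    (h : BoundedVariationSquare ψ) :
    ∀ᵐ w ∂(volume : Measure (ℝ × ℝ)).restrict freqSquare,
      ContinuousWithinAt ψ freqSquare w ∧ ContinuousWithinAt ψ freqSquare (-w) := by
  obtain ⟨F, G, hF, hG, hFG⟩ := h.exists_dominating
  have key : ∀ w ∈ freqSquare, ContinuousWithinAt F (Set.Icc (-Real.pi) Real.pi) w.1 →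
      ContinuousWithinAt G (Set.Icc (-Real.pi) Real.pi) w.2 →
      ContinuousWithinAt ψ freqSquare w := by
    intro w hw h1 h2
    have m1 : Tendsto (fun v : ℝ × ℝ => v.1) (𝓝[freqSquare] w)
        (𝓝[Set.Icc (-Real.pi) Real.pi] w.1) :=
      (continuous_fst.continuousWithinAt).tendsto_nhdsWithin fun v hv => hv.1
    have m2 : Tendsto (fun v : ℝ × ℝ => v.2) (𝓝[freqSquare] w)
        (𝓝[Set.Icc (-Real.pi) Real.pi] w.2) :=
      (continuous_snd.continuousWithinAt).tendsto_nhdsWithin fun v hv => hv.2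
    have t1 := ((h1.tendsto.comp m1).sub_const (F w.1)).abs
    have t2 := ((h2.tendsto.comp m2).sub_const (G w.2)).abs
    have t3 := t1.add t2
    simp only [sub_self, abs_zero, add_zero] at t3
    rw [ContinuousWithinAt, tendsto_iff_dist_tendsto_zero]
    refine squeeze_zero' (Eventually.of_forall fun _ => dist_nonneg) ?_ t3
    filter_upwards [self_mem_nhdsWithin] with v hv
    exact hFG v hv w hw
  rw [ae_restrict_iff' measurableSet_freqSquare]
  filter_upwards [ae_fst_snd (ae_continuousWithinAt_of_monotoneOn hF),
    ae_fst_snd (ae_continuousWithinAt_of_monotoneOn hG)] with w h1 h2 hw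
  have hw' := neg_mem_freqSquare hw
  exact ⟨key w hw (h1.1.1 hw.1) (h2.2.1 hw.2),
    key (-w) hw' (h1.1.2 hw'.1) (h2.2.2 hw'.2)⟩

lemma abs_cell_freq_le {n : ℕ} {i : ℤ} (hi : |i| ≤ (n : ℤ) / 2) :
    2 * Real.pi * (i : ℝ) / n ∈ Set.Icc (-Real.pi) Real.pi := by
  have hπ := Real.pi_pos
  have h1 : 2 * |i| ≤ (n : ℤ) := by omega
  have h2 : 2 * |(i : ℝ)| ≤ n := by exact_mod_cast h1
  rw [Set.mem_Icc, ← abs_le, abs_div, abs_mul, abs_of_pos (by positivity : 0 < 2 * Real.pi),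
    Nat.abs_cast]
  refine div_le_of_le_mul₀ (by positivity) hπ.le ?_
  nlinarith

lemma abs_le_of_mem_indexRange {n : ℕ} {i : ℤ} (hi : i ∈ indexRange n) : |i| ≤ (n : ℤ) / 2 := by
  rw [mem_indexRange] at hi
  rw [abs_le]
  omega

lemma fourierFreq_mem {n : ℕ × ℕ} {i : ℤ × ℤ} (hi : i ∈ fullIndex n) :
    fourierFreq n i ∈ freqSquare := by
  rw [mem_fullIndex] at hi
  exact ⟨abs_cell_freq_le (abs_le_of_mem_indexRange hi.1),
    abs_cell_freq_le (abs_le_of_mem_indexRange hi.2)⟩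

lemma fourierFreq_neg (n : ℕ × ℕ) (i : ℤ × ℤ) : fourierFreq n (-i) = -fourierFreq n i := by
  simp [fourierFreq, neg_div]

/-- Convergence along the grid at regular points of continuity. -/
lemma tendsto_grid_of_continuousWithinAt {ψ : ℝ × ℝ → ℝ} {w : ℝ × ℝ} (hw : IsRegularFreq w)
    (h : ContinuousWithinAt ψ freqSquare w ∧ ContinuousWithinAt ψ freqSquare (-w)) :
    Tendsto (fun n => ψ (fourierFreq n (gridIndex n w))) atTop (𝓝 (ψ w)) ∧
      Tendsto (fun n => ψ (fourierFreq n (-gridIndex n w))) atTop (𝓝 (ψ (-w))) := by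
  have ht := tendsto_fourierFreq_gridIndex w
  constructor
  · refine h.1.tendsto.comp (tendsto_nhdsWithin_iff.mpr ⟨ht, ?_⟩)
    filter_upwards [eventually_gridIndex hw] with n hn
    exact fourierFreq_mem (fourierIndex_subset n hn.1)
  · refine h.2.tendsto.comp (tendsto_nhdsWithin_iff.mpr ⟨?_, ?_⟩)
    · simp_rw [fourierFreq_neg]
      exact ht.neg
    · filter_upwards [eventually_gridIndex hw] with n hn
      exact fourierFreq_mem (fourierIndex_subset n hn.2.1)

/-- No measurability of ψ is assumed; it follows because ψ is almost everywhere the limit of its own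
samples on the grid cells. -/
lemma BoundedVariationSquare.aestronglyMeasurable {ψ : ℝ × ℝ → ℝ}
    (h : BoundedVariationSquare ψ) :
    AEStronglyMeasurable ψ ((volume : Measure (ℝ × ℝ)).restrict freqSquare) := by
  refine aestronglyMeasurable_of_tendsto_ae (u := atTop)
    (f := fun (n : ℕ × ℕ) w => ψ (fourierFreq n (gridIndex n w))) (fun n => ?_) ?_
  · have : StronglyMeasurable fun i => ψ (fourierFreq n i) := .of_discrete
    exact (this.comp_measurable (measurable_gridIndex n)).aestronglyMeasurable
  · filter_upwards [h.ae_continuousWithinAt, ae_isRegularFreq] with w h1 h2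
    exact (tendsto_grid_of_continuousWithinAt h2 h1).1

/-! ### Discrete Fourier analysis on rectangular regions -/

/-- The character `s ↦ e^{-ι sᵀω}`. -/
noncomputable def expChar (w : ℝ × ℝ) (s : ℤ × ℤ) : ℂ :=
  Complex.exp (-Complex.I * (dotFreq s w : ℂ))

lemma expChar_add (w : ℝ × ℝ) (s t : ℤ × ℤ) : expChar w (s + t) = expChar w s * expChar w t := by
  rw [expChar, expChar, expChar, ← Complex.exp_add]
  congr 1
  simp [dotFreq]; ring

lemma expChar_add_freq (w v : ℝ × ℝ) (s : ℤ × ℤ) :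
    expChar (w + v) s = expChar w s * expChar v s := by
  rw [expChar, expChar, expChar, ← Complex.exp_add]
  congr 1
  simp [dotFreq]; ring

lemma conj_expChar (w : ℝ × ℝ) (s : ℤ × ℤ) : star (expChar w s) = expChar w (-s) := by
  rw [expChar, expChar, Complex.star_def, ← Complex.exp_conj]
  congr 1
  simp [dotFreq]; ring

lemma expChar_neg_freq (w : ℝ × ℝ) (s : ℤ × ℤ) : expChar (-w) s = star (expChar w s) := by
  rw [conj_expChar, expChar, expChar]
  congr 1
  simp [dotFreq]

@[simp] lemma norm_expChar (w : ℝ × ℝ) (s : ℤ × ℤ) : ‖expChar w s‖ = 1 := by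
  have : -Complex.I * (dotFreq s w : ℂ) = ((-dotFreq s w : ℝ) : ℂ) * Complex.I := by
    push_cast; ring
  rw [expChar, this, Complex.norm_exp_ofReal_mul_I]

lemma continuous_expChar (s : ℤ × ℤ) : Continuous fun w => expChar w s := by
  unfold expChar dotFreq
  fun_prop

lemma expChar_mul_star (w : ℝ × ℝ) (s t : ℤ × ℤ) :
    expChar w s * star (expChar w t) = expChar w (s - t) := by
  rw [conj_expChar, ← expChar_add, sub_eq_add_neg]

lemma sum_zpow_Icc {z : ℂ} {n : ℕ} (hz : z ^ n = 1) (h1 : z ≠ 1) (hn : n ≠ 0) (a : ℤ) :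
    ∑ k ∈ Finset.Icc a (a + n - 1), z ^ k = 0 := by
  have hz0 : z ≠ 0 := by rintro rfl; simp [hn] at hz
  have : ∑ k ∈ Finset.Icc a (a + n - 1), z ^ k = ∑ r ∈ Finset.range n, z ^ a * z ^ r := by
    symm
    refine Finset.sum_nbij (fun r : ℕ => a + r) ?_ ?_ ?_ ?_
    · intro r hr
      simp only [Finset.mem_range] at hr
      rw [Finset.mem_Icc]; omega
    · intro r _ r' _ h
      simp only at h
      omega
    · intro k hk
      rw [Finset.coe_Icc, Set.mem_Icc] at hk
      exact ⟨(k - a).toNat, by simp only [Finset.coe_range, Set.mem_Iio]; omega, by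
        simp only; omega⟩
    · intro r _
      rw [zpow_add₀ hz0, zpow_natCast]
  rw [this, ← Finset.mul_sum, geom_sum_eq h1, hz]
  simp

/-- A primitive `n`-th root of unity, as used by the discrete Fourier transform. -/
noncomputable def unitRoot (n : ℕ) : ℂ := (Complex.exp (2 * Real.pi * Complex.I / n))⁻¹

lemma sum_unitRoot_zpow {n : ℕ} {m : ℤ} (hm : |m| < n) (a : ℤ) :
    ∑ k ∈ Finset.Icc a (a + n - 1), (unitRoot n ^ m) ^ k = if m = 0 then (n : ℂ) else 0 := by
  have hn : n ≠ 0 := by have := abs_nonneg m; omega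
  split_ifs with h
  · subst h
    simp
  · have hp : IsPrimitiveRoot (unitRoot n) n := (Complex.isPrimitiveRoot_exp n hn).inv
    refine sum_zpow_Icc ?_ ?_ hn a
    · rw [← zpow_natCast, ← zpow_mul, mul_comm, zpow_mul, zpow_natCast, hp.pow_eq_one, one_zpow]
    · intro h1
      rw [hp.zpow_eq_one_iff_dvd] at h1
      exact h (Int.eq_zero_of_abs_lt_dvd h1 hm)

/-- Written with powers of roots of unity, sums of characters over rectangles factor into two
geometric sums. -/
lemma expChar_fourierFreq (n : ℕ × ℕ) (i s : ℤ × ℤ) :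
    expChar (fourierFreq n i) s =
      (unitRoot n.1 ^ i.1) ^ s.1 * (unitRoot n.2 ^ i.2) ^ s.2 := by
  rw [expChar, unitRoot, unitRoot, ← Complex.exp_neg, ← Complex.exp_neg]
  simp only [← Complex.exp_int_mul, ← Complex.exp_add]
  congr 1
  simp [dotFreq, fourierFreq]; ring

/-- Orthogonality over sites. The size condition is what a difference of two Fourier indices
satisfies; applied to a single nonzero index it shows that constants have no Fourier component. -/
lemma sum_region_expChar {n : ℕ × ℕ} {i : ℤ × ℤ} (h1 : |i.1| < n.1) (h2 : |i.2| < n.2) :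
    ∑ s ∈ region 0 n, expChar (fourierFreq n i) s = if i = 0 then (size n : ℂ) else 0 := by
  simp_rw [region, expChar_fourierFreq, Finset.sum_product, ← Finset.mul_sum, ← Finset.sum_mul]
  have e1 := sum_unitRoot_zpow h1 (0 + 1)
  have e2 := sum_unitRoot_zpow h2 (0 + 1)
  rw [show (0 + 1 + (n.1 : ℤ) - 1) = 0 + n.1 by ring] at e1
  rw [show (0 + 1 + (n.2 : ℤ) - 1) = 0 + n.2 by ring] at e2
  simp only [Prod.fst_zero, Prod.snd_zero]
  rw [e1, e2]
  by_cases ha : i.1 = 0 <;> by_cases hb : i.2 = 0 <;> simp [ha, hb, Prod.ext_iff, size]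

lemma indexRange_eq (n : ℕ) : indexRange n =
    Finset.Icc (-(((n : ℤ) - 1) / 2)) (-(((n : ℤ) - 1) / 2) + n - 1) := by
  rw [indexRange]
  congr 1
  omega

/-- The dual orthogonality over frequencies, by the symmetry of the powers of roots of unity in
index and site; it yields Parseval. -/
lemma sum_fullIndex_expChar {n : ℕ × ℕ} {s : ℤ × ℤ} (h1 : |s.1| < n.1) (h2 : |s.2| < n.2) :
    ∑ k ∈ fullIndex n, expChar (fourierFreq n k) s = if s = 0 then (size n : ℂ) else 0 := by
  have hsw : ∀ k : ℤ × ℤ, expChar (fourierFreq n k) s =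
      (unitRoot n.1 ^ s.1) ^ k.1 * (unitRoot n.2 ^ s.2) ^ k.2 := by
    intro k
    rw [expChar_fourierFreq, ← zpow_mul, ← zpow_mul, ← zpow_mul, ← zpow_mul, mul_comm s.1,
      mul_comm s.2]
  simp_rw [fullIndex, hsw, Finset.sum_product, ← Finset.mul_sum, ← Finset.sum_mul]
  rw [indexRange_eq, indexRange_eq, sum_unitRoot_zpow h1, sum_unitRoot_zpow h2]
  by_cases ha : s.1 = 0 <;> by_cases hb : s.2 = 0 <;> simp [ha, hb, Prod.ext_iff, size]

lemma mem_region_zero {n : ℕ × ℕ} {s : ℤ × ℤ} :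
    s ∈ region 0 n ↔ (1 ≤ s.1 ∧ s.1 ≤ n.1) ∧ (1 ≤ s.2 ∧ s.2 ≤ n.2) := by
  simp [region, Finset.mem_product, Finset.mem_Icc]

lemma card_region (n : ℕ × ℕ) : ((region 0 n).card : ℝ) = size n := by
  simp [region, Finset.card_product, size]

/-- Parseval's identity on a rectangular region. -/
lemma sum_norm_sq_fourier (n : ℕ × ℕ) (v : ℤ × ℤ → ℂ) :
    ∑ k ∈ fullIndex n, ‖∑ t ∈ region 0 n, star (expChar (fourierFreq n k) t) * v t‖ ^ 2 =
      size n * ∑ t ∈ region 0 n, ‖v t‖ ^ 2 := by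
  have key : (∑ k ∈ fullIndex n, (∑ t ∈ region 0 n, star (expChar (fourierFreq n k) t) * v t) *
      star (∑ t ∈ region 0 n, star (expChar (fourierFreq n k) t) * v t)) =
      size n * ∑ t ∈ region 0 n, v t * star (v t) := by
    simp_rw [star_sum, Finset.sum_mul_sum]
    rw [Finset.sum_comm, Finset.mul_sum]
    refine Finset.sum_congr rfl fun t ht => ?_
    rw [Finset.sum_comm]
    have hterm : ∀ u ∈ region 0 n, (∑ k ∈ fullIndex n, star (expChar (fourierFreq n k) t) * v t *
        star (star (expChar (fourierFreq n k) u) * v u)) =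
        v t * star (v u) * if u = t then (size n : ℂ) else 0 := by
      intro u hu
      rw [mem_region_zero] at ht hu
      have := sum_fullIndex_expChar (n := n) (s := u - t)
        (by rw [Prod.fst_sub, abs_lt]; omega) (by rw [Prod.snd_sub, abs_lt]; omega)
      simp only [sub_eq_zero] at this
      rw [← this, Finset.mul_sum]
      refine Finset.sum_congr rfl fun k _ => ?_
      rw [← expChar_mul_star, star_mul, star_star]
      ring
    rw [Finset.sum_congr rfl hterm]
    simp only [mul_ite, mul_zero, Finset.sum_ite_eq', ht, if_true]
    ring
  have hsq : ∀ z : ℂ, z * star z = ((‖z‖ ^ 2 : ℝ) : ℂ) := by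
    intro z
    rw [Complex.star_def, Complex.mul_conj, Complex.normSq_eq_norm_sq]
  simp_rw [hsq] at key
  exact_mod_cast key

/-! ### Fraction of sites leaving a region under a shift -/

/-- The proportion of sites `t` of the region such that `t + h` is outside the region. -/
noncomputable def exitFraction (n : ℕ × ℕ) (h : ℤ × ℤ) : ℝ :=
  (size n)⁻¹ * ((region 0 n).filter fun t => t + h ∉ region 0 n).card

lemma size_nonneg (n : ℕ × ℕ) : 0 ≤ size n := by unfold size; positivity

lemma exitFraction_nonneg (n : ℕ × ℕ) (h : ℤ × ℤ) : 0 ≤ exitFraction n h :=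
  mul_nonneg (inv_nonneg.mpr (size_nonneg n)) (Nat.cast_nonneg _)

lemma exitFraction_le_one (n : ℕ × ℕ) (h : ℤ × ℤ) : exitFraction n h ≤ 1 := by
  have h1 : (((region 0 n).filter fun t => t + h ∉ region 0 n).card : ℝ) ≤ size n := by
    rw [← card_region]
    exact_mod_cast Finset.card_filter_le _ _
  rw [exitFraction]
  exact inv_mul_le_of_le_mul₀ (size_nonneg n) zero_le_one (by simpa using h1)

lemma card_exit_le (n : ℕ) (h : ℤ) :
    ((Finset.Icc (1 : ℤ) n).filter fun t => ¬ (1 ≤ t + h ∧ t + h ≤ n)).card ≤ h.natAbs := by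
  rcases le_total 0 h with hh | hh
  · calc _ ≤ (Finset.Icc ((n : ℤ) - h + 1) n).card := by
          refine Finset.card_le_card fun t ht => ?_
          simp only [Finset.mem_filter, Finset.mem_Icc] at ht ⊢
          omega
      _ ≤ _ := by rw [Int.card_Icc]; omega
  · calc _ ≤ (Finset.Icc (1 : ℤ) (-h)).card := by
          refine Finset.card_le_card fun t ht => ?_
          simp only [Finset.mem_filter, Finset.mem_Icc] at ht ⊢
          omega
      _ ≤ _ := by rw [Int.card_Icc]; omega

/-- A site that leaves the rectangle does so through one of the coordinates, and a shift by h expels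
at most |h₁| columns and |h₂| rows. -/
lemma exitFraction_le {n : ℕ × ℕ} (h1 : 0 < n.1) (h2 : 0 < n.2) (h : ℤ × ℤ) :
    exitFraction n h ≤ (h.1.natAbs : ℝ) / n.1 + (h.2.natAbs : ℝ) / n.2 := by
  have h1' : (0 : ℝ) < n.1 := by exact_mod_cast h1
  have h2' : (0 : ℝ) < n.2 := by exact_mod_cast h2
  have hsub : ((region 0 n).filter fun t => t + h ∉ region 0 n) ⊆
      (((Finset.Icc (1 : ℤ) n.1).filter fun t => ¬ (1 ≤ t + h.1 ∧ t + h.1 ≤ n.1)) ×ˢ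
        Finset.Icc (1 : ℤ) n.2) ∪ (Finset.Icc (1 : ℤ) n.1 ×ˢ
        ((Finset.Icc (1 : ℤ) n.2).filter fun t => ¬ (1 ≤ t + h.2 ∧ t + h.2 ≤ n.2))) := by
    intro t ht
    simp only [Finset.mem_filter, mem_region_zero, Finset.mem_union, Finset.mem_product,
      Finset.mem_Icc, Prod.fst_add, Prod.snd_add] at ht ⊢
    tauto
  have hc := (Finset.card_le_card hsub).trans (Finset.card_union_le _ _)
  rw [Finset.card_product, Finset.card_product, Int.card_Icc, Int.card_Icc] at hc
  have e1 := card_exit_le n.1 h.1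
  have e2 := card_exit_le n.2 h.2
  have hc' : ((region 0 n).filter fun t => t + h ∉ region 0 n).card ≤
      h.1.natAbs * n.2 + n.1 * h.2.natAbs := by
    refine hc.trans (add_le_add (Nat.mul_le_mul e1 (by omega)) (Nat.mul_le_mul (by omega) e2))
  have hc'' : (((region 0 n).filter fun t => t + h ∉ region 0 n).card : ℝ) ≤
      h.1.natAbs * n.2 + n.1 * h.2.natAbs := by exact_mod_cast hc'
  calc exitFraction n h ≤ (size n)⁻¹ * (h.1.natAbs * n.2 + n.1 * h.2.natAbs) :=
        mul_le_mul_of_nonneg_left hc'' (inv_nonneg.mpr (size_nonneg n))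
    _ = _ := by rw [size]; field_simp

lemma tendsto_exitFraction (h : ℤ × ℤ) : Tendsto (fun n => exitFraction n h) atTop (𝓝 0) := by
  have t1 := (tendsto_const_div_atTop_nhds_zero_nat (h.1.natAbs : ℝ)).comp tendsto_fst_atTop_prod
  have t2 := (tendsto_const_div_atTop_nhds_zero_nat (h.2.natAbs : ℝ)).comp tendsto_snd_atTop_prod
  have t3 := t1.add t2
  rw [add_zero] at t3
  refine squeeze_zero' (Eventually.of_forall fun n => exitFraction_nonneg n h) ?_ t3
  filter_upwards [eventually_pos] with n hn
  exact exitFraction_le hn.1 hn.2 h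

/-! ### Covariances of the discrete Fourier transform -/

section Spectral

variable (γ : ℤ × ℤ → ℝ)

/-- The Fourier series `∑_h γ(h) e^{-ι hᵀω}`. -/
noncomputable def fourierSeries (w : ℝ × ℝ) : ℂ := ∑' h, (γ h : ℂ) * expChar w h

/-- The bilinear form `∑_{s,t} γ(t - s) χ(s) η(t)` over a region. -/
noncomputable def covForm (n : ℕ × ℕ) (χ η : ℤ × ℤ → ℂ) : ℂ :=
  ∑ s ∈ region 0 n, ∑ t ∈ region 0 n, (γ (t - s) : ℂ) * (χ s * η t)

/-- The average edge effect `∑_h |γ(h)| · exitFraction`. -/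
noncomputable def edgeEffect (n : ℕ × ℕ) : ℝ := ∑' h, |γ h| * exitFraction n h

variable {γ}

/-- Dominated convergence for series: each exit fraction tends to zero and is at most 1. Absolute
summability suffices, without any rate. -/
lemma tendsto_edgeEffect (hγ : Summable fun h => |γ h|) :
    Tendsto (edgeEffect γ) atTop (𝓝 0) := by
  have := tendsto_tsum_of_dominated_convergence (𝓕 := (atTop : Filter (ℕ × ℕ)))
    (f := fun n h => |γ h| * exitFraction n h) (g := fun _ => 0) hγ
    (fun h => by simpa using (tendsto_exitFraction h).const_mul |γ h|)
    (Eventually.of_forall fun n h => by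
      rw [Real.norm_of_nonneg (mul_nonneg (abs_nonneg _) (exitFraction_nonneg n h))]
      exact mul_le_of_le_one_right (abs_nonneg _) (exitFraction_le_one n h))
  rw [tsum_zero] at this
  exact this

lemma summable_fourierSeries (hγ : Summable fun h => |γ h|) (w : ℝ × ℝ) :
    Summable fun h => (γ h : ℂ) * expChar w h :=
  Summable.of_norm (by simpa using hγ)

lemma norm_fourierSeries_le (hγ : Summable fun h => |γ h|) (w : ℝ × ℝ) :
    ‖fourierSeries γ w‖ ≤ ∑' h, |γ h| :=
  tsum_of_norm_bounded hγ.hasSum fun h => by simp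

lemma continuous_fourierSeries (hγ : Summable fun h => |γ h|) :
    Continuous (fourierSeries γ) :=
  continuous_tsum (fun h => continuous_const.mul (continuous_expChar h)) hγ fun h w => by simp

lemma star_fourierSeries (heven : ∀ h, γ (-h) = γ h) (w : ℝ × ℝ) :
    star (fourierSeries γ w) = fourierSeries γ w := by
  rw [fourierSeries, Complex.star_def, Complex.conj_tsum, ← (Equiv.neg (ℤ × ℤ)).tsum_eq]
  refine tsum_congr fun h => ?_
  simp only [Equiv.neg_apply, map_mul, Complex.conj_ofReal, heven]
  rw [← Complex.star_def, conj_expChar, neg_neg]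

lemma fourierSeries_neg (heven : ∀ h, γ (-h) = γ h) (w : ℝ × ℝ) :
    fourierSeries γ (-w) = fourierSeries γ w := by
  rw [fourierSeries, fourierSeries, ← (Equiv.neg (ℤ × ℤ)).tsum_eq]
  refine tsum_congr fun h => ?_
  simp only [Equiv.neg_apply, heven, expChar_neg_freq, conj_expChar, neg_neg]

/-- The local Fourier sum `∑_{s ∈ R} γ(t - s) e^{-ι (s - t)ᵀω}`. -/
noncomputable def localSeries (γ : ℤ × ℤ → ℝ) (n : ℕ × ℕ) (w : ℝ × ℝ) (t : ℤ × ℤ) : ℂ :=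
  ∑ s ∈ region 0 n, (γ (t - s) : ℂ) * expChar w (s - t)

lemma localSeries_eq_tsum (heven : ∀ h, γ (-h) = γ h) (n : ℕ × ℕ) (w : ℝ × ℝ) (t : ℤ × ℤ) :
    localSeries γ n w t =
      ∑' h, if t + h ∈ region 0 n then (γ h : ℂ) * expChar w h else 0 := by
  rw [← (Equiv.subRight t).tsum_eq, tsum_eq_sum (s := region 0 n)]
  · refine Finset.sum_congr rfl fun s hs => ?_
    simp only [Equiv.subRight_apply, add_sub_cancel, hs, if_true]
    rw [← heven (t - s), neg_sub]
  · intro s hs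
    simp [hs]

lemma norm_localSeries_le (hγ : Summable fun h => |γ h|) (heven : ∀ h, γ (-h) = γ h)
    (n : ℕ × ℕ) (w : ℝ × ℝ) (t : ℤ × ℤ) : ‖localSeries γ n w t‖ ≤ ∑' h, |γ h| := by
  rw [localSeries_eq_tsum heven]
  refine tsum_of_norm_bounded hγ.hasSum fun h => ?_
  split_ifs <;> simp

lemma norm_localSeries_sub_le (hγ : Summable fun h => |γ h|) (heven : ∀ h, γ (-h) = γ h)
    (n : ℕ × ℕ) (w : ℝ × ℝ) (t : ℤ × ℤ) :
    ‖localSeries γ n w t - fourierSeries γ w‖ ≤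
      ∑' h, if t + h ∉ region 0 n then |γ h| else 0 := by
  have hs : Summable fun h => if t + h ∈ region 0 n then (γ h : ℂ) * expChar w h else 0 :=
    Summable.of_norm_bounded hγ fun h => by split_ifs <;> simp
  rw [localSeries_eq_tsum heven, fourierSeries, ← hs.tsum_sub (summable_fourierSeries hγ w)]
  refine tsum_of_norm_bounded (Summable.hasSum ?_) fun h => ?_
  · exact hγ.of_nonneg_of_le (fun h => by split_ifs <;> simp)
      fun h => by split_ifs <;> simp
  · by_cases hh : t + h ∈ region 0 n <;> simp [hh]

/-- The deviation at t is at most the tail of |γ| over shifts leaving the region, itself at most the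
total Γ. One factor of the square is bounded by Γ; averaging the other over t and exchanging sums
gives the edge effect. -/
lemma avg_norm_localSeries_sub_sq_le (hγ : Summable fun h => |γ h|)
    (heven : ∀ h, γ (-h) = γ h) (n : ℕ × ℕ) (w : ℝ × ℝ) :
    (size n)⁻¹ * ∑ t ∈ region 0 n, ‖localSeries γ n w t - fourierSeries γ w‖ ^ 2 ≤
      (∑' h, |γ h|) * edgeEffect γ n := by
  have hsum : ∀ t, Summable fun h => if t + h ∉ region 0 n then |γ h| else 0 := fun t =>
    hγ.of_nonneg_of_le (fun h => by split_ifs <;> simp) fun h => by split_ifs <;> simp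
  have hΓ : 0 ≤ ∑' h, |γ h| := tsum_nonneg fun _ => abs_nonneg _
  have hedge : edgeEffect γ n =
      (size n)⁻¹ * ∑ t ∈ region 0 n, ∑' h, if t + h ∉ region 0 n then |γ h| else 0 := by
    rw [← Summable.tsum_finsetSum fun t _ => hsum t, ← tsum_mul_left, edgeEffect]
    refine tsum_congr fun h => ?_
    rw [exitFraction, ← Finset.sum_filter, Finset.sum_const, nsmul_eq_mul]
    ring
  rw [hedge, mul_left_comm, Finset.mul_sum _ _ (∑' h, |γ h|)]
  refine mul_le_mul_of_nonneg_left (Finset.sum_le_sum fun t _ => ?_)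
    (inv_nonneg.mpr (size_nonneg n))
  have h1 := norm_localSeries_sub_le hγ heven n w t
  have h2 : (∑' h, if t + h ∉ region 0 n then |γ h| else 0) ≤ ∑' h, |γ h| :=
    (hsum t).tsum_le_tsum (fun h => by split_ifs <;> simp) hγ
  rw [pow_two]
  exact mul_le_mul (h1.trans h2) h1 (norm_nonneg _) hΓ

/-- The normalized covariance of the discrete Fourier transforms at `ω` and at the `k`-th
Fourier frequency. -/
noncomputable def dftCov (γ : ℤ × ℤ → ℝ) (n : ℕ × ℕ) (w : ℝ × ℝ) (k : ℤ × ℤ) : ℂ :=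
  ((size n)⁻¹ : ℝ) * covForm γ n (expChar w) fun t => star (expChar (fourierFreq n k) t)

/-- Summing over s first exhibits the row k ↦ `dftCov γ n w k` as a discrete Fourier transform, so
Parseval controls the whole row at once. -/
lemma dftCov_eq (n : ℕ × ℕ) (w : ℝ × ℝ) (k : ℤ × ℤ) :
    dftCov γ n w k = ((size n)⁻¹ : ℝ) * ∑ t ∈ region 0 n,
      star (expChar (fourierFreq n k) t) * (expChar w t * localSeries γ n w t) := by
  rw [dftCov, covForm, Finset.sum_comm]
  congr 1
  refine Finset.sum_congr rfl fun t _ => ?_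
  rw [localSeries, Finset.mul_sum, Finset.mul_sum]
  refine Finset.sum_congr rfl fun s _ => ?_
  have : expChar w s = expChar w t * expChar w (s - t) := by
    rw [← expChar_add, add_sub_cancel]
  rw [this]
  ring

lemma sum_norm_dft_sq (n : ℕ × ℕ) (hn : 0 < size n) (v : ℤ × ℤ → ℂ) :
    ∑ k ∈ fullIndex n, ‖(((size n)⁻¹ : ℝ) : ℂ) * ∑ t ∈ region 0 n,
      star (expChar (fourierFreq n k) t) * v t‖ ^ 2 =
      (size n)⁻¹ * ∑ t ∈ region 0 n, ‖v t‖ ^ 2 := by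
  simp_rw [norm_mul, mul_pow, ← Finset.mul_sum, sum_norm_sq_fourier]
  rw [Complex.norm_real, Real.norm_of_nonneg (inv_nonneg.mpr hn.le)]
  field_simp

/-- By Parseval a row has the mean square of the local series, whose modulus is at most Γ. The bound
is uniform in the region and in w. -/
lemma sum_norm_dftCov_sq_le (hγ : Summable fun h => |γ h|) (heven : ∀ h, γ (-h) = γ h)
    {n : ℕ × ℕ} (hn : 0 < size n) (w : ℝ × ℝ) :
    ∑ k ∈ fullIndex n, ‖dftCov γ n w k‖ ^ 2 ≤ (∑' h, |γ h|) ^ 2 := by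
  simp_rw [dftCov_eq]
  rw [sum_norm_dft_sq n hn, inv_mul_le_iff₀ hn, ← card_region, ← nsmul_eq_mul,
    ← Finset.sum_const]
  refine Finset.sum_le_sum fun t _ => ?_
  rw [norm_mul, norm_expChar, one_mul]
  exact pow_le_pow_left₀ (norm_nonneg _) (norm_localSeries_le hγ heven n w t) 2

lemma norm_dftCov_le (hγ : Summable fun h => |γ h|) (heven : ∀ h, γ (-h) = γ h)
    {n : ℕ × ℕ} (hn : 0 < size n) (w : ℝ × ℝ) {k : ℤ × ℤ} (hk : k ∈ fullIndex n) :
    ‖dftCov γ n w k‖ ^ 2 ≤ (∑' h, |γ h|) ^ 2 :=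
  (Finset.single_le_sum (f := fun k => ‖dftCov γ n w k‖ ^ 2) (fun _ _ => by positivity) hk).trans
    (sum_norm_dftCov_sq_le hγ heven hn w)

lemma abs_sub_lt_of_mem_indexRange {n : ℕ} {i k : ℤ} (hi : i ∈ indexRange n)
    (hk : k ∈ indexRange n) : |i - k| < n := by
  rw [mem_indexRange] at hi hk
  rw [abs_lt]
  omega

lemma fourierFreq_sub (n : ℕ × ℕ) (i k : ℤ × ℤ) :
    fourierFreq n (i - k) = fourierFreq n i + -fourierFreq n k := by
  simp only [fourierFreq, Prod.fst_sub, Prod.snd_sub, Int.cast_sub, Prod.neg_mk, Prod.mk_add_mk]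
  congr 1 <;> ring

/-- The matrix of normalized covariances at Fourier frequencies is nearly diagonal. -/
lemma sum_norm_dftCov_sub_sq_le (hγ : Summable fun h => |γ h|) (heven : ∀ h, γ (-h) = γ h)
    {n : ℕ × ℕ} (hn : 0 < size n) {i : ℤ × ℤ} (hi : i ∈ fullIndex n) :
    ∑ k ∈ fullIndex n, ‖dftCov γ n (fourierFreq n i) k -
        if k = i then fourierSeries γ (fourierFreq n i) else 0‖ ^ 2 ≤
      (∑' h, |γ h|) * edgeEffect γ n := by
  refine le_trans (le_of_eq ?_) (avg_norm_localSeries_sub_sq_le hγ heven n (fourierFreq n i))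
  -- If the local series were constant in t, equal to its limit, orthogonality would make the row
  -- exactly diagonal. Hence the error row is the transform of the deviation of the local series.
  have hrw : ∀ k ∈ fullIndex n, dftCov γ n (fourierFreq n i) k -
      (if k = i then fourierSeries γ (fourierFreq n i) else 0) =
      ((size n)⁻¹ : ℝ) * ∑ t ∈ region 0 n, star (expChar (fourierFreq n k) t) *
        (expChar (fourierFreq n i) t *
          (localSeries γ n (fourierFreq n i) t - fourierSeries γ (fourierFreq n i))) := by
    intro k hk
    rw [mem_fullIndex] at hi hk
    have horth := sum_region_expChar (n := n) (i := i - k)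
      (abs_sub_lt_of_mem_indexRange hi.1 hk.1) (abs_sub_lt_of_mem_indexRange hi.2 hk.2)
    simp only [sub_eq_zero, eq_comm (a := i)] at horth
    have : (if k = i then fourierSeries γ (fourierFreq n i) else 0) =
        ((size n)⁻¹ : ℝ) * ∑ t ∈ region 0 n, star (expChar (fourierFreq n k) t) *
          (expChar (fourierFreq n i) t * fourierSeries γ (fourierFreq n i)) := by
      simp_rw [← mul_assoc _ _ (fourierSeries γ (fourierFreq n i)), ← Finset.sum_mul]
      have hs : ∑ t ∈ region 0 n, star (expChar (fourierFreq n k) t) *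
          expChar (fourierFreq n i) t = if k = i then (size n : ℂ) else 0 := by
        rw [← horth]
        refine Finset.sum_congr rfl fun t _ => ?_
        rw [fourierFreq_sub, expChar_add_freq, expChar_neg_freq, mul_comm]
      rw [hs]
      have hne : (size n : ℂ) ≠ 0 := by exact_mod_cast hn.ne'
      split_ifs <;> simp [hne]
    rw [this, dftCov_eq, ← mul_sub, ← Finset.sum_sub_distrib]
    congr 1
    refine Finset.sum_congr rfl fun t _ => ?_
    ring
  rw [Finset.sum_congr rfl fun k hk => by rw [hrw k hk], sum_norm_dft_sq n hn]
  simp_rw [norm_mul, norm_expChar, one_mul]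

end Spectral

/-! ### Second and fourth moments of linear statistics of a stationary field -/

section Moments

variable {Ω : Type*} [MeasurableSpace Ω] {P : Measure Ω} [IsProbabilityMeasure P]

/-- Hölder: the reciprocals of the exponents add up to at most 4 · (1/4) = 1, and the measure is
finite. -/
lemma integrable_prod_of_memLp_four {ι : Type*} {X : ι → Ω → ℝ} {t : Finset ι}
    (hX : ∀ i ∈ t, MemLp (X i) 4 P) (ht : t.card ≤ 4) :
    Integrable (fun x => ∏ i ∈ t, X i x) P := by
  have h := MemLp.prod' (p := fun _ => (4 : ENNReal)) hX
  rw [← memLp_one_iff_integrable]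
  refine h.mono_exponent ?_
  rw [Finset.sum_const, nsmul_eq_mul, ENNReal.one_le_inv, ← div_eq_mul_inv]
  refine ENNReal.div_le_of_le_mul ?_
  rw [one_mul]
  exact_mod_cast ht

lemma integrable_mul_four {X₁ X₂ X₃ X₄ : Ω → ℝ} (h₁ : MemLp X₁ 4 P) (h₂ : MemLp X₂ 4 P)
    (h₃ : MemLp X₃ 4 P) (h₄ : MemLp X₄ 4 P) :
    Integrable (fun x => X₁ x * X₂ x * X₃ x * X₄ x) P := by
  have := integrable_prod_of_memLp_four (P := P) (X := ![X₁, X₂, X₃, X₄]) (t := Finset.univ)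
    (by intro i _; fin_cases i <;> simpa) (by simp)
  simpa [Fin.prod_univ_four] using this

/-- The fourth-order form `∑ κ(t - s, u - s, v - s) χ̄(s) χ(t) η(u) η̄(v)` over a region. -/
noncomputable def cumForm (κ : (ℤ × ℤ) × (ℤ × ℤ) × (ℤ × ℤ) → ℝ) (n : ℕ × ℕ)
    (χ η : ℤ × ℤ → ℂ) : ℂ :=
  ∑ s ∈ region 0 n, ∑ t ∈ region 0 n, ∑ u ∈ region 0 n, ∑ v ∈ region 0 n,
    (κ (t - s, u - s, v - s) : ℂ) * (star (χ s) * χ t * (η u * star (η v)))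

/-- The linear statistic `∑_s Y(s) χ(s)` over a region. -/
noncomputable def linStat (Y : ℤ × ℤ → Ω → ℝ) (n : ℕ × ℕ) (χ : ℤ × ℤ → ℂ) (x : Ω) : ℂ :=
  ∑ s ∈ region 0 n, (Y s x : ℂ) * χ s

lemma norm_linStat_sq (Y : ℤ × ℤ → Ω → ℝ) (n : ℕ × ℕ) (χ : ℤ × ℤ → ℂ) (x : Ω) :
    ((‖linStat Y n χ x‖ ^ 2 : ℝ) : ℂ) =
      ∑ s ∈ region 0 n, ∑ t ∈ region 0 n, ((Y s x * Y t x : ℝ) : ℂ) * (star (χ s) * χ t) := by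
  rw [← Complex.normSq_eq_norm_sq, ← Complex.mul_conj, mul_comm, ← Complex.star_def, linStat,
    star_sum, Finset.sum_mul_sum]
  refine Finset.sum_congr rfl fun s _ => Finset.sum_congr rfl fun t _ => ?_
  rw [star_mul, Complex.star_def, Complex.conj_ofReal]
  push_cast
  ring

lemma norm_linStat_sq_mul (Y : ℤ × ℤ → Ω → ℝ) (n : ℕ × ℕ) (χ η : ℤ × ℤ → ℂ) (x : Ω) :
    ((‖linStat Y n χ x‖ ^ 2 * ‖linStat Y n η x‖ ^ 2 : ℝ) : ℂ) =
      ∑ s ∈ region 0 n, ∑ t ∈ region 0 n, ∑ u ∈ region 0 n, ∑ v ∈ region 0 n,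
        ((Y s x * Y t x * Y u x * Y v x : ℝ) : ℂ) *
          (star (χ s) * χ t * (η u * star (η v))) := by
  rw [Complex.ofReal_mul, norm_linStat_sq, norm_linStat_sq, Finset.sum_mul]
  refine Finset.sum_congr rfl fun s _ => ?_
  rw [Finset.sum_mul]
  refine Finset.sum_congr rfl fun t _ => ?_
  rw [Finset.sum_comm, Finset.mul_sum]
  refine Finset.sum_congr rfl fun u _ => ?_
  rw [Finset.mul_sum]
  refine Finset.sum_congr rfl fun v _ => ?_
  push_cast
  ring

lemma memLp_two_norm_linStat_sq {Y : ℤ × ℤ → Ω → ℝ} (hY : ∀ s, MemLp (Y s) 4 P)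
    (n : ℕ × ℕ) (χ : ℤ × ℤ → ℂ) : MemLp (fun x => ‖linStat Y n χ x‖ ^ 2) 2 P := by
  have h1 : MemLp (linStat Y n χ) 4 P := by
    refine memLp_finsetSum (region 0 n) (f := fun s x => (Y s x : ℂ) * χ s) fun s _ => ?_
    exact (hY s).ofReal.mul_const (χ s)
  have h2 := h1.norm
  have h3 : MemLp (fun x => ‖linStat Y n χ x‖ * ‖linStat Y n χ x‖) 2 P :=
    MemLp.mul' (p := 4) (q := 4) (r := 2) h2 h2 (hpqr := ⟨by
      rw [show (4 : ENNReal) = 2 * 2 by norm_num, ENNReal.mul_inv (by simp) (by simp),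
        ← mul_add, ENNReal.inv_two_add_inv_two, mul_one]⟩)
  simpa only [pow_two] using h3

variable {γ : ℤ × ℤ → ℝ} {κ : (ℤ × ℤ) × (ℤ × ℤ) × (ℤ × ℤ) → ℝ}

lemma star_covForm (n : ℕ × ℕ) (χ η : ℤ × ℤ → ℂ) :
    star (covForm γ n χ η) = covForm γ n (fun s => star (χ s)) fun s => star (η s) := by
  simp only [covForm, star_sum, star_mul', Complex.star_def, Complex.conj_ofReal]

lemma integral_norm_linStat_sq {Y : ℤ × ℤ → Ω → ℝ} (hY : ∀ s, MemLp (Y s) 4 P)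
    (h2 : ∀ s t, ∫ x, Y s x * Y t x ∂P = γ (t - s)) (n : ℕ × ℕ) (χ : ℤ × ℤ → ℂ) :
    ((∫ x, ‖linStat Y n χ x‖ ^ 2 ∂P : ℝ) : ℂ) = covForm γ n (fun s => star (χ s)) χ := by
  have hInt : ∀ s t, Integrable (fun x => ((Y s x * Y t x : ℝ) : ℂ) * (star (χ s) * χ t)) P :=
    fun s t => ((((hY s).mono_exponent (by norm_num : (2 : ENNReal) ≤ 4)).integrable_mul
      ((hY t).mono_exponent (by norm_num : (2 : ENNReal) ≤ 4))).ofReal).mul_const _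
  rw [← integral_complex_ofReal]
  simp_rw [norm_linStat_sq]
  rw [integral_finsetSum _ fun s _ => integrable_finsetSum _ fun t _ => hInt s t, covForm]
  refine Finset.sum_congr rfl fun s _ => ?_
  rw [integral_finsetSum _ fun t _ => hInt s t]
  refine Finset.sum_congr rfl fun t _ => ?_
  rw [integral_mul_const, integral_complex_ofReal, h2]

/-- Fourth moments of linear statistics, in terms of covariances and fourth cumulants. -/
lemma integral_norm_linStat_sq_mul {Y : ℤ × ℤ → Ω → ℝ} (hY : ∀ s, MemLp (Y s) 4 P)
    (h2 : ∀ s t, ∫ x, Y s x * Y t x ∂P = γ (t - s))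
    (h4 : ∀ s t u v, ∫ x, Y s x * Y t x * Y u x * Y v x ∂P = κ (t - s, u - s, v - s) +
      γ (t - s) * γ (v - u) + γ (u - s) * γ (v - t) + γ (v - s) * γ (u - t))
    (heven : ∀ h, γ (-h) = γ h)
    (n : ℕ × ℕ) (χ η : ℤ × ℤ → ℂ) :
    ((∫ x, ‖linStat Y n χ x‖ ^ 2 * ‖linStat Y n η x‖ ^ 2 ∂P : ℝ) : ℂ) =
      cumForm κ n χ η +
        ((∫ x, ‖linStat Y n χ x‖ ^ 2 ∂P : ℝ) : ℂ) * ((∫ x, ‖linStat Y n η x‖ ^ 2 ∂P : ℝ) : ℂ) +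
        ((‖covForm γ n χ fun s => star (η s)‖ ^ 2 : ℝ) : ℂ) +
        ((‖covForm γ n χ η‖ ^ 2 : ℝ) : ℂ) := by
  have hInt : ∀ s t u v, Integrable (fun x => ((Y s x * Y t x * Y u x * Y v x : ℝ) : ℂ) *
      (star (χ s) * χ t * (η u * star (η v)))) P := fun s t u v =>
    (integrable_mul_four (hY s) (hY t) (hY u) (hY v)).ofReal.mul_const _
  have hsq : ∀ z : ℂ, ((‖z‖ ^ 2 : ℝ) : ℂ) = star z * z := by
    intro z
    rw [← Complex.normSq_eq_norm_sq, ← Complex.mul_conj, mul_comm, Complex.star_def]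
  have e0 : ((∫ x, ‖linStat Y n χ x‖ ^ 2 * ‖linStat Y n η x‖ ^ 2 ∂P : ℝ) : ℂ) =
      ∑ s ∈ region 0 n, ∑ t ∈ region 0 n, ∑ u ∈ region 0 n, ∑ v ∈ region 0 n,
        ((κ (t - s, u - s, v - s) + γ (t - s) * γ (v - u) + γ (u - s) * γ (v - t) +
          γ (v - s) * γ (u - t) : ℝ) : ℂ) * (star (χ s) * χ t * (η u * star (η v))) := by
    rw [← integral_complex_ofReal]
    simp_rw [norm_linStat_sq_mul]
    rw [integral_finsetSum _ fun s _ => integrable_finsetSum _ fun t _ =>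
      integrable_finsetSum _ fun u _ => integrable_finsetSum _ fun v _ => hInt s t u v]
    refine Finset.sum_congr rfl fun s _ => ?_
    rw [integral_finsetSum _ fun t _ =>
      integrable_finsetSum _ fun u _ => integrable_finsetSum _ fun v _ => hInt s t u v]
    refine Finset.sum_congr rfl fun t _ => ?_
    rw [integral_finsetSum _ fun u _ => integrable_finsetSum _ fun v _ => hInt s t u v]
    refine Finset.sum_congr rfl fun u _ => ?_
    rw [integral_finsetSum _ fun v _ => hInt s t u v]
    refine Finset.sum_congr rfl fun v _ => ?_
    rw [integral_mul_const, integral_complex_ofReal, h4]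
  -- The three pairings of {s, t, u, v} factor into products of bilinear forms: the first gives the
  -- product of means, the others the squared moduli of a covariance and a pseudo-covariance.
  have e1 : covForm γ n (fun s => star (χ s)) χ * covForm γ n η (fun s => star (η s)) =
      ∑ s ∈ region 0 n, ∑ t ∈ region 0 n, ∑ u ∈ region 0 n, ∑ v ∈ region 0 n,
        ((γ (t - s) * γ (v - u) : ℝ) : ℂ) * (star (χ s) * χ t * (η u * star (η v))) := by
    rw [covForm, covForm, Finset.sum_mul]
    refine Finset.sum_congr rfl fun s _ => ?_
    rw [Finset.sum_mul]
    refine Finset.sum_congr rfl fun t _ => ?_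
    rw [Finset.mul_sum]
    refine Finset.sum_congr rfl fun u _ => ?_
    rw [Finset.mul_sum]
    refine Finset.sum_congr rfl fun v _ => ?_
    push_cast
    ring
  have e2 : covForm γ n (fun s => star (χ s)) η * covForm γ n χ (fun s => star (η s)) =
      ∑ s ∈ region 0 n, ∑ t ∈ region 0 n, ∑ u ∈ region 0 n, ∑ v ∈ region 0 n,
        ((γ (u - s) * γ (v - t) : ℝ) : ℂ) * (star (χ s) * χ t * (η u * star (η v))) := by
    rw [covForm, covForm, Finset.sum_mul_sum]
    refine Finset.sum_congr rfl fun s _ => Finset.sum_congr rfl fun t _ => ?_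
    rw [Finset.sum_mul_sum]
    refine Finset.sum_congr rfl fun u _ => Finset.sum_congr rfl fun v _ => ?_
    push_cast
    ring
  have e3 : covForm γ n (fun s => star (χ s)) (fun s => star (η s)) * covForm γ n χ η =
      ∑ s ∈ region 0 n, ∑ t ∈ region 0 n, ∑ u ∈ region 0 n, ∑ v ∈ region 0 n,
        ((γ (v - s) * γ (u - t) : ℝ) : ℂ) * (star (χ s) * χ t * (η u * star (η v))) := by
    rw [covForm, covForm, Finset.sum_mul_sum]
    refine Finset.sum_congr rfl fun s _ => Finset.sum_congr rfl fun t _ => ?_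
    rw [Finset.sum_mul_sum, Finset.sum_comm]
    refine Finset.sum_congr rfl fun u _ => Finset.sum_congr rfl fun v _ => ?_
    push_cast
    ring
  -- The first pairing produces this form with its arguments in the opposite order; evenness of γ
  -- restores the order of the mean.
  have hη : covForm γ n η (fun s => star (η s)) = covForm γ n (fun s => star (η s)) η := by
    rw [covForm, covForm, Finset.sum_comm]
    refine Finset.sum_congr rfl fun s _ => Finset.sum_congr rfl fun t _ => ?_
    rw [← heven, neg_sub, mul_comm (η t)]
  rw [integral_norm_linStat_sq hY h2, integral_norm_linStat_sq hY h2, hsq, hsq, star_covForm,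
    star_covForm]
  simp only [star_star]
  rw [← hη, e0, e1, e2, e3, cumForm]
  simp only [← Finset.sum_add_distrib]
  refine Finset.sum_congr rfl fun s _ => Finset.sum_congr rfl fun t _ =>
    Finset.sum_congr rfl fun u _ => Finset.sum_congr rfl fun v _ => ?_
  push_cast
  ring

end Moments

/-! ### Stationarity of order four -/

section Stationary

variable {Ω : Type*} [MeasurableSpace Ω] {P : Measure Ω} [IsProbabilityMeasure P]
  {Z : ℤ × ℤ → Ω → ℝ}

lemma FourthOrderStationary.integral_finset_prod (h : FourthOrderStationary P Z) {ι : Type*}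
    (t : Finset ι) (ht : t.card ≤ 4) (s : ι → ℤ × ℤ) (a : ℤ × ℤ) :
    ∫ x, ∏ i ∈ t, Z (s i + a) x ∂P = ∫ x, ∏ i ∈ t, Z (s i) x ∂P := by
  have e : ∀ f : ι → ℝ, ∏ i ∈ t, f i = ∏ k : Fin t.card, f (t.equivFin.symm k) := by
    intro f
    rw [← Finset.prod_coe_sort]
    exact (Equiv.prod_comp t.equivFin.symm (fun i : t => f i)).symm
  simp_rw [e]
  exact h.2 t.card ht (fun k => s (t.equivFin.symm k)) a

lemma FourthOrderStationary.mean_eq (h : FourthOrderStationary P Z) (s : ℤ × ℤ) :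
    P[Z s] = P[Z 0] := by
  simpa using h.integral_finset_prod (Finset.univ : Finset (Fin 1)) (by simp) (fun _ => 0) s

/-- Centered joint moments of order at most four are translation invariant. -/
lemma FourthOrderStationary.integral_centered_prod (h : FourthOrderStationary P Z) (m : ℝ)
    {ι : Type*} [Fintype ι] (hι : Fintype.card ι ≤ 4) (s : ι → ℤ × ℤ) (a : ℤ × ℤ) :
    ∫ x, ∏ i, (Z (s i + a) x - m) ∂P = ∫ x, ∏ i, (Z (s i) x - m) ∂P := by
  classical
  -- Expansion over subsets reduces a centered moment to raw moments of order at most four, whose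
  -- invariance is the hypothesis.
  have key : ∀ r : ι → ℤ × ℤ, ∫ x, ∏ i, (Z (r i) x - m) ∂P =
      ∑ t ∈ (Finset.univ : Finset ι).powerset,
        (∫ x, ∏ i ∈ t, Z (r i) x ∂P) * ∏ i ∈ Finset.univ \ t, (-m) := by
    intro r
    simp_rw [sub_eq_add_neg, Finset.prod_add]
    rw [integral_finsetSum]
    · exact Finset.sum_congr rfl fun t _ => integral_mul_const _ _
    · intro t _
      exact (integrable_prod_of_memLp_four (fun i _ => h.1 (r i))
        ((Finset.card_le_univ t).trans hι)).mul_const _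
  rw [key, key]
  refine Finset.sum_congr rfl fun t _ => ?_
  rw [h.integral_finset_prod t ((Finset.card_le_univ t).trans hι)]

lemma FourthOrderStationary.integral_centered_two (h : FourthOrderStationary P Z)
    (s t a : ℤ × ℤ) :
    ∫ x, (Z (s + a) x - P[Z 0]) * (Z (t + a) x - P[Z 0]) ∂P =
      ∫ x, (Z s x - P[Z 0]) * (Z t x - P[Z 0]) ∂P := by
  simpa [Fin.prod_univ_two] using
    h.integral_centered_prod (P[Z 0]) (ι := Fin 2) (by simp) ![s, t] a

lemma FourthOrderStationary.covariance_eq (h : FourthOrderStationary P Z) (s t : ℤ × ℤ) :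
    cov[Z s, Z t; P] = autocov P Z (t - s) := by
  rw [autocov, covariance, covariance, h.mean_eq s, h.mean_eq t, h.mean_eq (t - s)]
  simpa using h.integral_centered_two 0 (t - s) s

lemma FourthOrderStationary.autocov_neg (h : FourthOrderStationary P Z) (a : ℤ × ℤ) :
    autocov P Z (-a) = autocov P Z a := by
  have := h.covariance_eq a 0
  rw [zero_sub, covariance_comm] at this
  exact this.symm

lemma FourthOrderStationary.cumulant4_eq (h : FourthOrderStationary P Z) (s t u v : ℤ × ℤ) :
    cumulant4 P (Z s) (Z t) (Z u) (Z v) = fieldCumulant4 P Z (t - s, u - s, v - s) := by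
  simp only [fieldCumulant4, cumulant4, h.covariance_eq, h.mean_eq s, h.mean_eq t, h.mean_eq u,
    h.mean_eq v, h.mean_eq (t - s), h.mean_eq (u - s), h.mean_eq (v - s), sub_zero,
    sub_sub_sub_cancel_right]
  have := h.integral_centered_prod (P[Z 0]) (ι := Fin 4) (by simp)
    ![0, t - s, u - s, v - s] s
  simp only [Fin.prod_univ_four] at this
  simp at this
  rw [this]

/-- The centered field translated by `j`. -/
noncomputable def centered (P : Measure Ω) (Z : ℤ × ℤ → Ω → ℝ) (j s : ℤ × ℤ) (x : Ω) : ℝ :=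
  Z (s + j) x - P[Z 0]

lemma FourthOrderStationary.memLp_centered (h : FourthOrderStationary P Z) (j s : ℤ × ℤ) :
    MemLp (centered P Z j s) 4 P := (h.1 (s + j)).sub (memLp_const _)

lemma FourthOrderStationary.integral_centered_mul (h : FourthOrderStationary P Z)
    (j s t : ℤ × ℤ) :
    ∫ x, centered P Z j s x * centered P Z j t x ∂P = autocov P Z (t - s) := by
  have := h.covariance_eq (s + j) (t + j)
  rw [covariance, h.mean_eq (s + j), h.mean_eq (t + j), add_sub_add_right_eq_sub] at this
  exact this

lemma FourthOrderStationary.integral_centered_mul_four (h : FourthOrderStationary P Z)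
    (j s t u v : ℤ × ℤ) :
    ∫ x, centered P Z j s x * centered P Z j t x * centered P Z j u x * centered P Z j v x ∂P =
      fieldCumulant4 P Z (t - s, u - s, v - s) + autocov P Z (t - s) * autocov P Z (v - u) +
        autocov P Z (u - s) * autocov P Z (v - t) +
        autocov P Z (v - s) * autocov P Z (u - t) := by
  have := h.cumulant4_eq (s + j) (t + j) (u + j) (v + j)
  simp only [add_sub_add_right_eq_sub] at this
  rw [← this]
  simp only [cumulant4, h.covariance_eq, h.mean_eq (s + j), h.mean_eq (t + j), h.mean_eq (u + j),
    h.mean_eq (v + j), add_sub_add_right_eq_sub, centered]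
  ring

end Stationary

/-! ### The periodogram at nonzero Fourier frequencies -/

section Periodogram

variable {Ω : Type*} [MeasurableSpace Ω] (P : Measure Ω) (Z : ℤ × ℤ → Ω → ℝ)

lemma sum_region_shift {E : Type*} [AddCommMonoid E] (j : ℤ × ℤ) (n : ℕ × ℕ) (g : ℤ × ℤ → E) :
    ∑ s ∈ region j n, g s = ∑ s ∈ region 0 n, g (s + j) := by
  symm
  refine Finset.sum_nbij' (fun s => s + j) (fun s => s - j) ?_ ?_ ?_ ?_ ?_
  · intro s hs
    simp only [region, Finset.mem_product, Finset.mem_Icc, Prod.fst_add, Prod.snd_add,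
      Prod.fst_zero, Prod.snd_zero] at hs ⊢
    omega
  · intro s hs
    simp only [region, Finset.mem_product, Finset.mem_Icc, Prod.fst_sub, Prod.snd_sub,
      Prod.fst_zero, Prod.snd_zero] at hs ⊢
    omega
  · intro s _; simp
  · intro s _; simp
  · intro s _; rfl

lemma abs_lt_of_mem_fullIndex {n : ℕ × ℕ} (h1 : 0 < n.1) (h2 : 0 < n.2) {i : ℤ × ℤ}
    (hi : i ∈ fullIndex n) : |i.1| < n.1 ∧ |i.2| < n.2 := by
  rw [mem_fullIndex] at hi
  have a1 := abs_le_of_mem_indexRange hi.1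
  have a2 := abs_le_of_mem_indexRange hi.2
  omega

lemma pos_of_mem_fullIndex {n : ℕ × ℕ} {i : ℤ × ℤ} (hi : i ∈ fullIndex n) :
    0 < n.1 ∧ 0 < n.2 := by
  simp only [mem_fullIndex, mem_indexRange] at hi
  omega

lemma size_pos_of_mem {n : ℕ × ℕ} {i : ℤ × ℤ} (hi : i ∈ fourierIndex n) : 0 < size n :=
  let h := pos_of_mem_fullIndex (fourierIndex_subset n hi)
  size_pos h.1 h.2

/-- At nonzero Fourier frequencies the periodogram does not depend on the mean of the field. -/
lemma periodogram_eq_linStat (j : ℤ × ℤ) {n : ℕ × ℕ} {i : ℤ × ℤ} (hi : i ∈ fourierIndex n)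
    (x : Ω) :
    periodogram Z j n (fourierFreq n i) x = ((2 * Real.pi) ^ 2)⁻¹ * (size n)⁻¹ *
      ‖linStat (centered P Z j) n (expChar (fourierFreq n i)) x‖ ^ 2 := by
  have hpos := pos_of_mem_fullIndex (fourierIndex_subset n hi)
  have hlt := abs_lt_of_mem_fullIndex hpos.1 hpos.2 (fourierIndex_subset n hi)
  have hi0 : i ≠ 0 := by
    rw [fourierIndex_eq_erase, Finset.mem_erase] at hi
    exact hi.1
  have hsum : ∑ s ∈ region 0 n, expChar (fourierFreq n i) s = 0 := by
    rw [sum_region_expChar hlt.1 hlt.2, if_neg hi0]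
  rw [periodogram]
  congr 2
  -- Translating the block only multiplies the transform by a phase of modulus one, and subtracting
  -- the mean changes nothing since the character sums to zero.
  have h1 : ∑ s ∈ region j n, (Z s x : ℂ) *
      Complex.exp (-Complex.I * (dotFreq s (fourierFreq n i) : ℂ)) =
      expChar (fourierFreq n i) j *
        linStat (centered P Z j) n (expChar (fourierFreq n i)) x := by
    rw [sum_region_shift]
    change ∑ s ∈ region 0 n, (Z (s + j) x : ℂ) * expChar (fourierFreq n i) (s + j) = _
    have h2 : linStat (centered P Z j) n (expChar (fourierFreq n i)) x =
        ∑ s ∈ region 0 n, (Z (s + j) x : ℂ) * expChar (fourierFreq n i) s -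
          ((P[Z 0] : ℝ) : ℂ) * ∑ s ∈ region 0 n, expChar (fourierFreq n i) s := by
      rw [linStat, Finset.mul_sum, ← Finset.sum_sub_distrib]
      refine Finset.sum_congr rfl fun s _ => ?_
      rw [centered]
      push_cast
      ring
    rw [h2, hsum, mul_zero, sub_zero, Finset.mul_sum]
    refine Finset.sum_congr rfl fun s _ => ?_
    rw [expChar_add]
    ring
  rw [h1, norm_mul, norm_expChar, one_mul]

end Periodogram

/-! ### The fourth-cumulant contribution to the variance -/

section Cumulant

variable {κ : (ℤ × ℤ) × (ℤ × ℤ) × (ℤ × ℤ) → ℝ}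

/-- The sites `s` of the region for which `s + h₁`, `s + h₂`, `s + h₃` stay in the region. -/
noncomputable def innerSites (n : ℕ × ℕ) (h : (ℤ × ℤ) × (ℤ × ℤ) × (ℤ × ℤ)) : Finset (ℤ × ℤ) :=
  (region 0 n).filter fun s =>
    s + h.1 ∈ region 0 n ∧ s + h.2.1 ∈ region 0 n ∧ s + h.2.2 ∈ region 0 n

/-- The proportion of inner sites. -/
noncomputable def innerFraction (n : ℕ × ℕ) (h : (ℤ × ℤ) × (ℤ × ℤ) × (ℤ × ℤ)) : ℝ :=
  (size n)⁻¹ * (innerSites n h).card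

lemma innerFraction_nonneg (n : ℕ × ℕ) (h : (ℤ × ℤ) × (ℤ × ℤ) × (ℤ × ℤ)) :
    0 ≤ innerFraction n h :=
  mul_nonneg (inv_nonneg.mpr (size_nonneg n)) (Nat.cast_nonneg _)

lemma innerFraction_le_one (n : ℕ × ℕ) (h : (ℤ × ℤ) × (ℤ × ℤ) × (ℤ × ℤ)) :
    innerFraction n h ≤ 1 := by
  have h1 : ((innerSites n h).card : ℝ) ≤ size n := by
    rw [← card_region]
    exact_mod_cast Finset.card_filter_le _ _
  exact inv_mul_le_of_le_mul₀ (size_nonneg n) zero_le_one (by simpa using h1)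

lemma tendsto_innerFraction (h : (ℤ × ℤ) × (ℤ × ℤ) × (ℤ × ℤ)) :
    Tendsto (fun n => innerFraction n h) atTop (𝓝 1) := by
  have t := (tendsto_const_nhds (x := (1 : ℝ)) (f := (atTop : Filter (ℕ × ℕ)))).sub
    (((tendsto_exitFraction h.1).add (tendsto_exitFraction h.2.1)).add
      (tendsto_exitFraction h.2.2))
  simp only [add_zero, sub_zero] at t
  refine tendsto_of_tendsto_of_tendsto_of_le_of_le' t tendsto_const_nhds ?_
    (Eventually.of_forall fun n => innerFraction_le_one n h)
  filter_upwards [eventually_pos] with n hn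
  have hs := size_pos hn.1 hn.2
  have hcard : (region 0 n).card ≤ (innerSites n h).card +
      (((region 0 n).filter fun t => t + h.1 ∉ region 0 n).card +
      ((region 0 n).filter fun t => t + h.2.1 ∉ region 0 n).card +
      ((region 0 n).filter fun t => t + h.2.2 ∉ region 0 n).card) := by
    refine le_trans (Finset.card_le_card (t := innerSites n h ∪
      (((region 0 n).filter fun t => t + h.1 ∉ region 0 n) ∪
      ((region 0 n).filter fun t => t + h.2.1 ∉ region 0 n) ∪
      ((region 0 n).filter fun t => t + h.2.2 ∉ region 0 n))) ?_) ?_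
    · intro s hs
      simp only [innerSites, Finset.mem_union, Finset.mem_filter, hs, true_and]
      tauto
    · refine (Finset.card_union_le _ _).trans (Nat.add_le_add_left ?_ _)
      refine (Finset.card_union_le _ _).trans (Nat.add_le_add_right ?_ _)
      exact Finset.card_union_le _ _
  have hcard' : size n ≤ (innerSites n h).card +
      ((((region 0 n).filter fun t => t + h.1 ∉ region 0 n).card : ℝ) +
      ((region 0 n).filter fun t => t + h.2.1 ∉ region 0 n).card +
      ((region 0 n).filter fun t => t + h.2.2 ∉ region 0 n).card) := by
    rw [← card_region]
    exact_mod_cast hcard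
  have h1 := mul_le_mul_of_nonneg_left hcard' (inv_nonneg.mpr hs.le)
  rw [inv_mul_cancel₀ hs.ne', mul_add, mul_add, mul_add] at h1
  simp only [innerFraction, exitFraction]
  linarith

/-- In terms of the differences from s, the product of characters no longer depends on s. The sum
over s therefore merely counts the sites for which all shifted points stay inside. -/
lemma cumForm_expChar_eq_tsum (hκ : Summable fun h => |κ h|) (n : ℕ × ℕ) (w v : ℝ × ℝ) :
    cumForm κ n (expChar w) (expChar v) = ∑' h, (κ h : ℂ) *
      ((innerSites n h).card * (expChar w h.1 * expChar v (h.2.1 - h.2.2))) := by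
  have hs : ∀ s, Summable fun h : (ℤ × ℤ) × (ℤ × ℤ) × (ℤ × ℤ) =>
      if s + h.1 ∈ region 0 n ∧ s + h.2.1 ∈ region 0 n ∧ s + h.2.2 ∈ region 0 n then
        (κ h : ℂ) * (expChar w h.1 * expChar v (h.2.1 - h.2.2)) else 0 := fun s =>
    Summable.of_norm_bounded hκ fun h => by split_ifs <;> simp
  have h1 : ∀ s, (∑ t ∈ region 0 n, ∑ u ∈ region 0 n, ∑ r ∈ region 0 n,
      (κ (t - s, u - s, r - s) : ℂ) *
        (star (expChar w s) * expChar w t * (expChar v u * star (expChar v r)))) =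
      ∑' h : (ℤ × ℤ) × (ℤ × ℤ) × (ℤ × ℤ),
        if s + h.1 ∈ region 0 n ∧ s + h.2.1 ∈ region 0 n ∧ s + h.2.2 ∈ region 0 n then
          (κ h : ℂ) * (expChar w h.1 * expChar v (h.2.1 - h.2.2)) else 0 := by
    intro s
    rw [← (Equiv.subRight ((s, s, s) : (ℤ × ℤ) × (ℤ × ℤ) × (ℤ × ℤ))).tsum_eq,
      tsum_eq_sum (s := region 0 n ×ˢ region 0 n ×ˢ region 0 n)]
    · rw [Finset.sum_product]
      refine Finset.sum_congr rfl fun t ht => ?_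
      rw [Finset.sum_product]
      refine Finset.sum_congr rfl fun u hu => Finset.sum_congr rfl fun r hr => ?_
      simp only [Equiv.subRight_apply, Prod.fst_sub, Prod.snd_sub, add_sub_cancel, ht, hu, hr,
        and_self, if_true, sub_sub_sub_cancel_right, expChar_mul_star]
      rw [mul_comm (star _), expChar_mul_star]
      rfl
    · intro b hb
      simp only [Finset.mem_product] at hb
      simp only [Equiv.subRight_apply, Prod.fst_sub, Prod.snd_sub, add_sub_cancel, hb, if_false]
  rw [cumForm, Finset.sum_congr rfl fun s _ => h1 s, ← Summable.tsum_finsetSum fun s _ => hs s]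
  refine tsum_congr fun h => ?_
  rw [← Finset.sum_filter, Finset.sum_const, nsmul_eq_mul]
  simp only [innerSites]
  ring

/-- The bound has order n, whereas second moments of the periodogram are normalized by n²; at a
single frequency cumulants are thus negligible. -/
lemma norm_cumForm_expChar_le (hκ : Summable fun h => |κ h|) (n : ℕ × ℕ) (w v : ℝ × ℝ) :
    ‖cumForm κ n (expChar w) (expChar v)‖ ≤ size n * ∑' h, |κ h| := by
  rw [cumForm_expChar_eq_tsum hκ]
  refine tsum_of_norm_bounded (hκ.hasSum.mul_left (size n)) fun h => ?_
  have h1 : ((innerSites n h).card : ℝ) ≤ size n := by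
    rw [← card_region]
    exact_mod_cast Finset.card_filter_le _ _
  simp only [norm_mul, norm_expChar, mul_one, Complex.norm_real, Real.norm_eq_abs,
    Complex.norm_natCast]
  rw [mul_comm]
  exact mul_le_mul_of_nonneg_right h1 (abs_nonneg _)

/-- The discrete Fourier coefficient of `ψ` over the nonzero Fourier frequencies. -/
noncomputable def gridCoeff (ψ : ℝ × ℝ → ℝ) (n : ℕ × ℕ) (a : ℤ × ℤ) : ℂ :=
  (size n)⁻¹ • ∑ i ∈ fourierIndex n, (ψ (fourierFreq n i) : ℂ) * expChar (fourierFreq n i) a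

/-- The Fourier coefficient of `ψ` over the frequency square. -/
noncomputable def fourierCoeff (ψ : ℝ × ℝ → ℝ) (a : ℤ × ℤ) : ℂ :=
  ((2 * Real.pi) ^ 2)⁻¹ • ∫ w in freqSquare, (ψ w : ℂ) * expChar w a

lemma card_fourierIndex_le (n : ℕ × ℕ) : ((fourierIndex n).card : ℝ) ≤ size n := by
  rw [← card_fullIndex]
  exact_mod_cast Finset.card_le_card (fourierIndex_subset n)

lemma norm_gridCoeff_le {ψ : ℝ × ℝ → ℝ} {B : ℝ} (hB0 : 0 ≤ B)
    (hB : ∀ w ∈ freqSquare, |ψ w| ≤ B) (n : ℕ × ℕ) (a : ℤ × ℤ) : ‖gridCoeff ψ n a‖ ≤ B := by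
  rw [gridCoeff, norm_smul, norm_inv, Real.norm_of_nonneg (size_nonneg n)]
  refine inv_mul_le_of_le_mul₀ (size_nonneg n) hB0 ?_
  refine (norm_sum_le_of_le (fourierIndex n) (f := fun i => (ψ (fourierFreq n i) : ℂ) *
    expChar (fourierFreq n i) a) (n := fun _ => B) fun i hi => ?_).trans ?_
  · simpa using hB _ (fourierFreq_mem (fourierIndex_subset n hi))
  · rw [Finset.sum_const, nsmul_eq_mul]
    exact mul_le_mul_of_nonneg_right (card_fourierIndex_le n) hB0

lemma tendsto_gridCoeff {ψ : ℝ × ℝ → ℝ} (hψ : BoundedVariationSquare ψ) (a : ℤ × ℤ) :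
    Tendsto (fun n => gridCoeff ψ n a) atTop (𝓝 (fourierCoeff ψ a)) := by
  obtain ⟨B, hB0, hB⟩ := hψ.exists_bound
  refine tendsto_fourier_average (β := id) tendsto_id
    (fun n i => (ψ (fourierFreq n i) : ℂ) * expChar (fourierFreq n i) a)
    (fun w => (ψ w : ℂ) * expChar w a) B ?_ ?_
  · refine Eventually.of_forall fun n i hi => ?_
    simpa using hB _ (fourierFreq_mem (fourierIndex_subset n hi))
  · filter_upwards [hψ.ae_continuousWithinAt, ae_isRegularFreq] with w h1 h2
    exact ((Complex.continuous_ofReal.tendsto _).comp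
      (tendsto_grid_of_continuousWithinAt h2 h1).1).mul
      (((continuous_expChar a).tendsto w).comp (tendsto_fourierFreq_gridIndex w))

/-- For fixed h the characters at the two frequencies factor, so the sums over i and k separate. Of
the three factors 1/n, one normalizes the count of inner sites and two normalize the discrete
Fourier coefficients. -/
lemma sum_cumForm_eq (hκ : Summable fun h => |κ h|) (ψ : ℝ × ℝ → ℝ) (n : ℕ × ℕ) :
    (((size n)⁻¹ ^ 3 : ℝ) : ℂ) * ∑ i ∈ fourierIndex n, ∑ k ∈ fourierIndex n,
      ((ψ (fourierFreq n i) * ψ (fourierFreq n k) : ℝ) : ℂ) *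
        cumForm κ n (expChar (fourierFreq n i)) (expChar (fourierFreq n k)) =
      ∑' h, (κ h : ℂ) * (innerFraction n h *
        (gridCoeff ψ n h.1 * gridCoeff ψ n (h.2.1 - h.2.2))) := by
  have hs : ∀ i k, Summable fun h : (ℤ × ℤ) × (ℤ × ℤ) × (ℤ × ℤ) =>
      ((ψ (fourierFreq n i) * ψ (fourierFreq n k) : ℝ) : ℂ) * ((κ h : ℂ) *
      ((innerSites n h).card * (expChar (fourierFreq n i) h.1 *
        expChar (fourierFreq n k) (h.2.1 - h.2.2)))) := fun i k => by
    refine Summable.mul_left _ (Summable.of_norm_bounded (hκ.mul_left (size n)) fun h => ?_)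
    have h1 : ((innerSites n h).card : ℝ) ≤ size n := by
      rw [← card_region]
      exact_mod_cast Finset.card_filter_le _ _
    simp only [norm_mul, norm_expChar, mul_one, Complex.norm_real, Real.norm_eq_abs,
      Complex.norm_natCast]
    rw [mul_comm]
    exact mul_le_mul_of_nonneg_right h1 (abs_nonneg _)
  simp_rw [cumForm_expChar_eq_tsum hκ, ← tsum_mul_left]
  rw [Finset.sum_congr rfl fun i _ => (Summable.tsum_finsetSum fun k _ => hs i k).symm,
    ← Summable.tsum_finsetSum fun i _ => summable_sum fun k _ => hs i k, ← tsum_mul_left]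
  refine tsum_congr fun h => ?_
  rw [gridCoeff, gridCoeff, smul_mul_smul_comm, Finset.sum_mul_sum, innerFraction,
    Finset.mul_sum, Finset.smul_sum, Finset.mul_sum, Finset.mul_sum]
  refine Finset.sum_congr rfl fun i _ => ?_
  rw [Finset.mul_sum, Finset.smul_sum, Finset.mul_sum, Finset.mul_sum]
  refine Finset.sum_congr rfl fun k _ => ?_
  rw [Complex.real_smul]
  push_cast
  ring

/-- Termwise convergence under the dominating series of |κ| B², with B a bound for |ψ|. -/
lemma tendsto_sum_cumForm (hκ : Summable fun h => |κ h|) {ψ : ℝ × ℝ → ℝ}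
    (hψ : BoundedVariationSquare ψ) :
    Tendsto (fun n => (((size n)⁻¹ ^ 3 : ℝ) : ℂ) * ∑ i ∈ fourierIndex n, ∑ k ∈ fourierIndex n,
      ((ψ (fourierFreq n i) * ψ (fourierFreq n k) : ℝ) : ℂ) *
        cumForm κ n (expChar (fourierFreq n i)) (expChar (fourierFreq n k))) atTop
      (𝓝 (∑' h, (κ h : ℂ) * (fourierCoeff ψ h.1 * fourierCoeff ψ (h.2.1 - h.2.2)))) := by
  obtain ⟨B, hB0, hB⟩ := hψ.exists_bound
  refine Tendsto.congr (f₁ := fun n => ∑' h, (κ h : ℂ) * (innerFraction n h *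
        (gridCoeff ψ n h.1 * gridCoeff ψ n (h.2.1 - h.2.2)))) ?_ ?_
  · exact fun n => (sum_cumForm_eq hκ ψ n).symm
  · refine tendsto_tsum_of_dominated_convergence (hκ.mul_right (1 * (B * B))) (fun h => ?_) ?_
    · have t1 : Tendsto (fun n => (innerFraction n h : ℂ)) atTop (𝓝 1) := by
        have := (Complex.continuous_ofReal.tendsto _).comp (tendsto_innerFraction h)
        rw [Complex.ofReal_one] at this
        exact this
      have t2 := t1.mul ((tendsto_gridCoeff hψ h.1).mul (tendsto_gridCoeff hψ (h.2.1 - h.2.2)))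
      rw [one_mul] at t2
      exact t2.const_mul _
    · refine Eventually.of_forall fun n h => ?_
      simp only [norm_mul, Complex.norm_real, Real.norm_eq_abs,
        abs_of_nonneg (innerFraction_nonneg n h)]
      gcongr
      · exact innerFraction_le_one n h
      · exact norm_gridCoeff_le hB0 hB n _
      · exact norm_gridCoeff_le hB0 hB n _

end Cumulant

/-! ### The second variance component as a series in Fourier coefficients -/

section SigmaTwo

variable {Ω : Type*} [MeasurableSpace Ω] (P : Measure Ω) (Z : ℤ × ℤ → Ω → ℝ)

/-- At the third frequency -ω₂ the lags h₂ and h₃ enter the phase only through their difference,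
which matches the shape of the cumulant limit. -/
lemma specDensity4_neg (w₁ w₂ : ℝ × ℝ) :
    specDensity4 P Z w₁ w₂ (-w₂) = (((2 * Real.pi) ^ 6)⁻¹ : ℝ) *
      ∑' h, (fieldCumulant4 P Z h : ℂ) * (expChar w₁ h.1 * expChar w₂ (h.2.1 - h.2.2)) := by
  rw [specDensity4]
  congr 1
  refine tsum_congr fun h => ?_
  rw [expChar, expChar, ← Complex.exp_add]
  congr 2
  simp [dotFreq]
  ring

lemma integrable_mul_expChar {ψ : ℝ × ℝ → ℝ} (hψ : BoundedVariationSquare ψ) (a : ℤ × ℤ) :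
    Integrable (fun w => (ψ w : ℂ) * expChar w a) (volume.restrict freqSquare) := by
  obtain ⟨B, hB0, hB⟩ := hψ.exists_bound
  refine Integrable.of_bound (C := B) ?_ ?_
  · exact (Complex.continuous_ofReal.comp_aestronglyMeasurable hψ.aestronglyMeasurable).mul
      (continuous_expChar a).aestronglyMeasurable
  · filter_upwards [ae_restrict_mem measurableSet_freqSquare] with w hw
    simpa using hB w hw

/-- The second variance component as a series in Fourier coefficients. -/
lemma sigmaSq2_eq_tsum {ψ : ℝ × ℝ → ℝ} (hψ : BoundedVariationSquare ψ)
    (hκ : Summable fun h => |fieldCumulant4 P Z h|) :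
    sigmaSq2 P Z ψ = (∑' h, (fieldCumulant4 P Z h : ℂ) *
      (fourierCoeff ψ h.1 * fourierCoeff ψ (h.2.1 - h.2.2))).re := by
  obtain ⟨B, hB0, hB⟩ := hψ.exists_bound
  set κ := fieldCumulant4 P Z
  set μ := (volume : Measure (ℝ × ℝ)).restrict freqSquare with hμ
  set c : ℂ := ((((2 * Real.pi) ^ 6)⁻¹ : ℝ) : ℂ) with hc
  let q : ℤ × ℤ → ℂ := fun a => ∫ w, (ψ w : ℂ) * expChar w a ∂μ
  have hnorm : ∀ a, ∫ w, ‖(ψ w : ℂ) * expChar w a‖ ∂μ ≤ B * μ.real Set.univ := by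
    intro a
    have h1 : ∫ w, ‖(ψ w : ℂ) * expChar w a‖ ∂μ ≤ ∫ _, B ∂μ := by
      refine integral_mono_ae (integrable_mul_expChar hψ a).norm (integrable_const B) ?_
      filter_upwards [ae_restrict_mem measurableSet_freqSquare] with w hw
      simpa using hB w hw
    simpa [mul_comm] using h1
  have hq : ∀ a, ‖q a‖ ≤ B * μ.real Set.univ := fun a =>
    (norm_integral_le_integral_norm _).trans (hnorm a)
  have hinner : ∀ w₁, ∫ w₂, (ψ w₁ : ℂ) * (ψ w₂ : ℂ) * specDensity4 P Z w₁ w₂ (-w₂) ∂μ =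
      c * ∑' h, (κ h : ℂ) * (((ψ w₁ : ℂ) * expChar w₁ h.1) * q (h.2.1 - h.2.2)) := by
    intro w₁
    have e1 : ∀ w₂, (ψ w₁ : ℂ) * (ψ w₂ : ℂ) * specDensity4 P Z w₁ w₂ (-w₂) =
        c * ∑' h, (κ h : ℂ) * ((ψ w₁ : ℂ) * expChar w₁ h.1) *
          ((ψ w₂ : ℂ) * expChar w₂ (h.2.1 - h.2.2)) := by
      intro w₂
      rw [specDensity4_neg, mul_left_comm, ← tsum_mul_left]
      congr 1
      exact tsum_congr fun h => by ring
    simp_rw [e1]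
    rw [integral_const_mul, ← integral_tsum_of_summable_integral_norm]
    · congr 1
      refine tsum_congr fun h => ?_
      rw [integral_const_mul]
      ring
    · exact fun h => (integrable_mul_expChar hψ _).const_mul _
    · refine (hκ.mul_right (|ψ w₁| * (B * μ.real Set.univ))).of_nonneg_of_le
        (fun h => integral_nonneg fun _ => norm_nonneg _) fun h => ?_
      simp_rw [norm_mul ((κ h : ℂ) * _)]
      rw [integral_const_mul]
      simp only [norm_mul ((κ h : ℂ)), norm_mul (ψ w₁ : ℂ), Complex.norm_real, Real.norm_eq_abs,
        norm_expChar, mul_one]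
      rw [mul_assoc]
      exact mul_le_mul_of_nonneg_left (mul_le_mul_of_nonneg_left (hnorm _) (abs_nonneg _))
        (abs_nonneg _)
  have houter : ∫ w₁, ∫ w₂, (ψ w₁ : ℂ) * (ψ w₂ : ℂ) * specDensity4 P Z w₁ w₂ (-w₂) ∂μ ∂μ =
      c * ∑' h, (κ h : ℂ) * (q h.1 * q (h.2.1 - h.2.2)) := by
    simp_rw [hinner]
    rw [integral_const_mul, ← integral_tsum_of_summable_integral_norm]
    · congr 1
      refine tsum_congr fun h => ?_
      rw [integral_const_mul, integral_mul_const]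
    · exact fun h => ((integrable_mul_expChar hψ _).mul_const _).const_mul _
    · refine (hκ.mul_right ((B * μ.real Set.univ) * (B * μ.real Set.univ))).of_nonneg_of_le
        (fun h => integral_nonneg fun _ => norm_nonneg _) fun h => ?_
      simp_rw [norm_mul (κ h : ℂ), norm_mul _ (q _)]
      rw [integral_const_mul, integral_mul_const, Complex.norm_real, Real.norm_eq_abs]
      refine mul_le_mul_of_nonneg_left (mul_le_mul (hnorm _) (hq _) (norm_nonneg _) ?_)
        (abs_nonneg _)
      exact mul_nonneg hB0 measureReal_nonneg
  have hπ : (2 * Real.pi) ≠ 0 := by positivity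
  have hcoef : ∀ a, q a = ((2 * Real.pi) ^ 2 : ℝ) * fourierCoeff ψ a := by
    intro a
    rw [fourierCoeff, Complex.real_smul, ← mul_assoc, ← Complex.ofReal_mul,
      mul_inv_cancel₀ (by positivity), Complex.ofReal_one, one_mul]
  rw [sigmaSq2, houter]
  simp_rw [hcoef]
  have e2 : ∀ h : (ℤ × ℤ) × (ℤ × ℤ) × (ℤ × ℤ), (κ h : ℂ) *
      ((((2 * Real.pi) ^ 2 : ℝ) : ℂ) * fourierCoeff ψ h.1 *
        ((((2 * Real.pi) ^ 2 : ℝ) : ℂ) * fourierCoeff ψ (h.2.1 - h.2.2))) =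
      (((2 * Real.pi) ^ 4 : ℝ) : ℂ) * ((κ h : ℂ) *
        (fourierCoeff ψ h.1 * fourierCoeff ψ (h.2.1 - h.2.2))) := by
    intro h
    push_cast
    ring
  simp_rw [e2]
  rw [tsum_mul_left, ← mul_assoc, hc, ← Complex.ofReal_mul, Complex.re_ofReal_mul, ← mul_assoc]
  -- The factors come from σ₂², from f₄, and from the two Fourier coefficients, each normalized by
  -- (2π)².
  have : (2 * Real.pi) ^ 2 * (((2 * Real.pi) ^ 6)⁻¹ * (2 * Real.pi) ^ 4) = 1 := by
    field_simp
  rw [this, one_mul]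

end SigmaTwo

/-! ### The covariance contribution to the variance -/

lemma abs_norm_sq_sub_le (a b : ℂ) :
    |‖a‖ ^ 2 - ‖b‖ ^ 2| ≤ ‖a - b‖ ^ 2 + 2 * ‖b‖ * ‖a - b‖ := by
  have h1 : |‖a‖ - ‖b‖| ≤ ‖a - b‖ := abs_norm_sub_norm_le a b
  have h2 : ‖a‖ ^ 2 - ‖b‖ ^ 2 = (‖a‖ - ‖b‖) ^ 2 + 2 * ‖b‖ * (‖a‖ - ‖b‖) := by ring
  rw [h2]
  refine (abs_add_le _ _).trans (add_le_add ?_ ?_)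
  · rw [abs_pow]
    exact pow_le_pow_left₀ (abs_nonneg _) h1 2
  · rw [abs_mul, abs_of_nonneg (by positivity : 0 ≤ 2 * ‖b‖)]
    exact mul_le_mul_of_nonneg_left h1 (by positivity)

/-- If `a` is nearly concentrated at `i`, weighted sums of `‖a k‖²` are close to one term. -/
lemma abs_sum_mul_norm_sq_sub_le {ι : Type*} [DecidableEq ι] {J G : Finset ι} (hJG : J ⊆ G)
    {i : ι} (hi : i ∈ J) (a : ι → ℂ) (f : ℂ) (p : ι → ℝ) {B E : ℝ} (hB0 : 0 ≤ B)
    (hB : ∀ k ∈ J, |p k| ≤ B) (hE : ∑ k ∈ G, ‖a k - if k = i then f else 0‖ ^ 2 ≤ E) :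
    |∑ k ∈ J, p k * ‖a k‖ ^ 2 - p i * ‖f‖ ^ 2| ≤ B * (E + 2 * ‖f‖ * √E) := by
  have hE0 : 0 ≤ E := le_trans (Finset.sum_nonneg fun _ _ => by positivity) hE
  have h1 : p i * ‖f‖ ^ 2 = ∑ k ∈ J, p k * ‖if k = i then f else 0‖ ^ 2 := by
    rw [Finset.sum_eq_single i]
    · simp
    · intro k _ hk; simp [hk]
    · intro h; exact absurd hi h
  have hai : ‖a i - f‖ ≤ √E := by
    refine Real.le_sqrt_of_sq_le (le_trans ?_ hE)
    have := Finset.single_le_sum (f := fun k => ‖a k - if k = i then f else 0‖ ^ 2)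
      (fun _ _ => by positivity) (hJG hi)
    simpa using this
  rw [h1, ← Finset.sum_sub_distrib]
  calc |∑ k ∈ J, (p k * ‖a k‖ ^ 2 - p k * ‖if k = i then f else 0‖ ^ 2)|
      ≤ ∑ k ∈ J, B * (‖a k - if k = i then f else 0‖ ^ 2 +
          2 * ‖if k = i then f else 0‖ * ‖a k - if k = i then f else 0‖) := by
        refine (Finset.abs_sum_le_sum_abs _ _).trans (Finset.sum_le_sum fun k hk => ?_)
        rw [← mul_sub, abs_mul]
        exact mul_le_mul (hB k hk) (abs_norm_sq_sub_le _ _) (abs_nonneg _) hB0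
    -- The cross term is present only at k = i, so the errors at other k enter squared and their sum
    -- is controlled by E.
    _ = B * (∑ k ∈ J, ‖a k - if k = i then f else 0‖ ^ 2 + 2 * ‖f‖ * ‖a i - f‖) := by
        rw [← Finset.mul_sum, Finset.sum_add_distrib]
        congr 2
        rw [Finset.sum_eq_single i]
        · simp
        · intro k _ hk; simp [hk]
        · intro h; exact absurd hi h
    _ ≤ B * (E + 2 * ‖f‖ * √E) := by
        refine mul_le_mul_of_nonneg_left (add_le_add ?_ ?_) hB0
        · exact (Finset.sum_le_sum_of_subset_of_nonneg hJG fun _ _ _ => by positivity).trans hE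
        · exact mul_le_mul_of_nonneg_left hai (by positivity)

section SecondOrder

variable {γ : ℤ × ℤ → ℝ}

/-- For `i` running through Fourier indices with convergent frequencies, weighted sums of squared
normalized covariances converge. -/
lemma tendsto_sum_norm_dftCov_sq (hγ : Summable fun h => |γ h|) (heven : ∀ h, γ (-h) = γ h)
    {ψ : ℝ × ℝ → ℝ} {B : ℝ} (hB0 : 0 ≤ B) (hB : ∀ w ∈ freqSquare, |ψ w| ≤ B)
    {i : ℕ × ℕ → ℤ × ℤ} (hi : ∀ᶠ n in atTop, i n ∈ fourierIndex n) {w : ℝ × ℝ}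
    (hw : Tendsto (fun n => fourierFreq n (i n)) atTop (𝓝 w)) {p : ℝ}
    (hp : Tendsto (fun n => ψ (fourierFreq n (i n))) atTop (𝓝 p)) :
    Tendsto (fun n => ∑ k ∈ fourierIndex n,
      ψ (fourierFreq n k) * ‖dftCov γ n (fourierFreq n (i n)) k‖ ^ 2) atTop
      (𝓝 (p * ‖fourierSeries γ w‖ ^ 2)) := by
  set Γ := ∑' h, |γ h| with hΓ
  have hΓ0 : 0 ≤ Γ := tsum_nonneg fun _ => abs_nonneg _
  have t1 : Tendsto (fun n => ψ (fourierFreq n (i n)) *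
      ‖fourierSeries γ (fourierFreq n (i n))‖ ^ 2) atTop (𝓝 (p * ‖fourierSeries γ w‖ ^ 2)) :=
    hp.mul ((((continuous_fourierSeries hγ).tendsto w).comp hw).norm.pow 2)
  have t2 : Tendsto (fun n => B * (Γ * edgeEffect γ n + 2 * Γ * √(Γ * edgeEffect γ n))) atTop
      (𝓝 0) := by
    have t3 : Tendsto (fun n => Γ * edgeEffect γ n) atTop (𝓝 0) := by
      simpa using (tendsto_edgeEffect hγ).const_mul Γ
    have t4 : Tendsto (fun n => √(Γ * edgeEffect γ n)) atTop (𝓝 0) := by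
      simpa using t3.sqrt
    simpa using (t3.add (t4.const_mul (2 * Γ))).const_mul B
  have t5 : Tendsto (fun n => ∑ k ∈ fourierIndex n,
      ψ (fourierFreq n k) * ‖dftCov γ n (fourierFreq n (i n)) k‖ ^ 2 -
      ψ (fourierFreq n (i n)) * ‖fourierSeries γ (fourierFreq n (i n))‖ ^ 2) atTop (𝓝 0) := by
    refine squeeze_zero_norm' ?_ t2
    filter_upwards [hi] with n hin
    have hpos := size_pos_of_mem hin
    rw [Real.norm_eq_abs]
    refine (abs_sum_mul_norm_sq_sub_le (fourierIndex_subset n) hin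
      (fun k => dftCov γ n (fourierFreq n (i n)) k) (fourierSeries γ (fourierFreq n (i n)))
      (fun k => ψ (fourierFreq n k)) hB0
      (fun k hk => hB _ (fourierFreq_mem (fourierIndex_subset n hk)))
      (sum_norm_dftCov_sub_sq_le hγ heven hpos (fourierIndex_subset n hin))).trans ?_
    have := norm_fourierSeries_le hγ (fourierFreq n (i n))
    gcongr
  simpa using t5.add t1

/-- Provides the domination, uniform in the frequency, for the average over i. -/
lemma abs_sum_norm_dftCov_sq_le (hγ : Summable fun h => |γ h|) (heven : ∀ h, γ (-h) = γ h)
    {ψ : ℝ × ℝ → ℝ} {B : ℝ} (hB0 : 0 ≤ B) (hB : ∀ w ∈ freqSquare, |ψ w| ≤ B)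
    {n : ℕ × ℕ} (hn : 0 < size n) (w : ℝ × ℝ) :
    |∑ k ∈ fourierIndex n, ψ (fourierFreq n k) * ‖dftCov γ n w k‖ ^ 2| ≤
      B * (∑' h, |γ h|) ^ 2 := by
  calc _ ≤ ∑ k ∈ fourierIndex n, B * ‖dftCov γ n w k‖ ^ 2 := by
        refine (Finset.abs_sum_le_sum_abs _ _).trans (Finset.sum_le_sum fun k hk => ?_)
        rw [abs_mul, abs_of_nonneg (by positivity : 0 ≤ ‖dftCov γ n w k‖ ^ 2)]
        exact mul_le_mul_of_nonneg_right
          (hB _ (fourierFreq_mem (fourierIndex_subset n hk))) (by positivity)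
    _ ≤ _ := by
        rw [← Finset.mul_sum]
        refine mul_le_mul_of_nonneg_left ?_ hB0
        exact (Finset.sum_le_sum_of_subset_of_nonneg (fourierIndex_subset n)
          fun _ _ _ => by positivity).trans (sum_norm_dftCov_sq_le hγ heven hn w)

/-- The inner sum over k collapses onto one index: i for the covariance, and -i for the
pseudo-covariance, whence ψ(ω) + ψ(-ω). What is left is an average over the Fourier grid. -/
lemma tendsto_second_order (hγ : Summable fun h => |γ h|) (heven : ∀ h, γ (-h) = γ h)
    {ψ : ℝ × ℝ → ℝ} (hψ : BoundedVariationSquare ψ) :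
    Tendsto (fun n => (size n)⁻¹ * ∑ i ∈ fourierIndex n, ∑ k ∈ fourierIndex n,
      ψ (fourierFreq n i) * ψ (fourierFreq n k) * (‖dftCov γ n (fourierFreq n i) k‖ ^ 2 +
        ‖dftCov γ n (-fourierFreq n i) k‖ ^ 2)) atTop
      (𝓝 (((2 * Real.pi) ^ 2)⁻¹ *
        ∫ w in freqSquare, ψ w * (ψ w + ψ (-w)) * ‖fourierSeries γ w‖ ^ 2)) := by
  obtain ⟨B, hB0, hB⟩ := hψ.exists_bound
  let Q : (ℕ × ℕ) → (ℝ × ℝ) → ℝ := fun n w =>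
    ∑ k ∈ fourierIndex n, ψ (fourierFreq n k) * ‖dftCov γ n w k‖ ^ 2
  have hQ : ∀ n, ∀ i ∈ fourierIndex n, ∑ k ∈ fourierIndex n,
      ψ (fourierFreq n i) * ψ (fourierFreq n k) * (‖dftCov γ n (fourierFreq n i) k‖ ^ 2 +
        ‖dftCov γ n (-fourierFreq n i) k‖ ^ 2) =
      ψ (fourierFreq n i) * (Q n (fourierFreq n i) + Q n (-fourierFreq n i)) := by
    intro n i _
    simp only [Q]
    rw [← Finset.sum_add_distrib, Finset.mul_sum]
    refine Finset.sum_congr rfl fun k _ => ?_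
    ring
  simp_rw [fun n => Finset.sum_congr rfl (hQ n)]
  set Γ := ∑' h, |γ h|
  have := tendsto_fourier_average (β := id) (l := (atTop : Filter (ℕ × ℕ))) tendsto_id
    (fun n i => ψ (fourierFreq n i) * (Q n (fourierFreq n i) + Q n (-fourierFreq n i)))
    (fun w => ψ w * (ψ w + ψ (-w)) * ‖fourierSeries γ w‖ ^ 2)
    (B * (B * Γ ^ 2 + B * Γ ^ 2)) ?_ ?_
  · simpa using this
  · refine Eventually.of_forall fun n i hi => ?_
    have hn := size_pos_of_mem hi
    rw [norm_mul, Real.norm_eq_abs, Real.norm_eq_abs]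
    refine mul_le_mul (hB _ (fourierFreq_mem (fourierIndex_subset n hi))) ?_ (abs_nonneg _) hB0
    refine (abs_add_le _ _).trans (add_le_add ?_ ?_)
    · exact abs_sum_norm_dftCov_sq_le hγ heven hB0 hB hn _
    · exact abs_sum_norm_dftCov_sq_le hγ heven hB0 hB hn _
  · filter_upwards [hψ.ae_continuousWithinAt, ae_isRegularFreq] with w h1 h2
    have hg := eventually_gridIndex h2
    obtain ⟨p1, p2⟩ := tendsto_grid_of_continuousWithinAt h2 h1
    have hw := tendsto_fourierFreq_gridIndex w
    have hw' : Tendsto (fun n => fourierFreq n (-gridIndex n w)) atTop (𝓝 (-w)) := by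
      simp_rw [fourierFreq_neg]
      exact hw.neg
    have q1 := tendsto_sum_norm_dftCov_sq hγ heven hB0 hB (hg.mono fun n h => h.1) hw p1
    have q2 := tendsto_sum_norm_dftCov_sq hγ heven hB0 hB (hg.mono fun n h => h.2.1) hw' p2
    rw [fourierSeries_neg heven] at q2
    simp_rw [fourierFreq_neg] at q2
    have := p1.mul (q1.add q2)
    rw [← add_mul, ← mul_assoc] at this
    exact this

end SecondOrder

/-! ### Moments of the spectral mean statistic and of the periodogram -/

section Statistic

variable {Ω : Type*} [MeasurableSpace Ω] {P : Measure Ω} [IsProbabilityMeasure P]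
  {Z : ℤ × ℤ → Ω → ℝ}

/-- The squared modulus of the centered discrete Fourier transform. -/
noncomputable def dftPower (P : Measure Ω) (Z : ℤ × ℤ → Ω → ℝ) (j : ℤ × ℤ) (n : ℕ × ℕ)
    (i : ℤ × ℤ) (x : Ω) : ℝ :=
  ‖linStat (centered P Z j) n (expChar (fourierFreq n i)) x‖ ^ 2

lemma FourthOrderStationary.memLp_dftPower (h : FourthOrderStationary P Z) (j : ℤ × ℤ)
    (n : ℕ × ℕ) (i : ℤ × ℤ) : MemLp (dftPower P Z j n i) 2 P :=
  memLp_two_norm_linStat_sq (h.memLp_centered j) n _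

lemma FourthOrderStationary.integral_dftPower (h : FourthOrderStationary P Z) (j : ℤ × ℤ)
    (n : ℕ × ℕ) (i : ℤ × ℤ) :
    ((∫ x, dftPower P Z j n i x ∂P : ℝ) : ℂ) =
      covForm (autocov P Z) n (fun s => star (expChar (fourierFreq n i) s))
        (expChar (fourierFreq n i)) :=
  integral_norm_linStat_sq (h.memLp_centered j) (h.integral_centered_mul j) n _

lemma FourthOrderStationary.integral_dftPower_shift (h : FourthOrderStationary P Z) (j : ℤ × ℤ)
    (n : ℕ × ℕ) (i : ℤ × ℤ) :
    ∫ x, dftPower P Z j n i x ∂P = ∫ x, dftPower P Z 0 n i x ∂P :=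
  Complex.ofReal_injective ((h.integral_dftPower j n i).trans (h.integral_dftPower 0 n i).symm)

lemma norm_dftCov_sq (γ : ℤ × ℤ → ℝ) (n : ℕ × ℕ) (i k : ℤ × ℤ) :
    ‖dftCov γ n (fourierFreq n i) k‖ ^ 2 = (size n)⁻¹ ^ 2 *
      ‖covForm γ n (expChar (fourierFreq n i))
        fun t => star (expChar (fourierFreq n k) t)‖ ^ 2 := by
  rw [dftCov, norm_mul, mul_pow, Complex.norm_real, Real.norm_eq_abs, sq_abs]

lemma norm_dftCov_neg_sq (γ : ℤ × ℤ → ℝ) (n : ℕ × ℕ) (i k : ℤ × ℤ) :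
    ‖dftCov γ n (-fourierFreq n i) k‖ ^ 2 = (size n)⁻¹ ^ 2 *
      ‖covForm γ n (expChar (fourierFreq n i)) (expChar (fourierFreq n k))‖ ^ 2 := by
  rw [← norm_star (covForm γ n (expChar (fourierFreq n i)) _), star_covForm, dftCov, norm_mul,
    mul_pow, Complex.norm_real, Real.norm_eq_abs, sq_abs]
  congr 3
  have : expChar (-fourierFreq n i) = fun s => star (expChar (fourierFreq n i) s) :=
    funext fun s => expChar_neg_freq _ s
  rw [this]

/-- The right-hand side is free of the translation j, so the formula also yields translation
invariance of mixed second moments. -/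
lemma FourthOrderStationary.integral_dftPower_mul (h : FourthOrderStationary P Z) (j : ℤ × ℤ)
    {n : ℕ × ℕ} (hn : 0 < size n) (i k : ℤ × ℤ) :
    (((∫ x, dftPower P Z j n i x * dftPower P Z j n k x ∂P) : ℝ) : ℂ) =
      cumForm (fieldCumulant4 P Z) n (expChar (fourierFreq n i)) (expChar (fourierFreq n k)) +
      (((∫ x, dftPower P Z 0 n i x ∂P) * (∫ x, dftPower P Z 0 n k x ∂P) +
        size n ^ 2 * (‖dftCov (autocov P Z) n (fourierFreq n i) k‖ ^ 2 +
          ‖dftCov (autocov P Z) n (-fourierFreq n i) k‖ ^ 2) : ℝ) : ℂ) := by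
  have h1 := integral_norm_linStat_sq_mul (h.memLp_centered j) (h.integral_centered_mul j)
    (h.integral_centered_mul_four j) h.autocov_neg n (expChar (fourierFreq n i))
    (expChar (fourierFreq n k))
  change (((∫ x, dftPower P Z j n i x * dftPower P Z j n k x ∂P) : ℝ) : ℂ) =
    _ + ((∫ x, dftPower P Z j n i x ∂P : ℝ) : ℂ) * ((∫ x, dftPower P Z j n k x ∂P : ℝ) : ℂ) +
      _ + _ at h1
  rw [h1, h.integral_dftPower_shift j, h.integral_dftPower_shift j, norm_dftCov_sq,
    norm_dftCov_neg_sq]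
  have hne : (size n : ℂ) ≠ 0 := by exact_mod_cast hn.ne'
  push_cast
  field_simp
  ring

lemma FourthOrderStationary.integral_dftPower_mul_shift (h : FourthOrderStationary P Z)
    (j : ℤ × ℤ) {n : ℕ × ℕ} (hn : 0 < size n) (i k : ℤ × ℤ) :
    ∫ x, dftPower P Z j n i x * dftPower P Z j n k x ∂P =
      ∫ x, dftPower P Z 0 n i x * dftPower P Z 0 n k x ∂P :=
  Complex.ofReal_injective
    ((h.integral_dftPower_mul j hn i k).trans (h.integral_dftPower_mul 0 hn i k).symm)

lemma specMeanStat_eq (ψ : ℝ × ℝ → ℝ) (j : ℤ × ℤ) (n : ℕ × ℕ) (x : Ω) :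
    specMeanStat Z ψ j n x = ∑ i ∈ fourierIndex n,
      (size n)⁻¹ ^ 2 * ψ (fourierFreq n i) * dftPower P Z j n i x := by
  have hπ := Real.pi_pos
  rw [specMeanStat, Finset.mul_sum]
  refine Finset.sum_congr rfl fun i hi => ?_
  rw [periodogram_eq_linStat P Z j hi, dftPower]
  field_simp

lemma FourthOrderStationary.memLp_specMeanStat (h : FourthOrderStationary P Z)
    (ψ : ℝ × ℝ → ℝ) (j : ℤ × ℤ) (n : ℕ × ℕ) : MemLp (specMeanStat Z ψ j n) 2 P := by
  have : specMeanStat Z ψ j n = fun x => ∑ i ∈ fourierIndex n,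
      (size n)⁻¹ ^ 2 * ψ (fourierFreq n i) * dftPower P Z j n i x :=
    funext fun x => specMeanStat_eq ψ j n x
  rw [this]
  exact memLp_finsetSum _ fun i _ => (h.memLp_dftPower j n i).const_mul _

lemma FourthOrderStationary.integral_specMeanStat (h : FourthOrderStationary P Z)
    (ψ : ℝ × ℝ → ℝ) (j : ℤ × ℤ) (n : ℕ × ℕ) :
    ∫ x, specMeanStat Z ψ j n x ∂P = ∑ i ∈ fourierIndex n,
      (size n)⁻¹ ^ 2 * ψ (fourierFreq n i) * ∫ x, dftPower P Z 0 n i x ∂P := by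
  simp_rw [specMeanStat_eq (P := P)]
  rw [integral_finsetSum _ fun i _ =>
    ((h.memLp_dftPower j n i).integrable (by norm_num)).const_mul _]
  refine Finset.sum_congr rfl fun i _ => ?_
  rw [integral_const_mul, h.integral_dftPower_shift]

lemma FourthOrderStationary.integral_specMeanStat_sq (h : FourthOrderStationary P Z)
    (ψ : ℝ × ℝ → ℝ) (j : ℤ × ℤ) (n : ℕ × ℕ) :
    ∫ x, specMeanStat Z ψ j n x ^ 2 ∂P = ∑ i ∈ fourierIndex n, ∑ k ∈ fourierIndex n,
      ((size n)⁻¹ ^ 2 * ψ (fourierFreq n i)) * ((size n)⁻¹ ^ 2 * ψ (fourierFreq n k)) *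
        ∫ x, dftPower P Z 0 n i x * dftPower P Z 0 n k x ∂P := by
  have hInt : ∀ i k, Integrable (fun x => ((size n)⁻¹ ^ 2 * ψ (fourierFreq n i)) *
      ((size n)⁻¹ ^ 2 * ψ (fourierFreq n k)) *
        (dftPower P Z j n i x * dftPower P Z j n k x)) P := fun i k =>
    ((h.memLp_dftPower j n i).integrable_mul (h.memLp_dftPower j n k)).const_mul _
  have e : ∀ x, specMeanStat Z ψ j n x ^ 2 = ∑ i ∈ fourierIndex n, ∑ k ∈ fourierIndex n,
      ((size n)⁻¹ ^ 2 * ψ (fourierFreq n i)) * ((size n)⁻¹ ^ 2 * ψ (fourierFreq n k)) *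
        (dftPower P Z j n i x * dftPower P Z j n k x) := by
    intro x
    rw [specMeanStat_eq (P := P), pow_two, Finset.sum_mul_sum]
    refine Finset.sum_congr rfl fun i _ => Finset.sum_congr rfl fun k _ => ?_
    ring
  simp_rw [e]
  rw [integral_finsetSum _ fun i _ => integrable_finsetSum _ fun k _ => hInt i k]
  refine Finset.sum_congr rfl fun i hi => ?_
  rw [integral_finsetSum _ fun k _ => hInt i k]
  refine Finset.sum_congr rfl fun k _ => ?_
  rw [integral_const_mul, h.integral_dftPower_mul_shift j (size_pos_of_mem hi)]

/-- The variance of the spectral mean statistic splits into a covariance and a cumulant part. -/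
lemma FourthOrderStationary.size_mul_variance_eq (h : FourthOrderStationary P Z)
    (ψ : ℝ × ℝ → ℝ) {n : ℕ × ℕ} (hn : 0 < size n) :
    ((size n * (∫ x, specMeanStat Z ψ 0 n x ^ 2 ∂P -
      (∫ x, specMeanStat Z ψ 0 n x ∂P) ^ 2) : ℝ) : ℂ) =
      (((size n)⁻¹ ^ 3 : ℝ) : ℂ) * ∑ i ∈ fourierIndex n, ∑ k ∈ fourierIndex n,
        ((ψ (fourierFreq n i) * ψ (fourierFreq n k) : ℝ) : ℂ) *
          cumForm (fieldCumulant4 P Z) n (expChar (fourierFreq n i))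
            (expChar (fourierFreq n k)) +
      (((size n)⁻¹ * ∑ i ∈ fourierIndex n, ∑ k ∈ fourierIndex n,
        ψ (fourierFreq n i) * ψ (fourierFreq n k) *
          (‖dftCov (autocov P Z) n (fourierFreq n i) k‖ ^ 2 +
            ‖dftCov (autocov P Z) n (-fourierFreq n i) k‖ ^ 2) : ℝ) : ℂ) := by
  have hne : (size n : ℂ) ≠ 0 := by exact_mod_cast hn.ne'
  rw [h.integral_specMeanStat_sq, h.integral_specMeanStat, pow_two (∑ i ∈ fourierIndex n, _),
    Finset.sum_mul_sum, ← Finset.sum_sub_distrib]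
  simp_rw [← Finset.sum_sub_distrib]
  push_cast
  -- The products of means cancel against the squared mean of the statistic. The weights are n · n⁻⁴
  -- for cumulants and n · n⁻⁴ · n² for normalized covariances.
  simp_rw [h.integral_dftPower_mul 0 hn]
  rw [Finset.mul_sum, Finset.mul_sum, Finset.mul_sum, ← Finset.sum_add_distrib]
  refine Finset.sum_congr rfl fun i _ => ?_
  rw [Finset.mul_sum, Finset.mul_sum, Finset.mul_sum, ← Finset.sum_add_distrib]
  refine Finset.sum_congr rfl fun k _ => ?_
  push_cast
  field_simp
  ring

lemma specDensity_eq (w : ℝ × ℝ) :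
    specDensity P Z w = ((2 * Real.pi) ^ 2)⁻¹ * (fourierSeries (autocov P Z) w).re := rfl

lemma FourthOrderStationary.norm_fourierSeries_sq (h : FourthOrderStationary P Z) (w : ℝ × ℝ) :
    ‖fourierSeries (autocov P Z) w‖ ^ 2 = (2 * Real.pi) ^ 4 * specDensity P Z w ^ 2 := by
  have hπ := Real.pi_pos
  have h1 := star_fourierSeries h.autocov_neg w
  rw [Complex.star_def, Complex.conj_eq_iff_re] at h1
  rw [← h1, Complex.norm_real, Real.norm_eq_abs, sq_abs, specDensity_eq]
  field_simp

/-- The normalized variance of the spectral mean statistic converges to `σ²`. -/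
theorem FourthOrderStationary.tendsto_variance (h : FourthOrderStationary P Z)
    {ψ : ℝ × ℝ → ℝ} (hψ : BoundedVariationSquare ψ)
    (hγ : Summable fun a => |autocov P Z a|) (hκ : Summable fun a => |fieldCumulant4 P Z a|) :
    Tendsto (fun n => size n * (∫ x, specMeanStat Z ψ 0 n x ^ 2 ∂P -
      (∫ x, specMeanStat Z ψ 0 n x ∂P) ^ 2)) atTop (𝓝 (sigmaSq P Z ψ)) := by
  have hπ := Real.pi_pos
  have t1 := (Complex.continuous_re.tendsto _).comp (tendsto_sum_cumForm hκ hψ)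
  have t2 := tendsto_second_order hγ h.autocov_neg hψ
  rw [← sigmaSq2_eq_tsum P Z hψ hκ] at t1
  have e : ((2 * Real.pi) ^ 2)⁻¹ * ∫ w in freqSquare, ψ w * (ψ w + ψ (-w)) *
      ‖fourierSeries (autocov P Z) w‖ ^ 2 = sigmaSq1 P Z ψ := by
    simp_rw [h.norm_fourierSeries_sq]
    rw [sigmaSq1, ← integral_const_mul, ← integral_const_mul]
    refine integral_congr_ae (Eventually.of_forall fun w => ?_)
    simp only
    field_simp
  rw [e] at t2
  have t3 := t1.add t2
  rw [add_comm, ← sigmaSq] at t3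
  refine t3.congr' ?_
  filter_upwards [eventually_pos] with n hn
  have := congrArg Complex.re (h.size_mul_variance_eq ψ (size_pos hn.1 hn.2))
  rw [Complex.ofReal_re, Complex.add_re, Complex.ofReal_re] at this
  exact this.symm

/-- Second moments of the periodogram. -/
lemma FourthOrderStationary.integral_periodogram_sq (h : FourthOrderStationary P Z) (j : ℤ × ℤ)
    {n : ℕ × ℕ} {i : ℤ × ℤ} (hi : i ∈ fourierIndex n) :
    ((∫ x, periodogram Z j n (fourierFreq n i) x ^ 2 ∂P : ℝ) : ℂ) =
      ((((2 * Real.pi) ^ 4)⁻¹ * (size n)⁻¹ ^ 2 : ℝ) : ℂ) *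
        cumForm (fieldCumulant4 P Z) n (expChar (fourierFreq n i)) (expChar (fourierFreq n i)) +
      ((((2 * Real.pi) ^ 4)⁻¹ * (2 * ‖dftCov (autocov P Z) n (fourierFreq n i) i‖ ^ 2 +
        ‖dftCov (autocov P Z) n (fourierFreq n (-i)) i‖ ^ 2) : ℝ) : ℂ) := by
  have hn := size_pos_of_mem hi
  have hπ := Real.pi_pos
  have hne : (size n : ℂ) ≠ 0 := by exact_mod_cast hn.ne'
  have hπc : (Real.pi : ℂ) ≠ 0 := by exact_mod_cast hπ.ne'
  have e1 : ∀ x, periodogram Z j n (fourierFreq n i) x ^ 2 =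
      (((2 * Real.pi) ^ 4)⁻¹ * (size n)⁻¹ ^ 2) *
        (dftPower P Z j n i x * dftPower P Z j n i x) := by
    intro x
    rw [periodogram_eq_linStat P Z j hi, ← dftPower]
    field_simp
  -- For i = k the product of means equals the squared diagonal covariance term, which accounts for
  -- the coefficient 2.
  have e2 : (∫ x, dftPower P Z 0 n i x ∂P) * (∫ x, dftPower P Z 0 n i x ∂P) =
      size n ^ 2 * ‖dftCov (autocov P Z) n (fourierFreq n i) i‖ ^ 2 := by
    have h1 := h.integral_dftPower 0 n i
    have h2 := congrArg norm h1
    rw [← norm_star (covForm _ _ _ _), star_covForm, Complex.norm_real] at h2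
    simp only [star_star] at h2
    rw [norm_dftCov_sq, ← h2, Real.norm_eq_abs, sq_abs]
    field_simp
  simp_rw [e1]
  rw [integral_const_mul, Complex.ofReal_mul, h.integral_dftPower_mul j hn, e2, fourierFreq_neg]
  push_cast
  field_simp
  ring

lemma FourthOrderStationary.integral_periodogram_sq_shift (h : FourthOrderStationary P Z)
    (j : ℤ × ℤ) {n : ℕ × ℕ} {i : ℤ × ℤ} (hi : i ∈ fourierIndex n) :
    ∫ x, periodogram Z j n (fourierFreq n i) x ^ 2 ∂P =
      ∫ x, periodogram Z 0 n (fourierFreq n i) x ^ 2 ∂P :=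
  Complex.ofReal_injective
    ((h.integral_periodogram_sq j hi).trans (h.integral_periodogram_sq 0 hi).symm)

lemma FourthOrderStationary.memLp_periodogram (h : FourthOrderStationary P Z) (j : ℤ × ℤ)
    (n : ℕ × ℕ) (w : ℝ × ℝ) : MemLp (periodogram Z j n w) 2 P := by
  have : periodogram Z j n w = fun x => ((2 * Real.pi) ^ 2)⁻¹ * (size n)⁻¹ *
      ‖linStat (fun s => Z (s + j)) n (fun s => expChar w (s + j)) x‖ ^ 2 := by
    funext x
    rw [periodogram, sum_region_shift]
    rfl
  rw [this]
  exact (memLp_two_norm_linStat_sq (fun s => h.1 (s + j)) n _).const_mul _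

/-- Valid at every nonzero Fourier frequency, including those on the axes and edges where no limit
law is assumed; this is the domination used for σ̂₁². -/
lemma FourthOrderStationary.exists_bound_periodogram_sq (h : FourthOrderStationary P Z)
    (hγ : Summable fun a => |autocov P Z a|) (hκ : Summable fun a => |fieldCumulant4 P Z a|) :
    ∃ C : ℝ, ∀ n, ∀ i ∈ fourierIndex n,
      ∫ x, periodogram Z 0 n (fourierFreq n i) x ^ 2 ∂P ≤ C := by
  set Γ := ∑' a, |autocov P Z a|
  set K := ∑' a, |fieldCumulant4 P Z a|
  have hK : 0 ≤ K := tsum_nonneg fun _ => abs_nonneg _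
  refine ⟨((2 * Real.pi) ^ 4)⁻¹ * K + ((2 * Real.pi) ^ 4)⁻¹ * (2 * Γ ^ 2 + Γ ^ 2),
    fun n i hi => ?_⟩
  have hn := size_pos_of_mem hi
  have hn1 : 1 ≤ size n := by
    have hp := pos_of_mem_fullIndex (fourierIndex_subset n hi)
    have h1 : (1 : ℝ) ≤ n.1 := by exact_mod_cast hp.1
    have h2 : (1 : ℝ) ≤ n.2 := by exact_mod_cast hp.2
    unfold size
    nlinarith
  have h1 := congrArg (fun z : ℂ => ‖z‖) (h.integral_periodogram_sq 0 hi)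
  simp only [Complex.norm_real] at h1
  refine (le_abs_self _).trans (h1.le.trans ((norm_add_le _ _).trans (add_le_add ?_ ?_)))
  · rw [norm_mul, Complex.norm_real, Real.norm_of_nonneg (by positivity)]
    calc _ ≤ ((2 * Real.pi) ^ 4)⁻¹ * (size n)⁻¹ ^ 2 * (size n * K) :=
          mul_le_mul_of_nonneg_left (norm_cumForm_expChar_le hκ n _ _) (by positivity)
      _ = ((2 * Real.pi) ^ 4)⁻¹ * K * (size n)⁻¹ := by field_simp
      _ ≤ ((2 * Real.pi) ^ 4)⁻¹ * K :=
          mul_le_of_le_one_right (by positivity) (inv_le_one_of_one_le₀ hn1)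
  · rw [Complex.norm_real, Real.norm_of_nonneg (by positivity)]
    have b1 := norm_dftCov_le hγ h.autocov_neg hn (fourierFreq n i) (fourierIndex_subset n hi)
    have b2 := norm_dftCov_le hγ h.autocov_neg hn (fourierFreq n (-i)) (fourierIndex_subset n hi)
    gcongr

/-- At a regular frequency the second moment of the periodogram converges to `2 f²`. -/
lemma FourthOrderStationary.tendsto_integral_periodogram_sq (h : FourthOrderStationary P Z)
    (hγ : Summable fun a => |autocov P Z a|) (hκ : Summable fun a => |fieldCumulant4 P Z a|)
    {w : ℝ × ℝ} (hw : IsRegularFreq w) :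
    Tendsto (fun n => ∫ x, periodogram Z 0 n (fourierFreq n (gridIndex n w)) x ^ 2 ∂P) atTop
      (𝓝 (2 * specDensity P Z w ^ 2)) := by
  have hπ := Real.pi_pos
  set γ := autocov P Z
  set Γ := ∑' a, |γ a|
  set K := ∑' a, |fieldCumulant4 P Z a|
  have hev := eventually_gridIndex hw
  have tE : Tendsto (fun n => Γ * edgeEffect γ n) atTop (𝓝 0) := by
    simpa using (tendsto_edgeEffect hγ).const_mul Γ
  have tS : Tendsto (fun n => √(Γ * edgeEffect γ n)) atTop (𝓝 0) := by
    simpa using tE.sqrt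
  have tN : Tendsto (fun n : ℕ × ℕ => (size n)⁻¹) atTop (𝓝 0) := by
    refine tendsto_inv_atTop_zero.comp ?_
    exact (tendsto_natCast_atTop_atTop.comp tendsto_fst_atTop_prod).atTop_mul_atTop₀
      (tendsto_natCast_atTop_atTop.comp tendsto_snd_atTop_prod)
  have tφ : Tendsto (fun n => fourierSeries γ (fourierFreq n (gridIndex n w))) atTop
      (𝓝 (fourierSeries γ w)) :=
    ((continuous_fourierSeries hγ).tendsto w).comp (tendsto_fourierFreq_gridIndex w)
  have t1 : Tendsto (fun n => dftCov γ n (fourierFreq n (gridIndex n w)) (gridIndex n w)) atTop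
      (𝓝 (fourierSeries γ w)) := by
    have : Tendsto (fun n => dftCov γ n (fourierFreq n (gridIndex n w)) (gridIndex n w) -
        fourierSeries γ (fourierFreq n (gridIndex n w))) atTop (𝓝 0) := by
      refine squeeze_zero_norm' ?_ tS
      filter_upwards [hev] with n hn
      have hi := fourierIndex_subset n hn.1
      have hb := sum_norm_dftCov_sub_sq_le hγ h.autocov_neg (size_pos_of_mem hn.1) hi
      have hs := Finset.single_le_sum (f := fun k => ‖dftCov γ n
        (fourierFreq n (gridIndex n w)) k - if k = gridIndex n w then
          fourierSeries γ (fourierFreq n (gridIndex n w)) else 0‖ ^ 2)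
        (fun _ _ => by positivity) hi
      simp only [if_true] at hs
      exact Real.le_sqrt_of_sq_le (hs.trans hb)
    simpa using this.add tφ
  -- Since i ≠ -i at a regular frequency, this is an off-diagonal entry of the row at -i, hence
  -- bounded by the edge effect.
  have t2 : Tendsto (fun n => ‖dftCov γ n (fourierFreq n (-gridIndex n w)) (gridIndex n w)‖ ^ 2)
      atTop (𝓝 0) := by
    refine squeeze_zero' (Eventually.of_forall fun _ => by positivity) ?_ tE
    filter_upwards [hev] with n hn
    have hb := sum_norm_dftCov_sub_sq_le hγ h.autocov_neg (size_pos_of_mem hn.1)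
      (fourierIndex_subset n hn.2.1)
    have hs := Finset.single_le_sum (f := fun k => ‖dftCov γ n
      (fourierFreq n (-gridIndex n w)) k - if k = -gridIndex n w then
        fourierSeries γ (fourierFreq n (-gridIndex n w)) else 0‖ ^ 2)
      (fun _ _ => by positivity) (fourierIndex_subset n hn.1)
    simp only [if_neg hn.2.2.symm, sub_zero] at hs
    exact hs.trans hb
  have t3 : Tendsto (fun n => (((((2 * Real.pi) ^ 4)⁻¹ * (size n)⁻¹ ^ 2 : ℝ) : ℂ) *
      cumForm (fieldCumulant4 P Z) n (expChar (fourierFreq n (gridIndex n w)))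
        (expChar (fourierFreq n (gridIndex n w)))).re) atTop (𝓝 0) := by
    have t4 : Tendsto (fun n : ℕ × ℕ => ((2 * Real.pi) ^ 4)⁻¹ * K * (size n)⁻¹) atTop (𝓝 0) := by
      simpa using tN.const_mul (((2 * Real.pi) ^ 4)⁻¹ * K)
    refine squeeze_zero_norm' ?_ t4
    filter_upwards [eventually_pos] with n hn
    have hs := size_pos hn.1 hn.2
    refine (Complex.abs_re_le_norm _).trans ?_
    rw [norm_mul, Complex.norm_real, Real.norm_of_nonneg (by positivity)]
    calc _ ≤ ((2 * Real.pi) ^ 4)⁻¹ * (size n)⁻¹ ^ 2 * (size n * K) :=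
          mul_le_mul_of_nonneg_left (norm_cumForm_expChar_le hκ n _ _) (by positivity)
      _ = ((2 * Real.pi) ^ 4)⁻¹ * K * (size n)⁻¹ := by field_simp
  have t5 := t3.add ((((t1.norm.pow 2).const_mul 2).add t2).const_mul (((2 * Real.pi) ^ 4)⁻¹))
  have e : (0 : ℝ) + ((2 * Real.pi) ^ 4)⁻¹ * (2 * ‖fourierSeries γ w‖ ^ 2 + 0) =
      2 * specDensity P Z w ^ 2 := by
    rw [h.norm_fourierSeries_sq]
    field_simp
    ring
  rw [e] at t5
  refine t5.congr' ?_
  filter_upwards [hev] with n hn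
  have := congrArg Complex.re (h.integral_periodogram_sq 0 hn.1)
  rw [Complex.ofReal_re, Complex.add_re, Complex.ofReal_re] at this
  exact this.symm

end Statistic

/-! ### Convergence in distribution and moments -/

section Distribution

variable {Ω Ω' : Type*} [MeasurableSpace Ω] {P : Measure Ω} [IsProbabilityMeasure P]
  [MeasurableSpace Ω'] {μ : Measure Ω'} [IsProbabilityMeasure μ]

/-- Expectations of bounded continuous functions converge under convergence in distribution. -/
lemma tendsto_integral_of_tendstoInDistribution {ι E : Type*} [TopologicalSpace E]
    [MeasurableSpace E] [BorelSpace E] {X : ι → Ω → E} {l : Filter ι} {Y : Ω' → E}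
    (h : TendstoInDistribution X l Y (fun _ => P) μ) {g : E → ℝ} (hg : Continuous g) {C : ℝ}
    (hC : ∀ y, |g y| ≤ C) :
    Tendsto (fun n => ∫ x, g (X n x) ∂P) l (𝓝 (∫ y, g (Y y) ∂μ)) := by
  have h1 := ProbabilityMeasure.tendsto_iff_forall_integral_tendsto.mp h.tendsto
    (BoundedContinuousFunction.ofNormedAddCommGroup g hg C hC)
  simp only [ProbabilityMeasure.coe_mk, BoundedContinuousFunction.coe_ofNormedAddCommGroup] at h1
  rw [integral_map h.aemeasurable_limit hg.measurable.aestronglyMeasurable] at h1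
  refine h1.congr fun n => ?_
  rw [integral_map (h.forall_aemeasurable n) hg.measurable.aestronglyMeasurable]

lemma integral_sub_const_sq {X : Ω → ℝ} (hX : MemLp X 2 P) (c : ℝ) :
    ∫ x, (X x - c) ^ 2 ∂P = ∫ x, X x ^ 2 ∂P - 2 * c * ∫ x, X x ∂P + c ^ 2 := by
  have i1 : Integrable (fun x => 2 * c * X x) P := (hX.integrable (by norm_num)).const_mul _
  have i2 : Integrable (fun x => X x ^ 2 - 2 * c * X x) P := hX.integrable_sq.sub i1
  have : ∀ x, (X x - c) ^ 2 = X x ^ 2 - 2 * c * X x + c ^ 2 := fun x => by ring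
  simp_rw [this]
  rw [integral_add i2 (integrable_const _), integral_sub hX.integrable_sq i1, integral_const_mul]
  simp

/-- Truncation of a real number to `[-K, K]`. -/
noncomputable def clamp (K x : ℝ) : ℝ := max (-K) (min x K)

lemma continuous_clamp (K : ℝ) : Continuous (clamp K) := by
  unfold clamp; fun_prop

lemma abs_clamp_le {K : ℝ} (hK : 0 ≤ K) (x : ℝ) : |clamp K x| ≤ K :=
  abs_le.mpr ⟨le_max_left _ _, max_le (by linarith) (min_le_right _ _)⟩

/-- The error vanishes on [-K, K], and outside it is at most |x| ≤ x²/K. Bounded second moments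
therefore give uniformly small truncation errors for means. -/
lemma abs_sub_clamp_le {K : ℝ} (hK : 0 < K) (x : ℝ) : |x - clamp K x| ≤ x ^ 2 / K := by
  rw [le_div_iff₀ hK]
  unfold clamp
  rcases le_total x K with h1 | h1
  · rw [min_eq_left h1]
    rcases le_total (-K) x with h2 | h2
    · rw [max_eq_right h2, sub_self, abs_zero, zero_mul]; positivity
    · rw [max_eq_left h2, abs_of_nonpos (by linarith)]; nlinarith
  · rw [min_eq_right h1, max_eq_right (by linarith), abs_of_nonneg (by linarith)]; nlinarith

lemma integrable_clamp {X : Ω → ℝ} (hX : AEStronglyMeasurable X P) {K : ℝ} (hK : 0 ≤ K) :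
    Integrable (fun x => clamp K (X x)) P :=
  Integrable.of_bound ((continuous_clamp K).comp_aestronglyMeasurable hX) K
    (Eventually.of_forall fun x => abs_clamp_le hK (X x))

lemma abs_integral_sub_clamp_le {X : Ω → ℝ} (hX : MemLp X 2 P) {K : ℝ} (hK : 0 < K) :
    |∫ x, X x ∂P - ∫ x, clamp K (X x) ∂P| ≤ (∫ x, X x ^ 2 ∂P) / K := by
  have h1 : Integrable X P := hX.integrable (by norm_num)
  have h2 := integrable_clamp hX.1 hK.le
  rw [← integral_sub h1 h2, ← integral_div]
  refine (abs_integral_le_integral_abs).trans ?_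
  exact integral_mono (h1.sub h2).abs (hX.integrable_sq.div_const K)
    fun x => abs_sub_clamp_le hK (X x)

/-- Convergence in distribution together with bounded variances implies convergence of the
means. -/
theorem tendsto_mean_of_tendstoInDistribution {ι : Type*} {l : Filter ι} {X : ι → Ω → ℝ}
    {Y : Ω' → ℝ} (h : TendstoInDistribution X l Y (fun _ => P) μ) (hX : ∀ n, MemLp (X n) 2 P)
    (hY : MemLp Y 2 μ) {V : ℝ}
    (hV : ∀ᶠ n in l, ∫ x, X n x ^ 2 ∂P - (∫ x, X n x ∂P) ^ 2 ≤ V) :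
    Tendsto (fun n => ∫ x, X n x ∂P) l (𝓝 (∫ y, Y y ∂μ)) := by
  have hX1 : ∀ n, Integrable (X n) P := fun n => (hX n).integrable (by norm_num)
  have hY1 : Integrable Y μ := hY.integrable (by norm_num)
  set a := ∫ y, |Y y| ∂μ with ha
  -- C collects the bound a on the truncated limit mean, a slack of 1 for the approach to it, and
  -- the bound on the expectation of 1 + (X - m)². The level K exceeds C, so `min |m| K ≤ C` forces
  -- |m| ≤ C.
  set C := a + 1 + (1 + V) with hC
  set K := |C| + 1 with hK
  have hK0 : 0 ≤ K := by positivity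
  have hmin : ∀ t : ℝ, |min |t| K| ≤ K := fun t => by
    rw [abs_of_nonneg (le_min (abs_nonneg t) hK0)]
    exact min_le_right _ _
  have tmin := tendsto_integral_of_tendstoInDistribution h (g := fun t => min |t| K)
    (by fun_prop) hmin
  have hle : ∫ y, min |Y y| K ∂μ ≤ a :=
    integral_mono (Integrable.of_bound
      ((by fun_prop : Continuous fun t : ℝ => min |t| K).comp_aestronglyMeasurable hY.1) K
      (Eventually.of_forall fun y => hmin (Y y))) hY1.abs fun y => min_le_left _ _
  have hbound : ∀ᶠ n in l, |∫ x, X n x ∂P| ≤ C := by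
    filter_upwards [tmin.eventually_lt_const (lt_add_of_le_of_pos hle one_pos), hV] with n h1 h2
    set m := ∫ x, X n x ∂P with hm
    -- A variable with bounded variance stays near its mean, so a large mean would carry the mass
    -- away and contradict the limit law.
    have hpt : ∀ x, min |m| K ≤ min |X n x| K + (1 + (X n x - m) ^ 2) := by
      intro x
      have e1 : |m| ≤ |X n x| + |X n x - m| := by
        have := abs_sub_abs_le_abs_sub m (X n x)
        rw [abs_sub_comm] at this
        linarith
      have e2 : |X n x - m| ≤ 1 + (X n x - m) ^ 2 := by
        rw [← sq_abs]
        nlinarith [sq_nonneg (|X n x - m| - 1), abs_nonneg (X n x - m)]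
      rcases le_total |X n x| K with h3 | h3
      · rw [min_eq_left h3]
        exact (min_le_left _ _).trans (by linarith)
      · rw [min_eq_right h3]
        exact (min_le_right _ _).trans (by nlinarith [sq_nonneg (X n x - m)])
    have i1 : Integrable (fun x => min |X n x| K) P :=
      Integrable.of_bound
        ((by fun_prop : Continuous fun t : ℝ => min |t| K).comp_aestronglyMeasurable (hX n).1) K
        (Eventually.of_forall fun y => hmin (X n y))
    have i2 : Integrable (fun x => (X n x - m) ^ 2) P :=
      ((hX n).sub (memLp_const m)).integrable_sq
    have e3 : ∫ x, (X n x - m) ^ 2 ∂P = ∫ x, X n x ^ 2 ∂P - m ^ 2 := by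
      rw [integral_sub_const_sq (hX n), ← hm]
      ring
    have i5 : Integrable (fun x => 1 + (X n x - m) ^ 2) P := (integrable_const 1).add i2
    have i3 := integral_mono (integrable_const (min |m| K))
      (i1.add i5) hpt
    have e4 : ∫ x, (min |X n x| K + (1 + (X n x - m) ^ 2)) ∂P =
        ∫ x, min |X n x| K ∂P + (1 + (∫ x, X n x ^ 2 ∂P - m ^ 2)) := by
      rw [integral_add i1 i5, integral_add (integrable_const 1) i2, e3]
      simp
    have e5 : ∫ _, min |m| K ∂P = min |m| K := by simp
    have i4 : min |m| K ≤ C := by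
      rw [← e5]
      refine i3.trans ?_
      change ∫ x, (min |X n x| K + (1 + (X n x - m) ^ 2)) ∂P ≤ C
      rw [e4]
      linarith
    rcases min_le_iff.mp i4 with h5 | h5
    · exact h5
    · exact absurd h5 (by linarith [le_abs_self C])
  -- Bounded means and variances bound the second moments; truncation at a level L with D / L ≤ ε /
  -- 2 then reduces the claim to a bounded continuous function.
  set D := |V + C ^ 2| + ∫ y, Y y ^ 2 ∂μ with hD
  have hY2 : 0 ≤ ∫ y, Y y ^ 2 ∂μ := integral_nonneg fun y => sq_nonneg _
  have hD0 : 0 ≤ D := by positivity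
  rw [Metric.tendsto_nhds]
  intro ε hε
  obtain ⟨L, hL0, hL⟩ : ∃ L : ℝ, 0 < L ∧ D / L ≤ ε / 2 := by
    refine ⟨(2 * D + 1) / ε, by positivity, ?_⟩
    rw [div_div_eq_mul_div, div_le_iff₀ (by positivity)]
    nlinarith
  have tcl := tendsto_integral_of_tendstoInDistribution h (continuous_clamp L)
    (abs_clamp_le hL0.le)
  filter_upwards [hbound, hV, Metric.tendsto_nhds.mp tcl (ε / 2) (by positivity)]
    with n h1 h2 h3
  have b1 := abs_integral_sub_clamp_le (hX n) hL0
  have b2 := abs_integral_sub_clamp_le hY hL0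
  have b3 : ∫ x, X n x ^ 2 ∂P ≤ |V + C ^ 2| := by
    have : (∫ x, X n x ∂P) ^ 2 ≤ C ^ 2 := by
      rw [← sq_abs]
      exact pow_le_pow_left₀ (abs_nonneg _) h1 2
    exact le_trans (by linarith) (le_abs_self _)
  have b4 : (∫ x, X n x ^ 2 ∂P) / L + (∫ y, Y y ^ 2 ∂μ) / L ≤ ε / 2 := by
    rw [← add_div]
    refine le_trans (div_le_div_of_nonneg_right ?_ hL0.le) hL
    rw [hD]
    linarith
  rw [Real.dist_eq] at h3 ⊢
  have e : ∫ x, X n x ∂P - ∫ y, Y y ∂μ = (∫ x, X n x ∂P - ∫ x, clamp L (X n x) ∂P) +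
      (∫ x, clamp L (X n x) ∂P - ∫ y, clamp L (Y y) ∂μ) -
      (∫ y, Y y ∂μ - ∫ y, clamp L (Y y) ∂μ) := by ring
  rw [e]
  refine (abs_sub _ _).trans_lt ?_
  refine (add_le_add_left (abs_add_le _ _) _).trans_lt ?_
  linarith

end Distribution

/-! ### Second moments of the normalized spectral mean statistic -/

section HStat

variable {Ω : Type*} [MeasurableSpace Ω] {P : Measure Ω} [IsProbabilityMeasure P]
  {Z : ℤ × ℤ → Ω → ℝ}

lemma FourthOrderStationary.memLp_hStat (h : FourthOrderStationary P Z) (ψ : ℝ × ℝ → ℝ)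
    (j : ℤ × ℤ) (n : ℕ × ℕ) : MemLp (hStat P Z ψ j n) 2 P :=
  ((h.memLp_specMeanStat ψ j n).sub (memLp_const _)).const_mul _

lemma FourthOrderStationary.integral_hStat (h : FourthOrderStationary P Z) (ψ : ℝ × ℝ → ℝ)
    (j : ℤ × ℤ) (n : ℕ × ℕ) :
    ∫ x, hStat P Z ψ j n x ∂P =
      √(size n) * (∫ x, specMeanStat Z ψ j n x ∂P - specMean P Z ψ) := by
  simp only [hStat]
  rw [integral_const_mul, integral_sub ((h.memLp_specMeanStat ψ j n).integrable (by norm_num))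
    (integrable_const _)]
  simp

lemma FourthOrderStationary.integral_hStat_sq (h : FourthOrderStationary P Z) (ψ : ℝ × ℝ → ℝ)
    (j : ℤ × ℤ) (n : ℕ × ℕ) :
    ∫ x, hStat P Z ψ j n x ^ 2 ∂P = size n * (∫ x, specMeanStat Z ψ j n x ^ 2 ∂P -
      2 * specMean P Z ψ * ∫ x, specMeanStat Z ψ j n x ∂P + specMean P Z ψ ^ 2) := by
  rw [← integral_sub_const_sq (h.memLp_specMeanStat ψ j n), ← integral_const_mul]
  refine integral_congr_ae (Eventually.of_forall fun x => ?_)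
  simp only [hStat]
  rw [mul_pow, Real.sq_sqrt (size_nonneg n)]

lemma FourthOrderStationary.integral_hStat_sq_shift (h : FourthOrderStationary P Z)
    (ψ : ℝ × ℝ → ℝ) (j : ℤ × ℤ) (n : ℕ × ℕ) :
    ∫ x, hStat P Z ψ j n x ^ 2 ∂P = ∫ x, hStat P Z ψ 0 n x ^ 2 ∂P := by
  rw [h.integral_hStat_sq, h.integral_hStat_sq, h.integral_specMeanStat_sq,
    h.integral_specMeanStat_sq, h.integral_specMeanStat, h.integral_specMeanStat]

/-- A limit of variances is nonnegative. Without this the conversion `toNNReal` in the limit laws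
could lose the value of σ². -/
lemma FourthOrderStationary.sigmaSq_nonneg (h : FourthOrderStationary P Z) {ψ : ℝ × ℝ → ℝ}
    (hψ : BoundedVariationSquare ψ) (hγ : Summable fun a => |autocov P Z a|)
    (hκ : Summable fun a => |fieldCumulant4 P Z a|) : 0 ≤ sigmaSq P Z ψ := by
  refine ge_of_tendsto (h.tendsto_variance hψ hγ hκ) (Eventually.of_forall fun n => ?_)
  refine mul_nonneg (size_nonneg n) ?_
  have := variance_nonneg (specMeanStat Z ψ 0 n) P
  rw [variance_eq_sub (h.memLp_specMeanStat ψ 0 n)] at this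
  simpa using this

/-- The second moment of `H_n` converges to `σ²`. -/
theorem FourthOrderStationary.tendsto_integral_hStat_sq (h : FourthOrderStationary P Z)
    {ψ : ℝ × ℝ → ℝ} (hψ : BoundedVariationSquare ψ) (hγ : Summable fun a => |autocov P Z a|)
    (hκ : Summable fun a => |fieldCumulant4 P Z a|) (hlaw : LimitLaw P Z ψ) :
    Tendsto (fun n => ∫ x, hStat P Z ψ 0 n x ^ 2 ∂P) atTop (𝓝 (sigmaSq P Z ψ)) := by
  have hvar : ∀ n, ∫ x, hStat P Z ψ 0 n x ^ 2 ∂P - (∫ x, hStat P Z ψ 0 n x ∂P) ^ 2 =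
      size n * (∫ x, specMeanStat Z ψ 0 n x ^ 2 ∂P -
        (∫ x, specMeanStat Z ψ 0 n x ∂P) ^ 2) := by
    intro n
    rw [h.integral_hStat_sq, h.integral_hStat, mul_pow, Real.sq_sqrt (size_nonneg n)]
    ring
  have tV := h.tendsto_variance hψ hγ hκ
  simp_rw [← hvar] at tV
  -- The scaled bias tends to zero as a consequence of the limit law and the bounded variance; no
  -- rate for the bias is computed.
  have hmean := tendsto_mean_of_tendstoInDistribution hlaw (fun n => h.memLp_hStat ψ 0 n)
    (memLp_id_gaussianReal 2) (tV.eventually_le_const (lt_add_one _))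
  simp only [id, integral_id_gaussianReal] at hmean
  simpa using tV.add (hmean.pow 2)

end HStat

/-! ### Uniformity over well-separated pairs -/

/-- Convergence along every section of a filter over `ℕ × ℕ` implies convergence along the
filter. -/
theorem tendsto_of_sections {A : Type*} {l : Filter ((ℕ × ℕ) × A)} [l.IsCountablyGenerated]
    (hl : Tendsto Prod.fst l atTop) (d : ℕ × ℕ → A)
    (hd : Tendsto (fun β => (β, d β)) atTop l) {Φ : ℕ × ℕ → A → ℝ} {c : ℝ}
    (h : ∀ p : ℕ × ℕ → A, Tendsto (fun β => (β, p β)) atTop l →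
      Tendsto (fun β => Φ β (p β)) atTop (𝓝 c)) :
    Tendsto (fun q : (ℕ × ℕ) × A => Φ q.1 q.2) l (𝓝 c) := by
  refine tendsto_of_subseq_tendsto fun ns hns => ?_
  have h1 : Tendsto (fun r => (ns r).1.1) atTop atTop :=
    tendsto_fst_atTop_prod.comp (hl.comp hns)
  -- Along this subsequence the first block size is strictly increasing, so each size occurs at most
  -- once and the remaining data become a function of the size.
  obtain ⟨φ, hφ, hmono⟩ := strictMono_subseq_of_tendsto_atTop h1
  refine ⟨φ, ?_⟩
  let β : ℕ → ℕ × ℕ := fun r => (ns (φ r)).1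
  have hβmono : StrictMono fun r => (β r).1 := hmono
  have hβinj : Function.Injective β := fun r r' hr => hβmono.injective (congrArg Prod.fst hr)
  -- The section follows the subsequence at its sizes and the default d elsewhere. It converges
  -- along `l` because a large first size on the subsequence forces a large subsequence index.
  let p : ℕ × ℕ → A := Function.extend β (fun r => (ns (φ r)).2) d
  have hns' : Tendsto (fun r => ns (φ r)) atTop l := hns.comp hφ.tendsto_atTop
  have hp : Tendsto (fun β => (β, p β)) atTop l := by
    intro S hS
    obtain ⟨R, hR⟩ := eventually_atTop.mp (hns'.eventually_mem hS)
    have hdS := hd.eventually_mem hS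
    have hbig := tendsto_fst_atTop_prod.eventually_ge_atTop (β R).1
    rw [mem_map]
    filter_upwards [hdS, hbig] with b hb1 hb2
    change (b, p b) ∈ S
    by_cases hb : ∃ r, β r = b
    · obtain ⟨r, rfl⟩ := hb
      have hpr : p (β r) = (ns (φ r)).2 := hβinj.extend_apply _ _ r
      rw [hpr]
      exact hR r (hβmono.le_iff_le.mp hb2)
    · have : p b = d b := Function.extend_apply' _ _ b hb
      rwa [this]
  have hβtop : Tendsto β atTop atTop := hl.comp hns'
  refine ((h p hp).comp hβtop).congr fun r => ?_
  have hpr : p (β r) = (ns (φ r)).2 := hβinj.extend_apply _ _ r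
  simp only [Function.comp_apply, hpr, β]

/-- The separation of a pair of translations relative to the region size. -/
noncomputable def separation (q : (ℕ × ℕ) × (ℤ × ℤ) × (ℤ × ℤ)) : ℝ :=
  min (min (q.1.1 : ℝ) q.1.2)
    (min (|(q.2.1.1 : ℝ) - q.2.2.1| / q.1.1) (|(q.2.1.2 : ℝ) - q.2.2.2| / q.1.2))

/-- Along growing sizes the size terms of the minimum diverge by themselves. They are there so that
large separation alone already forces large regions. -/
lemma tendsto_separation_iff {j k : ℕ × ℕ → ℤ × ℤ} :
    Tendsto (fun β => separation (β, j β, k β)) atTop atTop ↔ WellSeparated j k := by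
  constructor
  · intro h
    exact ⟨tendsto_atTop_mono (fun β => (min_le_right _ _).trans (min_le_left _ _)) h,
      tendsto_atTop_mono (fun β => (min_le_right _ _).trans (min_le_right _ _)) h⟩
  · rintro ⟨h1, h2⟩
    refine tendsto_atTop.mpr fun K => ?_
    filter_upwards [tendsto_atTop.mp h1 K, tendsto_atTop.mp h2 K,
      tendsto_atTop.mp (tendsto_natCast_atTop_atTop.comp tendsto_fst_atTop_prod) K,
      tendsto_atTop.mp (tendsto_natCast_atTop_atTop.comp tendsto_snd_atTop_prod) K]
      with β a1 a2 a3 a4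
    exact le_min (le_min a3 a4) (le_min a1 a2)

/-- A concrete well-separated pair, used to fill in the sizes that a given subsequence misses: m²/m
= m. -/
lemma wellSeparated_default :
    WellSeparated (fun β => ((β.1 : ℤ) * β.1, (β.2 : ℤ) * β.2)) fun _ => 0 := by
  have key : ∀ m : ℕ, |(((m : ℤ) * m : ℤ) : ℝ) - ((0 : ℤ) : ℝ)| / (m : ℝ) = m := by
    intro m
    rcases Nat.eq_zero_or_pos m with rfl | hm
    · simp
    · have : (0 : ℝ) < m := by exact_mod_cast hm
      push_cast
      rw [sub_zero, abs_of_nonneg (by positivity)]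
      field_simp
  constructor
  · simp only [Prod.fst_zero, key]
    exact tendsto_natCast_atTop_atTop.comp tendsto_fst_atTop_prod
  · simp only [Prod.snd_zero, key]
    exact tendsto_natCast_atTop_atTop.comp tendsto_snd_atTop_prod

/-- A quantity that converges along all well-separated families converges uniformly in the
separation. -/
theorem eventually_of_wellSeparated {Φ : ℕ × ℕ → (ℤ × ℤ) × (ℤ × ℤ) → ℝ} {c : ℝ}
    (h : ∀ j k, WellSeparated j k → Tendsto (fun β => Φ β (j β, k β)) atTop (𝓝 c))
    {ε : ℝ} (hε : 0 < ε) :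
    ∃ K : ℝ, ∀ q : (ℕ × ℕ) × (ℤ × ℤ) × (ℤ × ℤ), K ≤ separation q → |Φ q.1 q.2 - c| < ε := by
  have hl : Tendsto Prod.fst (comap separation atTop) (atTop : Filter (ℕ × ℕ)) := by
    rw [← prod_atTop_atTop_eq, tendsto_prod_iff']
    constructor
    · rw [← tendsto_natCast_atTop_iff (R := ℝ)]
      exact tendsto_atTop_mono (fun q => (min_le_left _ _).trans (min_le_left _ _))
        tendsto_comap
    · rw [← tendsto_natCast_atTop_iff (R := ℝ)]
      exact tendsto_atTop_mono (fun q => (min_le_left _ _).trans (min_le_right _ _))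
        tendsto_comap
  -- Sections tending along this filter are exactly the well-separated families, and a limit along
  -- the filter is uniformity in the separation.
  have ht := tendsto_of_sections (l := comap separation atTop) hl
    (fun β => (((β.1 : ℤ) * β.1, (β.2 : ℤ) * β.2), 0))
    (tendsto_comap_iff.mpr (tendsto_separation_iff.mpr wellSeparated_default)) (Φ := Φ) (c := c)
    fun p hp => h (fun β => (p β).1) (fun β => (p β).2)
      (tendsto_separation_iff.mp (tendsto_comap_iff.mp hp))
  have hev := Metric.tendsto_nhds.mp ht ε hε
  rw [(atTop_basis.comap separation).eventually_iff] at hev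
  obtain ⟨K, -, hK⟩ := hev
  exact ⟨K, fun q hq => hK hq⟩

/-! ### Averages over blocks -/

section BlockMean

variable {n b : ℕ × ℕ}

lemma blockMean_add (g h : ℤ × ℤ → ℝ) :
    blockMean n b (fun l => g l + h l) = blockMean n b g + blockMean n b h := by
  simp only [blockMean, Finset.sum_add_distrib, mul_add]

lemma blockMean_sub (g h : ℤ × ℤ → ℝ) :
    blockMean n b (fun l => g l - h l) = blockMean n b g - blockMean n b h := by
  simp only [blockMean, Finset.sum_sub_distrib, mul_sub]

lemma blockMean_const_mul (c : ℝ) (g : ℤ × ℤ → ℝ) :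
    blockMean n b (fun l => c * g l) = c * blockMean n b g := by
  simp only [blockMean, ← Finset.mul_sum]
  ring

lemma blockMean_const (hne : (blockShifts n b).Nonempty) (c : ℝ) :
    blockMean n b (fun _ => c) = c := by
  have : ((blockShifts n b).card : ℝ) ≠ 0 := by
    exact_mod_cast hne.card_pos.ne'
  rw [blockMean, Finset.sum_const, nsmul_eq_mul, inv_mul_cancel_left₀ this]

lemma blockMean_mono {g h : ℤ × ℤ → ℝ} (hgh : ∀ l, g l ≤ h l) :
    blockMean n b g ≤ blockMean n b h :=
  mul_le_mul_of_nonneg_left (Finset.sum_le_sum fun l _ => hgh l) (by positivity)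

lemma blockMean_nonneg {g : ℤ × ℤ → ℝ} (hg : ∀ l, 0 ≤ g l) : 0 ≤ blockMean n b g :=
  mul_nonneg (by positivity) (Finset.sum_nonneg fun l _ => hg l)

lemma blockMean_sub_blockMean_sq (hne : (blockShifts n b).Nonempty) (g : ℤ × ℤ → ℝ) :
    blockMean n b (fun l => (g l - blockMean n b g) ^ 2) =
      blockMean n b (fun l => g l ^ 2) - blockMean n b g ^ 2 := by
  set m := blockMean n b g with hm
  have : ∀ l, (g l - m) ^ 2 = (g l ^ 2 - 2 * m * g l) + m ^ 2 := fun l => by ring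
  simp_rw [this]
  rw [blockMean_add, blockMean_sub, blockMean_const_mul, blockMean_const hne, ← hm]
  ring

lemma blockMean_sq_le (hne : (blockShifts n b).Nonempty) (g : ℤ × ℤ → ℝ) :
    blockMean n b g ^ 2 ≤ blockMean n b (fun l => g l ^ 2) := by
  have h1 := blockMean_sub_blockMean_sq hne g
  have h2 : 0 ≤ blockMean n b (fun l => (g l - blockMean n b g) ^ 2) :=
    blockMean_nonneg fun l => sq_nonneg _
  linarith

variable {Ω : Type*} [MeasurableSpace Ω] {P : Measure Ω}

lemma integrable_blockMean {F : ℤ × ℤ → Ω → ℝ} (hF : ∀ l, Integrable (F l) P) :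
    Integrable (fun x => blockMean n b fun l => F l x) P :=
  (integrable_finsetSum _ fun l _ => hF l).const_mul _

lemma memLp_blockMean {F : ℤ × ℤ → Ω → ℝ} (hF : ∀ l, MemLp (F l) 2 P) :
    MemLp (fun x => blockMean n b fun l => F l x) 2 P :=
  (memLp_finsetSum _ fun l _ => hF l).const_mul _

lemma integral_blockMean {F : ℤ × ℤ → Ω → ℝ} (hF : ∀ l, Integrable (F l) P) :
    ∫ x, blockMean n b (fun l => F l x) ∂P = blockMean n b fun l => ∫ x, F l x ∂P := by
  simp only [blockMean]
  rw [integral_const_mul, integral_finsetSum _ fun l _ => hF l]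

end BlockMean

/-! ### Counting close pairs of blocks -/

lemma card_blockShifts {n b : ℕ × ℕ} (h1 : b.1 ≤ n.1) (h2 : b.2 ≤ n.2) :
    ((blockShifts n b).card : ℝ) = ((n.1 : ℝ) - b.1 + 1) * ((n.2 : ℝ) - b.2 + 1) := by
  rw [blockShifts, Finset.card_product, Int.card_Icc, Int.card_Icc]
  have e : ∀ p q : ℕ, q ≤ p → ((((p : ℤ) - q + 1 - 0).toNat : ℕ) : ℝ) = (p : ℝ) - q + 1 := by
    intro p q h
    have : ((p : ℤ) - q + 1 - 0).toNat = p - q + 1 := by omega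
    rw [this]
    push_cast [Nat.cast_sub h]
    ring
  push_cast
  rw [e _ _ h1, e _ _ h2]

lemma card_filter_close_le (a m : ℤ) (K c : ℕ) :
    (((Finset.Icc 0 m).filter fun x : ℤ => |a - x| < K * c).card : ℝ) ≤ 2 * (K * c) + 1 := by
  have h : ((Finset.Icc 0 m).filter fun x : ℤ => |a - x| < K * c).card ≤ 2 * (K * c) + 1 := by
    calc _ ≤ (Finset.Icc (a - (K * c : ℕ)) (a + (K * c : ℕ))).card := by
          refine Finset.card_le_card fun x hx => ?_
          simp only [Finset.mem_filter, Finset.mem_Icc, abs_lt] at hx ⊢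
          push_cast
          omega
      _ ≤ _ := by rw [Int.card_Icc]; omega
  exact_mod_cast h

/-- Double averages over blocks of a bounded kernel that is small at separated pairs. -/
lemma abs_double_blockMean_le {n b : ℕ × ℕ} (h1 : b.1 ≤ n.1) (h2 : b.2 ≤ n.2)
    (e : ℤ × ℤ → ℤ × ℤ → ℝ) {D ε : ℝ} (hD0 : 0 ≤ D) (hε : 0 ≤ ε) (hD : ∀ l l', |e l l'| ≤ D) (K : ℕ)
    (hfar : ∀ l l', (K * b.1 : ℤ) ≤ |l.1 - l'.1| → (K * b.2 : ℤ) ≤ |l.2 - l'.2| →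
      |e l l'| ≤ ε) :
    |blockMean n b fun l => blockMean n b fun l' => e l l'| ≤
      ε + D * ((2 * (K * b.1) + 1) / ((n.1 : ℝ) - b.1 + 1) +
        (2 * (K * b.2) + 1) / ((n.2 : ℝ) - b.2 + 1)) := by
  classical
  have hc1 : (b.1 : ℝ) ≤ n.1 := by exact_mod_cast h1
  have hc2 : (b.2 : ℝ) ≤ n.2 := by exact_mod_cast h2
  set L1 : ℝ := (n.1 : ℝ) - b.1 + 1 with hL1
  set L2 : ℝ := (n.2 : ℝ) - b.2 + 1 with hL2
  have hL1p : 0 < L1 := by linarith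
  have hL2p : 0 < L2 := by linarith
  have hcard : ((blockShifts n b).card : ℝ) = L1 * L2 := card_blockShifts h1 h2
  have hne : (blockShifts n b).Nonempty := by
    rw [← Finset.card_pos]
    have : (0 : ℝ) < (blockShifts n b).card := by rw [hcard]; positivity
    exact_mod_cast this
  set δ := (2 * (K * b.1) + 1) / L1 + (2 * (K * b.2) + 1) / L2 with hδ
  have hc3 : ((Finset.Icc (0 : ℤ) ((n.1 : ℤ) - b.1)).card : ℝ) = L1 := by
    rw [Int.card_Icc, show ((n.1 : ℤ) - b.1 + 1 - 0).toNat = n.1 - b.1 + 1 by omega]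
    push_cast [Nat.cast_sub h1]
    ring
  have hc4 : ((Finset.Icc (0 : ℤ) ((n.2 : ℤ) - b.2)).card : ℝ) = L2 := by
    rw [Int.card_Icc, show ((n.2 : ℤ) - b.2 + 1 - 0).toNat = n.2 - b.2 + 1 by omega]
    push_cast [Nat.cast_sub h2]
    ring
  have hinner : ∀ l, |blockMean n b fun l' => e l l'| ≤ ε + D * δ := by
    intro l
    -- A block is close as soon as one coordinate is; the close blocks lie in two strips, of at most
    -- 2Kb₁ + 1 columns and 2Kb₂ + 1 rows.
    let close := (blockShifts n b).filter fun l' =>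
      |l.1 - l'.1| < K * b.1 ∨ |l.2 - l'.2| < K * b.2
    have hclose : (close.card : ℝ) ≤ L1 * L2 * δ := by
      have hsub : close ⊆
          (((Finset.Icc 0 ((n.1 : ℤ) - b.1)).filter fun x : ℤ => |l.1 - x| < K * b.1) ×ˢ
            Finset.Icc 0 ((n.2 : ℤ) - b.2)) ∪ (Finset.Icc 0 ((n.1 : ℤ) - b.1) ×ˢ
          ((Finset.Icc 0 ((n.2 : ℤ) - b.2)).filter fun x : ℤ => |l.2 - x| < K * b.2)) := by
        intro l' hl'
        simp only [close, blockShifts, Finset.mem_filter, Finset.mem_product, Finset.mem_union]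
          at hl' ⊢
        tauto
      have hle := (Finset.card_le_card hsub).trans (Finset.card_union_le _ _)
      rw [Finset.card_product, Finset.card_product] at hle
      have hle' : (close.card : ℝ) ≤
          (((Finset.Icc 0 ((n.1 : ℤ) - b.1)).filter fun x : ℤ => |l.1 - x| < K * b.1).card : ℝ) *
            ((Finset.Icc (0 : ℤ) ((n.2 : ℤ) - b.2)).card : ℝ) +
          ((Finset.Icc (0 : ℤ) ((n.1 : ℤ) - b.1)).card : ℝ) *
          (((Finset.Icc 0 ((n.2 : ℤ) - b.2)).filter fun x : ℤ => |l.2 - x| < K * b.2).card : ℝ) := by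
        have := (Nat.cast_le (α := ℝ)).mpr hle
        rwa [Nat.cast_add, Nat.cast_mul, Nat.cast_mul] at this
      rw [hc3, hc4] at hle'
      have c1 := card_filter_close_le l.1 ((n.1 : ℤ) - b.1) K b.1
      have c2 := card_filter_close_le l.2 ((n.2 : ℤ) - b.2) K b.2
      calc (close.card : ℝ) ≤ (2 * (K * b.1) + 1) * L2 + L1 * (2 * (K * b.2) + 1) :=
            hle'.trans (add_le_add (mul_le_mul_of_nonneg_right c1 hL2p.le)
              (mul_le_mul_of_nonneg_left c2 hL1p.le))
        _ = L1 * L2 * δ := by rw [hδ]; field_simp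
    have hsum : ∑ l' ∈ blockShifts n b, |e l l'| ≤ L1 * L2 * ε + L1 * L2 * δ * D := by
      calc ∑ l' ∈ blockShifts n b, |e l l'|
          ≤ ∑ l' ∈ blockShifts n b, (ε + if l' ∈ close then D else 0) := by
            refine Finset.sum_le_sum fun l' hl' => ?_
            by_cases hcl : l' ∈ close
            · rw [if_pos hcl]
              linarith [hD l l']
            · rw [if_neg hcl, add_zero]
              simp only [close, Finset.mem_filter, hl', true_and, not_or, not_lt] at hcl
              exact hfar l l' hcl.1 hcl.2
        _ = L1 * L2 * ε + close.card * D := by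
            rw [Finset.sum_add_distrib, Finset.sum_const, nsmul_eq_mul, hcard,
              ← Finset.sum_filter, Finset.sum_const, nsmul_eq_mul]
            congr 4
            exact Finset.filter_mem_eq_inter.trans
              (Finset.inter_eq_right.mpr (Finset.filter_subset _ _))
        _ ≤ _ := add_le_add le_rfl (mul_le_mul_of_nonneg_right hclose hD0)
    rw [blockMean, abs_mul, hcard, abs_of_pos (by positivity : 0 < (L1 * L2)⁻¹),
      inv_mul_le_iff₀ (by positivity)]
    refine (Finset.abs_sum_le_sum_abs _ _).trans (hsum.trans (le_of_eq ?_))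
    ring
  rw [abs_le]
  constructor
  · rw [← blockMean_const hne (-(ε + D * δ))]
    exact blockMean_mono fun l => (abs_le.mp (hinner l)).1
  · rw [← blockMean_const hne (ε + D * δ)]
    exact blockMean_mono fun l => (abs_le.mp (hinner l)).2

lemma tendsto_close_fraction {c m : ℕ × ℕ → ℕ} (hm : Tendsto m atTop atTop)
    (hc : Tendsto (fun n => (c n : ℝ) / m n) atTop (𝓝 0)) (K : ℕ) :
    Tendsto (fun n => (2 * (K * (c n : ℝ)) + 1) / ((m n : ℝ) - c n + 1)) atTop (𝓝 0) := by
  have hm' : Tendsto (fun n => (m n : ℝ)⁻¹) atTop (𝓝 0) :=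
    tendsto_inv_atTop_zero.comp (tendsto_natCast_atTop_atTop.comp hm)
  have h1 : Tendsto (fun n => (2 * (K * ((c n : ℝ) / m n)) + (m n : ℝ)⁻¹) /
      (1 - (c n : ℝ) / m n + (m n : ℝ)⁻¹)) atTop (𝓝 ((2 * (K * 0) + 0) / (1 - 0 + 0))) :=
    (((hc.const_mul _).const_mul _).add hm').div ((hc.const_sub 1).add hm') (by norm_num)
  have e0 : ((2 : ℝ) * (K * 0) + 0) / (1 - 0 + 0) = 0 := by simp
  rw [e0] at h1
  refine h1.congr' ?_
  filter_upwards [hm.eventually_gt_atTop 0] with n hn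
  have hn' : (0 : ℝ) < m n := by exact_mod_cast hn
  rw [← mul_div_mul_left _ _ hn'.ne']
  congr 1 <;> field_simp

/-! ### A law of large numbers for sample variances over blocks -/

/-- Shape of the two-stage arguments below: an auxiliary level is fixed from δ first, and only then
does n grow. -/
lemma tendsto_zero_of_forall_bound {ι : Type*} {l : Filter ι} {a : ι → ℝ} (h0 : ∀ n, 0 ≤ a n)
    (h : ∀ δ > 0, ∃ (r : ι → ℝ) (r₀ : ℝ), r₀ < δ ∧ Tendsto r l (𝓝 r₀) ∧ ∀ᶠ n in l, a n ≤ r n) :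
    Tendsto a l (𝓝 0) := by
  rw [Metric.tendsto_nhds]
  intro δ hδ
  obtain ⟨r, r₀, hr, ht, hle⟩ := h δ hδ
  filter_upwards [hle, ht.eventually_lt_const hr] with n h1 h2
  rw [Real.dist_0_eq_abs, abs_of_nonneg (h0 n)]
  exact h1.trans_lt h2

lemma integral_abs_le_sqrt {Ω : Type*} [MeasurableSpace Ω] {P : Measure Ω}
    [IsProbabilityMeasure P] {Y : Ω → ℝ} (hY : MemLp Y 2 P) :
    ∫ x, |Y x| ∂P ≤ √(∫ x, Y x ^ 2 ∂P) := by
  have h1 := variance_nonneg (fun x => |Y x|) P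
  have hY' : MemLp (fun x => |Y x|) 2 P := hY.abs
  rw [variance_eq_sub hY'] at h1
  refine Real.le_sqrt_of_sq_le ?_
  simp only [Pi.pow_apply, sq_abs] at h1
  linarith

/-- Outside [-K, K] the claim is (|x| - K)² ≤ x² - K². The same truncation error thus controls both
the squares and the variables. -/
lemma sub_clamp_sq_le {K : ℝ} (hK : 0 ≤ K) (x : ℝ) :
    (x - clamp K x) ^ 2 ≤ x ^ 2 - min (x ^ 2) (K ^ 2) := by
  unfold clamp
  rcases le_total x K with h1 | h1
  · rw [min_eq_left h1]
    rcases le_total (-K) x with h2 | h2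
    · rw [max_eq_right h2, sub_self]
      have := min_le_left (x ^ 2) (K ^ 2)
      nlinarith
    · rw [max_eq_left h2, min_eq_right (by nlinarith)]; nlinarith
  · rw [min_eq_right h1, max_eq_right (by linarith), min_eq_right (by nlinarith)]; nlinarith

section LLN

variable {Ω : Type*} [MeasurableSpace Ω] {P : Measure Ω} [IsProbabilityMeasure P]
  {μ : Measure ℝ} [IsProbabilityMeasure μ] {X : ℕ × ℕ → ℤ × ℤ → Ω → ℝ} {b : ℕ × ℕ → ℕ × ℕ}

lemma eventually_le_of_tendsto_div {c m : ℕ × ℕ → ℕ} (hm : Tendsto m atTop atTop)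
    (hc : Tendsto (fun n => (c n : ℝ) / m n) atTop (𝓝 0)) : ∀ᶠ n in atTop, c n ≤ m n := by
  filter_upwards [hm.eventually_gt_atTop 0, hc.eventually_lt_const one_pos] with n h1 h2
  have : (0 : ℝ) < m n := by exact_mod_cast h1
  rw [div_lt_one this] at h2
  exact_mod_cast h2.le

/-- The block sizes grow, but slower than the sampling region. -/
structure AdmissibleBlocks (b : ℕ × ℕ → ℕ × ℕ) : Prop where
  tendsto_atTop : Tendsto b atTop atTop
  fst_div : Tendsto (fun n : ℕ × ℕ => ((b n).1 : ℝ) / (n.1 : ℝ)) atTop (𝓝 0)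
  snd_div : Tendsto (fun n : ℕ × ℕ => ((b n).2 : ℝ) / (n.2 : ℝ)) atTop (𝓝 0)

lemma AdmissibleBlocks.eventually_le (hb : AdmissibleBlocks b) :
    ∀ᶠ n in atTop, (b n).1 ≤ n.1 ∧ (b n).2 ≤ n.2 :=
  (eventually_le_of_tendsto_div tendsto_fst_atTop_prod hb.fst_div).and
    (eventually_le_of_tendsto_div tendsto_snd_atTop_prod hb.snd_div)

lemma blockShifts_nonempty {n c : ℕ × ℕ} (h : c.1 ≤ n.1 ∧ c.2 ≤ n.2) :
    (blockShifts n c).Nonempty := by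
  refine ⟨0, ?_⟩
  simp only [blockShifts, Finset.mem_product, Finset.mem_Icc, Prod.fst_zero, Prod.snd_zero]
  omega

lemma AdmissibleBlocks.eventually_nonempty (hb : AdmissibleBlocks b) :
    ∀ᶠ n in atTop, (blockShifts n (b n)).Nonempty :=
  hb.eventually_le.mono fun _ h => blockShifts_nonempty h

/-- The joint law of the statistics at well-separated translations converges to `μ ⊗ μ`. -/
def SeparatedLaw (P : Measure Ω) [IsProbabilityMeasure P] (X : ℕ × ℕ → ℤ × ℤ → Ω → ℝ)
    (μ : Measure ℝ) [IsProbabilityMeasure μ] : Prop :=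
  ∀ j k : ℕ × ℕ → ℤ × ℤ, WellSeparated j k →
    TendstoInDistribution (fun (β : ℕ × ℕ) x => (X β (j β) x, X β (k β) x)) atTop
      (id : ℝ × ℝ → ℝ × ℝ) (fun _ => P) (μ.prod μ)

/-- Block averages of a bounded continuous function of the statistics converge in `L²`. -/
theorem SeparatedLaw.tendsto_blockMean_bounded (h : SeparatedLaw P X μ)
    (hX : ∀ β j, AEStronglyMeasurable (X β j) P) (hb : AdmissibleBlocks b) {g : ℝ → ℝ}
    (hg : Continuous g) {C : ℝ} (hC : ∀ y, |g y| ≤ C) :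
    Tendsto (fun n => ∫ x, (blockMean n (b n) (fun l => g (X (b n) l x)) - ∫ y, g y ∂μ) ^ 2 ∂P)
      atTop (𝓝 0) := by
  set c := ∫ y, g y ∂μ with hc
  have hC0 : 0 ≤ C := (abs_nonneg _).trans (hC 0)
  have hgint : Integrable g μ :=
    Integrable.of_bound hg.aestronglyMeasurable C (Eventually.of_forall hC)
  have hcC : |c| ≤ C := by
    have := norm_integral_le_of_norm_le_const (μ := μ) (f := g) (C := C) (Eventually.of_forall hC)
    simpa using this
  let G : ℝ → ℝ := fun y => g y - c
  have hG : Continuous G := hg.sub continuous_const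
  have hGb : ∀ y, |G y| ≤ 2 * C := fun y => by
    have := abs_sub (g y) c
    linarith [hC y]
  have hGμ : ∫ y, G y ∂μ = 0 := by
    simp only [G]
    rw [integral_sub hgint (integrable_const _)]
    simp [hc]
  have hGGb : ∀ y z, |G y * G z| ≤ (2 * C) * (2 * C) := fun y z => by
    rw [abs_mul]
    exact mul_le_mul (hGb y) (hGb z) (abs_nonneg _) (by positivity)
  let Φ : ℕ × ℕ → (ℤ × ℤ) × (ℤ × ℤ) → ℝ := fun β q => ∫ x, G (X β q.1 x) * G (X β q.2 x) ∂P
  have hmeas : ∀ β j, AEStronglyMeasurable (fun x => G (X β j x)) P := fun β j =>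
    hG.comp_aestronglyMeasurable (hX β j)
  have hInt : ∀ β j k, Integrable (fun x => G (X β j x) * G (X β k x)) P := fun β j k =>
    Integrable.of_bound ((hmeas β j).mul (hmeas β k)) _
      (Eventually.of_forall fun x => hGGb _ _)
  have hΦb : ∀ β q, |Φ β q| ≤ (2 * C) * (2 * C) := fun β q => by
    have := norm_integral_le_of_norm_le_const (μ := P)
      (f := fun x => G (X β q.1 x) * G (X β q.2 x)) (C := (2 * C) * (2 * C))
      (Eventually.of_forall fun x => hGGb _ _)
    simpa using this
  -- The limit law is a product, so the covariance tends to the squared integral of the centered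
  -- function `G`, which is zero.
  have hΦ : ∀ j k, WellSeparated j k → Tendsto (fun β => Φ β (j β, k β)) atTop (𝓝 0) := by
    intro j k hjk
    have h1 := tendsto_integral_of_tendstoInDistribution (h j k hjk)
      (g := fun p : ℝ × ℝ => G p.1 * G p.2)
      ((hG.comp continuous_fst).mul (hG.comp continuous_snd)) (fun p => hGGb p.1 p.2)
    simp only [id] at h1
    rw [integral_prod_mul, hGμ, mul_zero] at h1
    exact h1
  refine tendsto_zero_of_forall_bound (fun n => integral_nonneg fun x => sq_nonneg _) ?_
  intro ε hε
  obtain ⟨K, hK⟩ := eventually_of_wellSeparated hΦ (half_pos hε)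
  set K' := ⌈K⌉₊ with hK'
  have hKK' : K ≤ K' := Nat.le_ceil K
  refine ⟨fun n => ε / 2 + (2 * C) * (2 * C) *
    ((2 * (K' * ((b n).1 : ℝ)) + 1) / ((n.1 : ℝ) - (b n).1 + 1) +
      (2 * (K' * ((b n).2 : ℝ)) + 1) / ((n.2 : ℝ) - (b n).2 + 1)), ε / 2, half_lt_self hε, ?_, ?_⟩
  · have t1 := tendsto_close_fraction (c := fun n => (b n).1) tendsto_fst_atTop_prod hb.fst_div K'
    have t2 := tendsto_close_fraction (c := fun n => (b n).2) tendsto_snd_atTop_prod hb.snd_div K'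
    simpa using ((t1.add t2).const_mul ((2 * C) * (2 * C))).const_add (ε / 2)
  · have hb1 := tendsto_fst_atTop_prod.comp hb.tendsto_atTop
    have hb2 := tendsto_snd_atTop_prod.comp hb.tendsto_atTop
    -- Separation also measures the block sizes, so these must reach K'; the extra 1 keeps them
    -- positive for the divisions.
    filter_upwards [hb.eventually_le, hb1.eventually_ge_atTop (K' + 1),
      hb2.eventually_ge_atTop (K' + 1)] with n hle hn1 hn2
    simp only [Function.comp_apply] at hn1 hn2
    have hne := blockShifts_nonempty hle
    have p1 : (0 : ℝ) < (b n).1 := by exact_mod_cast (by omega : 0 < (b n).1)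
    have p2 : (0 : ℝ) < (b n).2 := by exact_mod_cast (by omega : 0 < (b n).2)
    have q1 : (K' : ℝ) ≤ (b n).1 := by exact_mod_cast (by omega : K' ≤ (b n).1)
    have q2 : (K' : ℝ) ≤ (b n).2 := by exact_mod_cast (by omega : K' ≤ (b n).2)
    have key := abs_double_blockMean_le hle.1 hle.2 (fun l l' => Φ (b n) (l, l'))
      (D := (2 * C) * (2 * C)) (by positivity) (half_pos hε).le (fun l l' => hΦb _ _) K'
      (fun l l' h1 h2 => by
        have h1' : (K' : ℝ) * (b n).1 ≤ |(l.1 : ℝ) - l'.1| := by exact_mod_cast h1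
        have h2' : (K' : ℝ) * (b n).2 ≤ |(l.2 : ℝ) - l'.2| := by exact_mod_cast h2
        have := hK (b n, l, l') (le_min (le_min (hKK'.trans q1) (hKK'.trans q2))
          (le_min (hKK'.trans ((le_div_iff₀ p1).mpr h1'))
            (hKK'.trans ((le_div_iff₀ p2).mpr h2'))))
        rw [sub_zero] at this
        exact this.le)
    refine le_trans (le_of_eq ?_) ((le_abs_self _).trans key)
    have e1 : ∀ x, (blockMean n (b n) (fun l => g (X (b n) l x)) - c) ^ 2 =
        blockMean n (b n) fun l => blockMean n (b n) fun l' =>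
          G (X (b n) l x) * G (X (b n) l' x) := by
      intro x
      have e2 : blockMean n (b n) (fun l => g (X (b n) l x)) - c =
          blockMean n (b n) fun l => G (X (b n) l x) := by
        simp only [G]
        rw [blockMean_sub, blockMean_const hne]
      rw [e2]
      simp_rw [blockMean_const_mul]
      simp_rw [mul_comm (G _)]
      rw [blockMean_const_mul, pow_two]
    simp_rw [e1]
    rw [integral_blockMean fun l => integrable_blockMean fun l' => hInt (b n) l l']
    congr 1
    funext l
    rw [integral_blockMean fun l' => hInt (b n) l l']

lemma tendsto_integral_min_sq (hμ : MemLp id 2 μ) :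
    Tendsto (fun K : ℕ => ∫ y, min (y ^ 2) ((K : ℝ) ^ 2) ∂μ) atTop (𝓝 (∫ y, y ^ 2 ∂μ)) := by
  refine tendsto_integral_of_dominated_convergence (fun y => y ^ 2)
    (fun K => (by fun_prop : Continuous fun y : ℝ => min (y ^ 2) ((K : ℝ) ^ 2)).aestronglyMeasurable)
    hμ.integrable_sq ?_ ?_
  · refine fun K => Eventually.of_forall fun y => ?_
    rw [Real.norm_of_nonneg (le_min (sq_nonneg _) (sq_nonneg _))]
    exact min_le_left _ _
  · refine Eventually.of_forall fun y => ?_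
    refine tendsto_const_nhds.congr' ?_
    obtain ⟨N, hN⟩ := exists_nat_ge |y|
    filter_upwards [eventually_ge_atTop N] with K hK
    have h1 : |y| ≤ K := hN.trans (by exact_mod_cast hK)
    rw [min_eq_left]
    rw [← sq_abs y]
    exact pow_le_pow_left₀ (abs_nonneg _) h1 2

/-- The truncation error of the block averages of squares is asymptotically that of the limit
law. -/
lemma SeparatedLaw.tendsto_truncation_error (h : SeparatedLaw P X μ)
    (hX : ∀ β j, MemLp (X β j) 2 P) (hb : AdmissibleBlocks b)
    (hshift : ∀ᶠ β in atTop, ∀ j, ∫ x, X β j x ^ 2 ∂P = ∫ x, X β 0 x ^ 2 ∂P)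
    (hmom : Tendsto (fun β => ∫ x, X β 0 x ^ 2 ∂P) atTop (𝓝 (∫ y, y ^ 2 ∂μ))) (K : ℝ) :
    Tendsto (fun n => ∫ x, blockMean n (b n)
      (fun l => X (b n) l x ^ 2 - min (X (b n) l x ^ 2) (K ^ 2)) ∂P) atTop
      (𝓝 (∫ y, y ^ 2 ∂μ - ∫ y, min (y ^ 2) (K ^ 2) ∂μ)) := by
  have hcont : Continuous fun y : ℝ => min (y ^ 2) (K ^ 2) := by fun_prop
  have hbd : ∀ y : ℝ, |min (y ^ 2) (K ^ 2)| ≤ K ^ 2 := fun y => by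
    rw [abs_of_nonneg (le_min (sq_nonneg _) (sq_nonneg _))]
    exact min_le_right _ _
  have hm : ∀ β j, MemLp (fun x => min (X β j x ^ 2) (K ^ 2)) 2 P := fun β j =>
    MemLp.of_bound (hcont.comp_aestronglyMeasurable (hX β j).1) (K ^ 2)
      (Eventually.of_forall fun x => hbd _)
  have t1 := h.tendsto_blockMean_bounded (fun β j => (hX β j).1) hb hcont hbd
  set c := ∫ y, min (y ^ 2) (K ^ 2) ∂μ
  have t2 : Tendsto (fun n => ∫ x, blockMean n (b n)
      (fun l => min (X (b n) l x ^ 2) (K ^ 2)) ∂P) atTop (𝓝 c) := by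
    rw [tendsto_iff_dist_tendsto_zero]
    have t3 : Tendsto (fun n => √(∫ x, (blockMean n (b n)
        (fun l => min (X (b n) l x ^ 2) (K ^ 2)) - c) ^ 2 ∂P)) atTop (𝓝 0) := by
      simpa using t1.sqrt
    refine squeeze_zero (fun _ => dist_nonneg) (fun n => ?_) t3
    have hM : MemLp (fun x => blockMean n (b n)
        (fun l => min (X (b n) l x ^ 2) (K ^ 2)) - c) 2 P :=
      (memLp_blockMean fun l => hm (b n) l).sub (memLp_const c)
    refine le_trans ?_ (integral_abs_le_sqrt hM)
    have e : ∫ x, blockMean n (b n) (fun l => min (X (b n) l x ^ 2) (K ^ 2)) ∂P - c =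
        ∫ x, (blockMean n (b n) (fun l => min (X (b n) l x ^ 2) (K ^ 2)) - c) ∂P := by
      rw [integral_sub (integrable_blockMean fun l => (hm (b n) l).integrable (by norm_num))
        (integrable_const _)]
      simp
    rw [Real.dist_eq, e]
    exact abs_integral_le_integral_abs
  -- By translation invariance the block average of X² has expectation exactly the second moment of
  -- one block, so no law of large numbers is needed for it here.
  refine ((hmom.comp hb.tendsto_atTop).sub t2).congr' ?_
  filter_upwards [hb.eventually_nonempty, hb.tendsto_atTop.eventually hshift] with n hne hs
  simp_rw [blockMean_sub]
  rw [integral_sub (integrable_blockMean fun l => (hX (b n) l).integrable_sq)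
    (integrable_blockMean fun l => (hm (b n) l).integrable (by norm_num)),
    integral_blockMean fun l => (hX (b n) l).integrable_sq]
  simp_rw [hs]
  rw [blockMean_const hne]
  rfl

/-- Block averages of squares converge in `L¹`. -/
theorem SeparatedLaw.tendsto_blockMean_sq (h : SeparatedLaw P X μ)
    (hX : ∀ β j, MemLp (X β j) 2 P) (hμ : MemLp id 2 μ) (hb : AdmissibleBlocks b)
    (hshift : ∀ᶠ β in atTop, ∀ j, ∫ x, X β j x ^ 2 ∂P = ∫ x, X β 0 x ^ 2 ∂P)
    (hmom : Tendsto (fun β => ∫ x, X β 0 x ^ 2 ∂P) atTop (𝓝 (∫ y, y ^ 2 ∂μ))) :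
    Tendsto (fun n => ∫ x, |blockMean n (b n) (fun l => X (b n) l x ^ 2) - ∫ y, y ^ 2 ∂μ| ∂P)
      atTop (𝓝 0) := by
  refine tendsto_zero_of_forall_bound (fun n => integral_nonneg fun x => abs_nonneg _) ?_
  intro δ hδ
  set m := ∫ y, y ^ 2 ∂μ
  -- The error bound tends to (m - c) + 0 + (m - c): truncation on the blocks, bounded law of large
  -- numbers, truncation of the limit law. This level makes it less than δ.
  obtain ⟨K, hK⟩ := ((tendsto_integral_min_sq hμ).eventually_const_lt
    (show m - δ / 2 < m by linarith)).exists
  have hcont : Continuous fun y : ℝ => min (y ^ 2) ((K : ℝ) ^ 2) := by fun_prop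
  have hbd : ∀ y : ℝ, |min (y ^ 2) ((K : ℝ) ^ 2)| ≤ (K : ℝ) ^ 2 := fun y => by
    rw [abs_of_nonneg (le_min (sq_nonneg _) (sq_nonneg _))]
    exact min_le_right _ _
  have hm : ∀ β j, MemLp (fun x => min (X β j x ^ 2) ((K : ℝ) ^ 2)) 2 P := fun β j =>
    MemLp.of_bound (hcont.comp_aestronglyMeasurable (hX β j).1) ((K : ℝ) ^ 2)
      (Eventually.of_forall fun x => hbd _)
  have t1 := (h.tendsto_blockMean_bounded (fun β j => (hX β j).1) hb hcont hbd).sqrt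
  rw [Real.sqrt_zero] at t1
  have t2 := h.tendsto_truncation_error hX hb hshift hmom K
  set c := ∫ y, min (y ^ 2) ((K : ℝ) ^ 2) ∂μ
  have hcm : c ≤ m := integral_mono
    (Integrable.of_bound hcont.aestronglyMeasurable _ (Eventually.of_forall hbd))
    hμ.integrable_sq fun y => min_le_left _ _
  refine ⟨_, _, ?_, (t2.add t1).add_const (m - c), Eventually.of_forall fun n => ?_⟩
  · linarith
  · have hM : MemLp (fun x => blockMean n (b n)
        (fun l => min (X (b n) l x ^ 2) ((K : ℝ) ^ 2)) - c) 2 P :=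
      (memLp_blockMean fun l => hm (b n) l).sub (memLp_const c)
    have i1 : Integrable (fun x => blockMean n (b n)
        (fun l => X (b n) l x ^ 2 - min (X (b n) l x ^ 2) ((K : ℝ) ^ 2))) P :=
      integrable_blockMean fun l =>
        (hX (b n) l).integrable_sq.sub ((hm (b n) l).integrable (by norm_num))
    have i2 : Integrable (fun x => |blockMean n (b n)
        (fun l => min (X (b n) l x ^ 2) ((K : ℝ) ^ 2)) - c|) P :=
      (hM.integrable (by norm_num)).abs
    have i3 : Integrable (fun x => blockMean n (b n) (fun l => X (b n) l x ^ 2) - m) P :=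
      (integrable_blockMean fun l => (hX (b n) l).integrable_sq).sub (integrable_const m)
    have i4 : Integrable (fun x => blockMean n (b n)
        (fun l => X (b n) l x ^ 2 - min (X (b n) l x ^ 2) ((K : ℝ) ^ 2)) +
        |blockMean n (b n) (fun l => min (X (b n) l x ^ 2) ((K : ℝ) ^ 2)) - c|) P := i1.add i2
    calc ∫ x, |blockMean n (b n) (fun l => X (b n) l x ^ 2) - m| ∂P
        ≤ ∫ x, ((blockMean n (b n)
            (fun l => X (b n) l x ^ 2 - min (X (b n) l x ^ 2) ((K : ℝ) ^ 2)) +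
            |blockMean n (b n) (fun l => min (X (b n) l x ^ 2) ((K : ℝ) ^ 2)) - c|) +
            (m - c)) ∂P := by
          refine integral_mono i3.abs (i4.add (integrable_const _)) fun x => ?_
          have hnn : 0 ≤ blockMean n (b n)
              (fun l => X (b n) l x ^ 2 - min (X (b n) l x ^ 2) ((K : ℝ) ^ 2)) :=
            blockMean_nonneg fun l => sub_nonneg.mpr (min_le_left _ _)
          simp only [blockMean_sub] at hnn ⊢
          set u := blockMean n (b n) (fun l => X (b n) l x ^ 2)
          set v := blockMean n (b n) (fun l => min (X (b n) l x ^ 2) ((K : ℝ) ^ 2))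
          have e : u - m = (u - v) + (v - c) - (m - c) := by ring
          rw [e]
          refine (abs_sub _ _).trans ?_
          rw [abs_of_nonneg (sub_nonneg.mpr hcm)]
          refine add_le_add ((abs_add_le _ _).trans ?_) le_rfl
          rw [abs_of_nonneg hnn]
      _ ≤ _ := by
          rw [integral_add i4 (integrable_const _), integral_add i1 i2]
          refine add_le_add (add_le_add le_rfl (integral_abs_le_sqrt hM)) ?_
          simp

/-- Block averages converge in `L²`. -/
theorem SeparatedLaw.tendsto_blockMean_id (h : SeparatedLaw P X μ)
    (hX : ∀ β j, MemLp (X β j) 2 P) (hμ : MemLp id 2 μ) (hb : AdmissibleBlocks b)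
    (hshift : ∀ᶠ β in atTop, ∀ j, ∫ x, X β j x ^ 2 ∂P = ∫ x, X β 0 x ^ 2 ∂P)
    (hmom : Tendsto (fun β => ∫ x, X β 0 x ^ 2 ∂P) atTop (𝓝 (∫ y, y ^ 2 ∂μ))) :
    Tendsto (fun n => ∫ x, (blockMean n (b n) (fun l => X (b n) l x) - ∫ y, y ∂μ) ^ 2 ∂P)
      atTop (𝓝 0) := by
  refine tendsto_zero_of_forall_bound (fun n => integral_nonneg fun x => sq_nonneg _) ?_
  intro δ hδ
  set m := ∫ y, y ∂μ with hm_def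
  set m₂ := ∫ y, y ^ 2 ∂μ with hm2
  -- The bound below tends to 3 · 2(m₂ - c), the 3 coming from (a + b + c)² ≤ 3(a² + b² + c²); hence
  -- δ / 6.
  obtain ⟨K, hK⟩ := ((tendsto_integral_min_sq hμ).eventually_const_lt
    (show m₂ - δ / 6 < m₂ by linarith)).exists
  have hK0 : (0 : ℝ) ≤ K := Nat.cast_nonneg K
  have t1 := h.tendsto_blockMean_bounded (fun β j => (hX β j).1) hb (continuous_clamp K)
    (abs_clamp_le hK0)
  have t2 := h.tendsto_truncation_error hX hb hshift hmom K
  set c := ∫ y, min (y ^ 2) ((K : ℝ) ^ 2) ∂μ with hc_def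
  set q := ∫ y, clamp K y ∂μ with hq_def
  have hclm : ∀ β j, MemLp (fun x => clamp K (X β j x)) 2 P := fun β j =>
    MemLp.of_bound ((continuous_clamp K).comp_aestronglyMeasurable (hX β j).1) K
      (Eventually.of_forall fun x => abs_clamp_le hK0 _)
  have hmin : ∀ β j, Integrable (fun x => min (X β j x ^ 2) ((K : ℝ) ^ 2)) P := fun β j =>
    Integrable.of_bound ((by fun_prop : Continuous fun y : ℝ => min (y ^ 2) ((K : ℝ) ^ 2)
      ).comp_aestronglyMeasurable (hX β j).1) ((K : ℝ) ^ 2) (Eventually.of_forall fun x => by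
        rw [Real.norm_of_nonneg (le_min (sq_nonneg _) (sq_nonneg _))]
        exact min_le_right _ _)
  have hminμ : Integrable (fun y : ℝ => min (y ^ 2) ((K : ℝ) ^ 2)) μ :=
    Integrable.of_bound ((by fun_prop : Continuous fun y : ℝ => min (y ^ 2) ((K : ℝ) ^ 2)
      ).aestronglyMeasurable) ((K : ℝ) ^ 2) (Eventually.of_forall fun x => by
        rw [Real.norm_of_nonneg (le_min (sq_nonneg _) (sq_nonneg _))]
        exact min_le_right _ _)
  -- The squared mean of y - clamp(y) is at most its mean square, by nonnegativity of the variance.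
  have hqm : (q - m) ^ 2 ≤ m₂ - c := by
    have hid : MemLp (fun y : ℝ => y) 2 μ := hμ
    have hcl : MemLp (fun y : ℝ => clamp K y) 2 μ :=
      MemLp.of_bound (continuous_clamp K).aestronglyMeasurable K
        (Eventually.of_forall fun x => abs_clamp_le hK0 _)
    have hd : MemLp (fun y : ℝ => y - clamp K y) 2 μ := hid.sub hcl
    have h1 := variance_nonneg (fun y : ℝ => y - clamp K y) μ
    rw [variance_eq_sub hd, integral_sub (hid.integrable (by norm_num))
      (hcl.integrable (by norm_num))] at h1
    simp only [Pi.pow_apply] at h1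
    have h2 : ∫ y, (y - clamp K y) ^ 2 ∂μ ≤ m₂ - c := by
      rw [hm2, hc_def, ← integral_sub hid.integrable_sq hminμ]
      exact integral_mono hd.integrable_sq (hid.integrable_sq.sub hminμ)
        fun y => sub_clamp_sq_le hK0 y
    have h3 : (q - m) ^ 2 = (∫ y, y ∂μ - ∫ y, clamp K y ∂μ) ^ 2 := by
      rw [hq_def, hm_def]; ring
    rw [h3]
    linarith
  refine ⟨_, _, ?_, ((t2.add t1).add_const (m₂ - c)).const_mul 3, ?_⟩
  · linarith
  · filter_upwards [hb.eventually_nonempty] with n hne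
    have i1 : Integrable (fun x => blockMean n (b n)
        (fun l => X (b n) l x ^ 2 - min (X (b n) l x ^ 2) ((K : ℝ) ^ 2))) P :=
      integrable_blockMean fun l => (hX (b n) l).integrable_sq.sub (hmin (b n) l)
    have i2 : Integrable (fun x => (blockMean n (b n) (fun l => clamp K (X (b n) l x)) - q) ^ 2)
        P := ((memLp_blockMean fun l => hclm (b n) l).sub (memLp_const q)).integrable_sq
    have i3 : Integrable (fun x => (blockMean n (b n) (fun l => X (b n) l x) - m) ^ 2) P :=
      ((memLp_blockMean fun l => hX (b n) l).sub (memLp_const m)).integrable_sq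
    have i4 : Integrable (fun x => blockMean n (b n)
        (fun l => X (b n) l x ^ 2 - min (X (b n) l x ^ 2) ((K : ℝ) ^ 2)) +
        (blockMean n (b n) (fun l => clamp K (X (b n) l x)) - q) ^ 2) P := i1.add i2
    have i5 : Integrable (fun x => blockMean n (b n)
        (fun l => X (b n) l x ^ 2 - min (X (b n) l x ^ 2) ((K : ℝ) ^ 2)) +
        (blockMean n (b n) (fun l => clamp K (X (b n) l x)) - q) ^ 2 + (m₂ - c)) P :=
      i4.add (integrable_const _)
    calc ∫ x, (blockMean n (b n) (fun l => X (b n) l x) - m) ^ 2 ∂P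
        ≤ ∫ x, 3 * (blockMean n (b n)
            (fun l => X (b n) l x ^ 2 - min (X (b n) l x ^ 2) ((K : ℝ) ^ 2)) +
            (blockMean n (b n) (fun l => clamp K (X (b n) l x)) - q) ^ 2 + (m₂ - c)) ∂P := by
          refine integral_mono i3 (i5.const_mul 3) fun x => ?_
          have hle : (blockMean n (b n) (fun l => X (b n) l x) -
              blockMean n (b n) fun l => clamp K (X (b n) l x)) ^ 2 ≤ blockMean n (b n)
              (fun l => X (b n) l x ^ 2 - min (X (b n) l x ^ 2) ((K : ℝ) ^ 2)) := by
            rw [← blockMean_sub]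
            exact (blockMean_sq_le hne _).trans (blockMean_mono fun l => sub_clamp_sq_le hK0 _)
          simp only
          set u := blockMean n (b n) (fun l => X (b n) l x)
          set v := blockMean n (b n) (fun l => clamp K (X (b n) l x))
          nlinarith [sq_nonneg ((u - v) - (v - q)), sq_nonneg ((v - q) - (q - m)),
            sq_nonneg ((u - v) - (q - m))]
      _ = _ := by
          rw [integral_const_mul, integral_add i4 (integrable_const _), integral_add i1 i2]
          simp

/-- Sample variances over blocks converge in `L¹` to the variance of the limit law. -/
theorem SeparatedLaw.tendsto_sample_variance (h : SeparatedLaw P X μ)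
    (hX : ∀ β j, MemLp (X β j) 2 P) (hμ : MemLp id 2 μ) (hb : AdmissibleBlocks b)
    (hshift : ∀ᶠ β in atTop, ∀ j, ∫ x, X β j x ^ 2 ∂P = ∫ x, X β 0 x ^ 2 ∂P)
    (hmom : Tendsto (fun β => ∫ x, X β 0 x ^ 2 ∂P) atTop (𝓝 (∫ y, y ^ 2 ∂μ))) :
    Tendsto (fun n => ∫ x, |blockMean n (b n)
      (fun l => (X (b n) l x - blockMean n (b n) fun l' => X (b n) l' x) ^ 2) -
        (∫ y, y ^ 2 ∂μ - (∫ y, y ∂μ) ^ 2)| ∂P) atTop (𝓝 0) := by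
  have t1 := h.tendsto_blockMean_sq hX hμ hb hshift hmom
  have t2 := h.tendsto_blockMean_id hX hμ hb hshift hmom
  set m := ∫ y, y ∂μ
  set m₂ := ∫ y, y ^ 2 ∂μ
  have t3 := t2.sqrt
  rw [Real.sqrt_zero] at t3
  have t4 := t1.add (t2.add (t3.const_mul (2 * |m|)))
  simp only [mul_zero, add_zero] at t4
  refine squeeze_zero' (Eventually.of_forall fun n => integral_nonneg fun x => abs_nonneg _) ?_ t4
  filter_upwards [hb.eventually_nonempty] with n hne
  have hV : MemLp (fun x => blockMean n (b n) (fun l => X (b n) l x) - m) 2 P :=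
    (memLp_blockMean fun l => hX (b n) l).sub (memLp_const m)
  have i1 : Integrable (fun x => |blockMean n (b n) (fun l => X (b n) l x ^ 2) - m₂|) P :=
    ((integrable_blockMean fun l => (hX (b n) l).integrable_sq).sub (integrable_const _)).abs
  have i2 : Integrable (fun x => (blockMean n (b n) (fun l => X (b n) l x) - m) ^ 2) P :=
    hV.integrable_sq
  have i3 : Integrable (fun x => 2 * |m| * |blockMean n (b n) (fun l => X (b n) l x) - m|) P :=
    (hV.integrable (by norm_num)).abs.const_mul _
  have i4 : Integrable (fun x => (blockMean n (b n) (fun l => X (b n) l x) - m) ^ 2 +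
      2 * |m| * |blockMean n (b n) (fun l => X (b n) l x) - m|) P := i2.add i3
  simp_rw [fun x => blockMean_sub_blockMean_sq hne fun l => X (b n) l x]
  have i5 : Integrable (fun x => blockMean n (b n) (fun l => X (b n) l x ^ 2) -
      blockMean n (b n) (fun l => X (b n) l x) ^ 2 - (m₂ - m ^ 2)) P :=
    ((integrable_blockMean fun l => (hX (b n) l).integrable_sq).sub
      (memLp_blockMean fun l => hX (b n) l).integrable_sq).sub (integrable_const _)
  calc _ ≤ ∫ x, (|blockMean n (b n) (fun l => X (b n) l x ^ 2) - m₂| +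
        ((blockMean n (b n) (fun l => X (b n) l x) - m) ^ 2 +
          2 * |m| * |blockMean n (b n) (fun l => X (b n) l x) - m|)) ∂P := by
        refine integral_mono i5.abs (i1.add i4) fun x => ?_
        simp only
        set u := blockMean n (b n) (fun l => X (b n) l x ^ 2)
        set v := blockMean n (b n) (fun l => X (b n) l x)
        -- Expanding v² around m² leaves a quadratic and a linear error, both controlled by L²
        -- convergence of the block averages.
        have e : u - v ^ 2 - (m₂ - m ^ 2) = (u - m₂) - ((v - m) ^ 2 + 2 * m * (v - m)) := by ring
        rw [e]
        refine (abs_sub _ _).trans (add_le_add le_rfl ((abs_add_le _ _).trans ?_))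
        rw [abs_of_nonneg (sq_nonneg (v - m)), abs_mul, abs_mul, abs_two]
    _ ≤ _ := by
        rw [integral_add i1 i4, integral_add i2 i3, integral_const_mul]
        refine add_le_add le_rfl (add_le_add le_rfl ?_)
        exact mul_le_mul_of_nonneg_left (integral_abs_le_sqrt hV) (by positivity)

end LLN

/-! ### Moments of the limit laws -/

/-- The k-th moment is the Gamma integral at k + 1. -/
lemma integrable_pow_expMeasure_one (k : ℕ) :
    Integrable (fun x : ℝ => x ^ k) (expMeasure 1) ∧
      ∫ x, x ^ k ∂(expMeasure 1) = (k.factorial : ℝ) := by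
  have hdens : expMeasure 1 = volume.withDensity
      fun x => ENNReal.ofReal (exponentialPDFReal 1 x) := rfl
  have hm : Measurable (exponentialPDFReal 1) := measurable_exponentialPDFReal 1
  have hpdf : ∀ x, 0 ≤ exponentialPDFReal 1 x := exponentialPDFReal_nonneg one_pos
  have e1 : ∀ x ∈ Set.Ioi (0 : ℝ), exponentialPDFReal 1 x * x ^ k =
      Real.exp (-x) * x ^ ((k : ℝ) + 1 - 1) := by
    intro x hx
    have hx' : (0 : ℝ) < x := hx
    rw [add_sub_cancel_right, Real.rpow_natCast, exponentialPDFReal, gammaPDFReal,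
      if_pos hx'.le]
    simp
  have e2 : (fun x => exponentialPDFReal 1 x * x ^ k) =ᵐ[volume]
      (Set.Ioi (0 : ℝ)).indicator fun x => Real.exp (-x) * x ^ ((k : ℝ) + 1 - 1) := by
    have hne : ∀ᵐ x ∂(volume : Measure ℝ), x ≠ 0 := by simp [ae_iff]
    filter_upwards [hne] with x hx
    by_cases hx0 : x ∈ Set.Ioi (0 : ℝ)
    · rw [Set.indicator_of_mem hx0, e1 x hx0]
    · rw [Set.indicator_of_notMem hx0, exponentialPDFReal, gammaPDFReal, if_neg, zero_mul]
      intro h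
      exact hx0 (lt_of_le_of_ne h hx.symm)
  have hInt : IntegrableOn (fun x => Real.exp (-x) * x ^ ((k : ℝ) + 1 - 1)) (Set.Ioi 0) :=
    Real.GammaIntegral_convergent (by positivity)
  have htr : ∀ x, (ENNReal.ofReal (exponentialPDFReal 1 x)).toReal • x ^ k =
      exponentialPDFReal 1 x * x ^ k := fun x => by
    rw [ENNReal.toReal_ofReal (hpdf x), smul_eq_mul]
  have hI : Integrable (fun x => exponentialPDFReal 1 x * x ^ k) volume :=
    (integrable_congr e2).mpr ((integrable_indicator_iff measurableSet_Ioi).mpr hInt)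
  constructor
  · rw [hdens, integrable_withDensity_iff_integrable_smul' hm.ennreal_ofReal
      (Eventually.of_forall fun x => ENNReal.ofReal_lt_top)]
    simp_rw [htr]
    exact hI
  · rw [hdens, integral_withDensity_eq_integral_toReal_smul hm.ennreal_ofReal
      (Eventually.of_forall fun x => ENNReal.ofReal_lt_top)]
    simp_rw [htr]
    rw [integral_congr_ae e2, integral_indicator measurableSet_Ioi,
      ← Real.Gamma_eq_integral (by positivity), Real.Gamma_nat_eq_factorial]

lemma memLp_id_expMeasure_one : MemLp id 2 (expMeasure 1) := by
  rw [memLp_two_iff_integrable_sq (by fun_prop)]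
  exact (integrable_pow_expMeasure_one 2).1

/-- The law of `a U` with `U` standard exponential. -/
noncomputable def scaledExp (a : ℝ) : Measure ℝ := (expMeasure 1).map fun u => a * u

instance isProbabilityMeasure_scaledExp (a : ℝ) : IsProbabilityMeasure (scaledExp a) :=
  Measure.isProbabilityMeasure_map (by fun_prop)

lemma integral_scaledExp (a : ℝ) : ∫ y, y ∂(scaledExp a) = a := by
  rw [scaledExp, integral_map (by fun_prop) (by fun_prop), integral_const_mul]
  have := (integrable_pow_expMeasure_one 1).2
  simp only [pow_one] at this
  rw [this]
  simp

/-- Together with mean a this gives variance a², so sample variances of the periodogram estimate f²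
itself. -/
lemma integral_sq_scaledExp (a : ℝ) : ∫ y, y ^ 2 ∂(scaledExp a) = 2 * a ^ 2 := by
  rw [scaledExp, integral_map (by fun_prop) (by fun_prop)]
  simp_rw [mul_pow]
  rw [integral_const_mul, (integrable_pow_expMeasure_one 2).2]
  norm_num
  ring

lemma memLp_id_scaledExp (a : ℝ) : MemLp id 2 (scaledExp a) := by
  rw [scaledExp, memLp_map_measure_iff (by fun_prop) (by fun_prop)]
  exact memLp_id_expMeasure_one.const_mul a

lemma integral_sq_gaussianReal_zero (v : NNReal) : ∫ y, y ^ 2 ∂(gaussianReal 0 v) = v := by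
  have h := variance_fun_id_gaussianReal (μ := 0) (v := v)
  have hm : MemLp (fun x : ℝ => x) 2 (gaussianReal 0 v) := memLp_id_gaussianReal 2
  rw [variance_eq_sub hm] at h
  simpa using h

/-! ### Consistency of the subsampling estimators -/

lemma tendstoInMeasure_of_tendsto_integral_abs {Ω ι : Type*} [MeasurableSpace Ω] {P : Measure Ω}
    [IsProbabilityMeasure P] {l : Filter ι} {F : ι → Ω → ℝ} (hF : ∀ n, Integrable (F n) P)
    {c : ℝ} (h : Tendsto (fun n => ∫ x, |F n x - c| ∂P) l (𝓝 0)) :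
    TendstoInMeasure P F l fun _ => c := by
  refine tendstoInMeasure_of_tendsto_eLpNorm one_ne_zero (fun n => (hF n).1)
    aestronglyMeasurable_const ?_
  have e : ∀ n, eLpNorm (F n - fun _ => c) 1 P = ENNReal.ofReal (∫ x, |F n x - c| ∂P) := by
    intro n
    rw [eLpNorm_one_eq_lintegral_enorm]
    exact (ofReal_integral_norm_eq_lintegral_enorm ((hF n).sub (integrable_const c))).symm
  simp_rw [e]
  simpa using ENNReal.tendsto_ofReal h

section Consistency

variable {Ω : Type*} [MeasurableSpace Ω] {P : Measure Ω} [IsProbabilityMeasure P]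
  {Z : ℤ × ℤ → Ω → ℝ} {ψ : ℝ × ℝ → ℝ} {b : ℕ × ℕ → ℕ × ℕ}

lemma FourthOrderStationary.integrable_sigmaHatSq (h : FourthOrderStationary P Z)
    (ψ : ℝ × ℝ → ℝ) (n c : ℕ × ℕ) : Integrable (sigmaHatSq Z ψ n c) P :=
  integrable_blockMean fun l =>
    ((h.memLp_specMeanStat ψ l c).sub
      (memLp_blockMean fun l' => h.memLp_specMeanStat ψ l' c)).integrable_sq.const_mul _

lemma FourthOrderStationary.integrable_periodogram_variance (h : FourthOrderStationary P Z)
    (n c : ℕ × ℕ) (w : ℝ × ℝ) :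
    Integrable (fun x => blockMean n c fun l => (periodogram Z l c w x -
      blockMean n c fun l' => periodogram Z l' c w x) ^ 2) P :=
  integrable_blockMean fun l => ((h.memLp_periodogram l c w).sub
    (memLp_blockMean fun l' => h.memLp_periodogram l' c w)).integrable_sq

lemma FourthOrderStationary.integrable_sigmaHatSq1 (h : FourthOrderStationary P Z)
    (ψ : ℝ × ℝ → ℝ) (n c : ℕ × ℕ) : Integrable (sigmaHatSq1 Z ψ n c) P :=
  (integrable_finsetSum _ fun i _ =>
    (h.integrable_periodogram_variance n c (fourierFreq c i)).const_mul _).const_mul _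

/-- A sample variance ignores the unknown centering M(ψ), and the scaling by the root of the block
size produces the factor in the estimator. -/
lemma sigmaHatSq_eq {n c : ℕ × ℕ} (hne : (blockShifts n c).Nonempty) (x : Ω) :
    sigmaHatSq Z ψ n c x = blockMean n c fun l =>
      (hStat P Z ψ l c x - blockMean n c fun l' => hStat P Z ψ l' c x) ^ 2 := by
  rw [sigmaHatSq]
  congr 1
  funext l
  simp only [hStat]
  rw [blockMean_const_mul, blockMean_sub, blockMean_const hne, ← mul_sub, mul_pow,
    Real.sq_sqrt (size_nonneg c)]
  ring

/-- The subsampling variance estimator converges in `L¹`. -/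
theorem FourthOrderStationary.tendsto_sigmaHatSq (h : FourthOrderStationary P Z)
    (hψ : BoundedVariationSquare ψ) (hγ : Summable fun a => |autocov P Z a|)
    (hκ : Summable fun a => |fieldCumulant4 P Z a|) (hlaw : LimitLaw P Z ψ)
    (hsep : SeparatedLimitLaw P Z ψ) (hb : AdmissibleBlocks b) :
    Tendsto (fun n => ∫ x, |sigmaHatSq Z ψ n (b n) x - sigmaSq P Z ψ| ∂P) atTop (𝓝 0) := by
  have hσ : ((sigmaSq P Z ψ).toNNReal : ℝ) = sigmaSq P Z ψ :=
    Real.coe_toNNReal _ (h.sigmaSq_nonneg hψ hγ hκ)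
  have hlaw' : SeparatedLaw P (fun β j => hStat P Z ψ j β)
      (gaussianReal 0 (sigmaSq P Z ψ).toNNReal) := hsep
  have t := hlaw'.tendsto_sample_variance (fun β j => h.memLp_hStat ψ j β)
    (memLp_id_gaussianReal 2) hb
    (Eventually.of_forall fun β j => h.integral_hStat_sq_shift ψ j β)
    (by rw [integral_sq_gaussianReal_zero, hσ]
        exact h.tendsto_integral_hStat_sq hψ hγ hκ hlaw)
  rw [integral_sq_gaussianReal_zero, hσ, integral_id_gaussianReal] at t
  refine t.congr' ?_
  filter_upwards [hb.eventually_nonempty] with n hne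
  simp_rw [sigmaHatSq_eq (P := P) hne]
  simp

/-- At a regular frequency, the periodograms over separated blocks are asymptotically
independent multiples of standard exponential variables. -/
lemma separatedLaw_periodogram (hper : SeparatedPeriodogramLaw P Z) {w : ℝ × ℝ}
    (hw : IsRegularFreq w) :
    SeparatedLaw P (fun β j => periodogram Z j β (fourierFreq β (gridIndex β w)))
      (scaledExp (specDensity P Z w)) := by
  intro j k hjk
  -- The index bound is required for all sizes, and `cellIndex` violates it at size zero. There the
  -- index is replaced by 0, which leaves the frequency unchanged because division by zero gives
  -- zero.
  let m : ℕ × ℕ → ℤ × ℤ := fun n =>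
    (if n.1 = 0 then 0 else cellIndex n.1 w.1, if n.2 = 0 then 0 else cellIndex n.2 w.2)
  have hfreq : ∀ n, fourierFreq n (m n) = fourierFreq n (gridIndex n w) := by
    intro n
    simp only [fourierFreq, m, gridIndex]
    congr 1 <;> split_ifs with h0 <;> simp [h0]
  have hcell : ∀ (n : ℕ) (x : ℝ), |x| < Real.pi →
      |if n = 0 then (0 : ℤ) else cellIndex n x| ≤ (n : ℤ) - (n : ℤ) / 2 := by
    intro n x hx
    split_ifs with h0
    · simp [h0]
    · have := abs_le_of_mem_indexRange (cellIndex_mem (Nat.pos_of_ne_zero h0)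
        (x := x) ⟨(abs_lt.mp hx).1.le, (abs_lt.mp hx).2⟩)
      omega
  have key := hper m w (fun n => ⟨hcell n.1 w.1 hw.1.2, hcell n.2 w.2 hw.2.2⟩)
    (by simp_rw [hfreq]; exact tendsto_fourierFreq_gridIndex w) hw.1.1 hw.1.2 hw.2.1 hw.2.2
    j k hjk
  simp_rw [hfreq] at key
  have hmap : ((scaledExp (specDensity P Z w)).prod (scaledExp (specDensity P Z w))).map id =
      ((expMeasure 1).prod (expMeasure 1)).map
        (fun u : ℝ × ℝ => (specDensity P Z w * u.1, specDensity P Z w * u.2)) := by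
    rw [Measure.map_id, scaledExp, Measure.map_prod_map _ _ (by fun_prop) (by fun_prop)]
    rfl
  refine ⟨key.forall_aemeasurable, aemeasurable_id, ?_⟩
  have ht := key.tendsto
  have heq : (⟨((scaledExp (specDensity P Z w)).prod (scaledExp (specDensity P Z w))).map id,
      Measure.isProbabilityMeasure_map aemeasurable_id⟩ : ProbabilityMeasure (ℝ × ℝ)) =
      ⟨((expMeasure 1).prod (expMeasure 1)).map
        (fun u : ℝ × ℝ => (specDensity P Z w * u.1, specDensity P Z w * u.2)),
        Measure.isProbabilityMeasure_map key.aemeasurable_limit⟩ := Subtype.ext hmap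
  rw [heq]
  exact ht

/-- The sample variance of the periodogram over blocks at a regular frequency converges in `L¹`
to the squared spectral density. -/
lemma FourthOrderStationary.tendsto_periodogram_variance (h : FourthOrderStationary P Z)
    (hγ : Summable fun a => |autocov P Z a|) (hκ : Summable fun a => |fieldCumulant4 P Z a|)
    (hper : SeparatedPeriodogramLaw P Z) (hb : AdmissibleBlocks b) {w : ℝ × ℝ}
    (hw : IsRegularFreq w) :
    Tendsto (fun n => ∫ x, |(blockMean n (b n) fun l =>
      (periodogram Z l (b n) (fourierFreq (b n) (gridIndex (b n) w)) x -
        blockMean n (b n) fun l' =>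
          periodogram Z l' (b n) (fourierFreq (b n) (gridIndex (b n) w)) x) ^ 2) -
        specDensity P Z w ^ 2| ∂P) atTop (𝓝 0) := by
  have t := (separatedLaw_periodogram hper hw).tendsto_sample_variance
    (fun β j => h.memLp_periodogram j β _) (memLp_id_scaledExp _) hb
    ((eventually_gridIndex hw).mono fun β hβ j => h.integral_periodogram_sq_shift j hβ.1)
    (by rw [integral_sq_scaledExp]; exact h.tendsto_integral_periodogram_sq hγ hκ hw)
  rw [integral_sq_scaledExp, integral_scaledExp] at t
  have e : 2 * specDensity P Z w ^ 2 - specDensity P Z w ^ 2 = specDensity P Z w ^ 2 := by ring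
  rw [e] at t
  exact t

lemma continuous_specDensity (hγ : Summable fun a => |autocov P Z a|) :
    Continuous (specDensity P Z) :=
  continuous_const.mul (Complex.continuous_re.comp (continuous_fourierSeries hγ))

lemma exists_bound_specDensity_sq (hγ : Summable fun a => |autocov P Z a|) :
    ∃ C : ℝ, ∀ w, specDensity P Z w ^ 2 ≤ C := by
  refine ⟨(((2 * Real.pi) ^ 2)⁻¹ * ∑' a, |autocov P Z a|) ^ 2, fun w => ?_⟩
  rw [← sq_abs, specDensity_eq, abs_mul, abs_of_nonneg (by positivity)]
  refine pow_le_pow_left₀ (by positivity) (mul_le_mul_of_nonneg_left ?_ (by positivity)) 2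
  exact (Complex.abs_re_le_norm _).trans (norm_fourierSeries_le hγ w)

/-- The subsampling estimator of the first variance component converges in `L¹`. -/
theorem FourthOrderStationary.tendsto_sigmaHatSq1 (h : FourthOrderStationary P Z)
    (hψ : BoundedVariationSquare ψ) (hγ : Summable fun a => |autocov P Z a|)
    (hκ : Summable fun a => |fieldCumulant4 P Z a|) (hper : SeparatedPeriodogramLaw P Z)
    (hb : AdmissibleBlocks b) :
    Tendsto (fun n => ∫ x, |sigmaHatSq1 Z ψ n (b n) x - sigmaSq1 P Z ψ| ∂P) atTop (𝓝 0) := by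
  have hπ := Real.pi_pos
  obtain ⟨B, hB0, hB⟩ := hψ.exists_bound
  obtain ⟨C, hC⟩ := h.exists_bound_periodogram_sq hγ hκ
  obtain ⟨F, hF⟩ := exists_bound_specDensity_sq (P := P) (Z := Z) hγ
  set f := specDensity P Z with hf
  let θ : ℕ × ℕ → ℤ × ℤ → ℝ := fun c i =>
    ψ (fourierFreq c i) * (ψ (fourierFreq c i) + ψ (fourierFreq c (-i)))
  let s : ℕ × ℕ → ℤ × ℤ → Ω → ℝ := fun n i x => blockMean n (b n) fun l =>
    (periodogram Z l (b n) (fourierFreq (b n) i) x -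
      blockMean n (b n) fun l' => periodogram Z l' (b n) (fourierFreq (b n) i) x) ^ 2
  have hs : ∀ n i, Integrable (s n i) P := fun n i =>
    h.integrable_periodogram_variance n (b n) (fourierFreq (b n) i)
  have hθ : ∀ c, ∀ i ∈ fourierIndex c, |θ c i| ≤ B * (B + B) := by
    intro c i hi
    have hm := fourierFreq_mem (fourierIndex_subset c hi)
    simp only [θ]
    rw [abs_mul, fourierFreq_neg]
    refine mul_le_mul (hB _ hm) ((abs_add_le _ _).trans
      (add_le_add (hB _ hm) (hB _ (neg_mem_freqSquare hm)))) (abs_nonneg _) hB0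
  have hθw : ∀ᵐ w ∂(volume : Measure (ℝ × ℝ)).restrict freqSquare,
      Tendsto (fun c => θ c (gridIndex c w)) atTop (𝓝 (ψ w * (ψ w + ψ (-w)))) := by
    filter_upwards [hψ.ae_continuousWithinAt, ae_isRegularFreq] with w h1 h2
    obtain ⟨p1, p2⟩ := tendsto_grid_of_continuousWithinAt h2 h1
    exact p1.mul (p1.add p2)
  have hfw : ∀ w, Tendsto (fun c => f (fourierFreq c (gridIndex c w)) ^ 2) atTop
      (𝓝 (f w ^ 2)) := fun w =>
    (((continuous_specDensity hγ).tendsto w).comp (tendsto_fourierFreq_gridIndex w)).pow 2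
  -- Deterministic part: the estimator with each sample variance replaced by f² at the Fourier
  -- frequency.
  have hRiemann : Tendsto (fun n => (size (b n))⁻¹ • ∑ i ∈ fourierIndex (b n),
      θ (b n) i * f (fourierFreq (b n) i) ^ 2) atTop
      (𝓝 (((2 * Real.pi) ^ 2)⁻¹ • ∫ w in freqSquare, ψ w * (ψ w + ψ (-w)) * f w ^ 2)) := by
    refine tendsto_fourier_average hb.tendsto_atTop
      (fun n i => θ (b n) i * f (fourierFreq (b n) i) ^ 2) _ (B * (B + B) * F) ?_ ?_
    · refine Eventually.of_forall fun n i hi => ?_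
      rw [norm_mul, Real.norm_eq_abs, Real.norm_of_nonneg (sq_nonneg _)]
      exact mul_le_mul (hθ _ i hi) (hF _) (sq_nonneg _) (by positivity)
    · filter_upwards [hθw] with w hw
      exact (hw.mul (hfw w)).comp hb.tendsto_atTop
  -- Random part: the L¹ error at each frequency. It tends to zero at almost every ω and is bounded
  -- uniformly, so its average over the grid tends to zero.
  let T : ℕ × ℕ → ℤ × ℤ → ℝ := fun n i =>
    |θ (b n) i| * ∫ x, |s n i x - f (fourierFreq (b n) i) ^ 2| ∂P
  have hT : Tendsto (fun n => (size (b n))⁻¹ • ∑ i ∈ fourierIndex (b n), T n i) atTop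
      (𝓝 (((2 * Real.pi) ^ 2)⁻¹ • ∫ _ in freqSquare, (0 : ℝ))) := by
    refine tendsto_fourier_average hb.tendsto_atTop T _ (B * (B + B) * (C + F)) ?_ ?_
    · filter_upwards [hb.eventually_nonempty] with n hne i hi
      have hInt : ∫ x, |s n i x - f (fourierFreq (b n) i) ^ 2| ∂P ≤ C + F := by
        have iI : ∀ l, Integrable
            (fun x => periodogram Z l (b n) (fourierFreq (b n) i) x ^ 2) P :=
          fun l => (h.memLp_periodogram l (b n) _).integrable_sq
        calc ∫ x, |s n i x - f (fourierFreq (b n) i) ^ 2| ∂P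
            ≤ ∫ x, (blockMean n (b n) (fun l =>
                periodogram Z l (b n) (fourierFreq (b n) i) x ^ 2) + F) ∂P := by
              refine integral_mono ((hs n i).sub (integrable_const _)).abs
                ((integrable_blockMean iI).add (integrable_const _)) fun x => ?_
              have h0 : 0 ≤ s n i x := blockMean_nonneg fun l => sq_nonneg _
              -- A sample variance is at most the mean square, whose expectation is bounded by C at
              -- all nonzero Fourier frequencies.
              have h1 : s n i x ≤ blockMean n (b n) (fun l =>
                  periodogram Z l (b n) (fourierFreq (b n) i) x ^ 2) := by
                simp only [s]
                rw [blockMean_sub_blockMean_sq hne]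
                linarith [sq_nonneg (blockMean n (b n) fun l' =>
                  periodogram Z l' (b n) (fourierFreq (b n) i) x)]
              refine (abs_sub _ _).trans ?_
              rw [abs_of_nonneg h0, abs_of_nonneg (sq_nonneg _)]
              exact add_le_add h1 (hF _)
          _ ≤ C + F := by
              rw [integral_add (integrable_blockMean iI) (integrable_const _),
                integral_blockMean iI]
              simp_rw [fun l => h.integral_periodogram_sq_shift l hi]
              rw [blockMean_const hne]
              refine add_le_add (hC (b n) i hi) ?_
              simp
      simp only [T]
      rw [Real.norm_of_nonneg (mul_nonneg (abs_nonneg _)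
        (integral_nonneg fun x => abs_nonneg _))]
      exact mul_le_mul (hθ _ i hi) hInt (integral_nonneg fun x => abs_nonneg _) (by positivity)
    · filter_upwards [hθw, ae_isRegularFreq] with w h1 h2
      have t1 := h.tendsto_periodogram_variance hγ hκ hper hb h2
      have t2 : Tendsto (fun n => |f w ^ 2 -
          f (fourierFreq (b n) (gridIndex (b n) w)) ^ 2|) atTop (𝓝 0) := by
        have := (((hfw w).comp hb.tendsto_atTop).const_sub (f w ^ 2)).abs
        simpa using this
      have t3 : Tendsto (fun n => ∫ x, |s n (gridIndex (b n) w) x -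
          f (fourierFreq (b n) (gridIndex (b n) w)) ^ 2| ∂P) atTop (𝓝 0) := by
        have t4 := t1.add t2
        rw [add_zero] at t4
        refine squeeze_zero (fun n => integral_nonneg fun x => abs_nonneg _) (fun n => ?_) t4
        set a := f (fourierFreq (b n) (gridIndex (b n) w)) ^ 2
        have i1 : Integrable (fun x => |s n (gridIndex (b n) w) x - f w ^ 2|) P :=
          ((hs n _).sub (integrable_const _)).abs
        calc ∫ x, |s n (gridIndex (b n) w) x - a| ∂P
            ≤ ∫ x, (|s n (gridIndex (b n) w) x - f w ^ 2| + |f w ^ 2 - a|) ∂P :=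
              integral_mono ((hs n _).sub (integrable_const _)).abs
                (i1.add (integrable_const _)) fun x => abs_sub_le _ _ _
          _ = _ := by
              rw [integral_add i1 (integrable_const _)]
              simp [s, hf]
      have t5 := ((h1.comp hb.tendsto_atTop).abs).mul t3
      rw [mul_zero] at t5
      exact t5
  simp only [integral_zero, smul_zero] at hT
  have t6 := (hRiemann.const_mul ((4 * Real.pi ^ 2) ^ 2)).sub_const (sigmaSq1 P Z ψ)
  -- The constant (4π²)² = (2π)⁴ of the estimator meets (2π)⁻² from the grid average, leaving the
  -- (2π)² of σ₁².
  have e1 : (4 * Real.pi ^ 2) ^ 2 * (((2 * Real.pi) ^ 2)⁻¹ •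
      ∫ w in freqSquare, ψ w * (ψ w + ψ (-w)) * f w ^ 2) - sigmaSq1 P Z ψ = 0 := by
    rw [sigmaSq1, smul_eq_mul, ← mul_assoc, sub_eq_zero]
    congr 1
    field_simp
    ring
  rw [e1] at t6
  have t7 := (hT.const_mul ((4 * Real.pi ^ 2) ^ 2)).add t6.abs
  simp only [mul_zero, abs_zero, add_zero] at t7
  refine squeeze_zero (fun n => integral_nonneg fun x => abs_nonneg _) (fun n => ?_) t7
  set R := (4 * Real.pi ^ 2) ^ 2 * ((size (b n))⁻¹ • ∑ i ∈ fourierIndex (b n),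
      θ (b n) i * f (fourierFreq (b n) i) ^ 2) with hR
  have hInt : ∀ i, Integrable
      (fun x => |θ (b n) i| * |s n i x - f (fourierFreq (b n) i) ^ 2|) P := fun i =>
    ((hs n i).sub (integrable_const _)).abs.const_mul _
  have i1 : Integrable (fun x => (4 * Real.pi ^ 2) ^ 2 * ((size (b n))⁻¹ *
      ∑ i ∈ fourierIndex (b n), |θ (b n) i| * |s n i x - f (fourierFreq (b n) i) ^ 2|)) P :=
    ((integrable_finsetSum _ fun i _ => hInt i).const_mul _).const_mul _
  calc ∫ x, |sigmaHatSq1 Z ψ n (b n) x - sigmaSq1 P Z ψ| ∂P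
      ≤ ∫ x, ((4 * Real.pi ^ 2) ^ 2 * ((size (b n))⁻¹ *
          ∑ i ∈ fourierIndex (b n), |θ (b n) i| * |s n i x - f (fourierFreq (b n) i) ^ 2|) +
          |R - sigmaSq1 P Z ψ|) ∂P := by
        refine integral_mono ((h.integrable_sigmaHatSq1 ψ n (b n)).sub (integrable_const _)).abs
          (i1.add (integrable_const _)) fun x => ?_
        refine (abs_sub_le _ R _).trans (add_le_add ?_ le_rfl)
        have e2 : sigmaHatSq1 Z ψ n (b n) x - R = (4 * Real.pi ^ 2) ^ 2 * ((size (b n))⁻¹ *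
            ∑ i ∈ fourierIndex (b n), θ (b n) i * (s n i x - f (fourierFreq (b n) i) ^ 2)) := by
          simp_rw [mul_sub, Finset.sum_sub_distrib, mul_sub]
          rw [hR, smul_eq_mul, sigmaHatSq1]
          congr 1
          simp only [θ, s]
          ring
        rw [e2, abs_mul, abs_mul, abs_of_nonneg (by positivity : 0 ≤ (4 * Real.pi ^ 2) ^ 2),
          abs_of_nonneg (inv_nonneg.mpr (size_nonneg (b n)))]
        refine mul_le_mul_of_nonneg_left (mul_le_mul_of_nonneg_left ?_
          (inv_nonneg.mpr (size_nonneg (b n)))) (by positivity)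
        refine (Finset.abs_sum_le_sum_abs _ _).trans (le_of_eq ?_)
        exact Finset.sum_congr rfl fun i _ => abs_mul _ _
    _ = _ := by
        rw [integral_add i1 (integrable_const _), integral_const_mul, integral_const_mul,
          integral_finsetSum _ fun i _ => hInt i]
        simp_rw [integral_const_mul]
        simp [T]

end Consistency

end SpatialSubsampling

/-! ### Convergence in probability of the three estimators -/

theorem theorem1 {Ω : Type*} [MeasurableSpace Ω] (P : Measure Ω) [IsProbabilityMeasure P]
    (Z : ℤ × ℤ → Ω → ℝ) (ψ : ℝ × ℝ → ℝ) (b : ℕ × ℕ → ℕ × ℕ)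
    (hψ : BoundedVariationSquare ψ)
    (hγ : Summable fun h => |autocov P Z h|)
    (hκ : Summable fun h => |fieldCumulant4 P Z h|)
    (h1 : FourthOrderStationary P Z)
    (h2 : LimitLaw P Z ψ)
    (h3 : SeparatedLimitLaw P Z ψ)
    (h4 : SeparatedPeriodogramLaw P Z)
    (hb1 : Tendsto (fun n => (b n).1) atTop atTop)
    (hb2 : Tendsto (fun n => (b n).2) atTop atTop)
    (hbn1 : Tendsto (fun n : ℕ × ℕ => ((b n).1 : ℝ) / (n.1 : ℝ)) atTop (𝓝 0))
    (hbn2 : Tendsto (fun n : ℕ × ℕ => ((b n).2 : ℝ) / (n.2 : ℝ)) atTop (𝓝 0)) :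
    TendstoInMeasure P (fun (n : ℕ × ℕ) x => sigmaHatSq1 Z ψ n (b n) x) atTop
        (fun _ => sigmaSq1 P Z ψ) ∧
      TendstoInMeasure P (fun (n : ℕ × ℕ) x => sigmaHatSq2 Z ψ n (b n) x) atTop
        (fun _ => sigmaSq2 P Z ψ) ∧
      TendstoInMeasure P (fun (n : ℕ × ℕ) x => sigmaHatSq Z ψ n (b n) x) atTop
        (fun _ => sigmaSq1 P Z ψ + sigmaSq2 P Z ψ) := by
  have hb0 : Tendsto b atTop (atTop ×ˢ atTop) := hb1.prodMk hb2
  have hb : AdmissibleBlocks b :=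
    ⟨hb0.mono_right prod_atTop_atTop_eq.le, hbn1, hbn2⟩
  have t1 := h1.tendsto_sigmaHatSq1 hψ hγ hκ h4 hb
  have t := h1.tendsto_sigmaHatSq hψ hγ hκ h2 h3 hb
  have i1 := fun n => h1.integrable_sigmaHatSq1 ψ n (b n)
  have i := fun n => h1.integrable_sigmaHatSq ψ n (b n)
  refine ⟨tendstoInMeasure_of_tendsto_integral_abs i1 t1,
    tendstoInMeasure_of_tendsto_integral_abs (fun n => (i n).sub (i1 n)) ?_,
    tendstoInMeasure_of_tendsto_integral_abs i t⟩
  have t2 := t.add t1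
  rw [add_zero] at t2
  refine squeeze_zero (fun n => integral_nonneg fun x => abs_nonneg _) (fun n => ?_) t2
  have j : Integrable (fun x => |sigmaHatSq Z ψ n (b n) x - sigmaSq P Z ψ|) P :=
    ((i n).sub (integrable_const _)).abs
  have j1 : Integrable (fun x => |sigmaHatSq1 Z ψ n (b n) x - sigmaSq1 P Z ψ|) P :=
    ((i1 n).sub (integrable_const _)).abs
  rw [← integral_add j j1]
  refine integral_mono (((i n).sub (i1 n)).sub (integrable_const _)).abs (j.add j1) fun x => ?_
  -- The error of the second estimator is the difference of the two errors already known to vanish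
  -- in L¹.
  have e : sigmaHatSq Z ψ n (b n) x - sigmaHatSq1 Z ψ n (b n) x - sigmaSq2 P Z ψ =
      (sigmaHatSq Z ψ n (b n) x - sigmaSq P Z ψ) -
        (sigmaHatSq1 Z ψ n (b n) x - sigmaSq1 P Z ψ) := by
    rw [sigmaSq]
    ring
  change |sigmaHatSq Z ψ n (b n) x - sigmaHatSq1 Z ψ n (b n) x - sigmaSq2 P Z ψ| ≤ _
  rw [e]
  exact abs_sub _ _
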